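/- Let $\mathcal X\subset\mathbb R^d$ be non-empty and let $f\sim\mathcal{GP}(0,k)$ on $\mathcal X$ with $0<k(x,x)\le 1$ for all $x\in\mathcal X$. In round $t=1,2,\dots$ a point $x_t\in\mathcal X$ is chosen, by a measurable rule, from the past data $(x_i,y_i)_{i<t}$ and possibly internal randomness of the algorithm, and $y_t=f(x_t)+\epsilon_t$ is observed, where the $\epsilon_t\sim\mathcal N(0,\sigma^2)$, $\sigma>0$, are independent; $f$, $(\epsilon_t)_t$ and the internal randomness are independent. Let $$\mu_{t-1}(x)=\mathbf k_{t-1}(x)^\top(\mathbf K+\sigma^2\mathbf I)^{-1}\mathbf y_{t-1},\qquad \sigma_{t-1}^2(x)=k(x,x)-\mathbf k_{t-1}(x)^\top(\mathbf K+\sigma^2\mathbf I)^{-1}\mathbf k_{t-1}(x)$$ be the posterior mean and variance, where $\mathbf k_{t-1}(x)=(k(x,x_i))_{i<t}$, $\mathbf K=(k(x_i,x_j))_{i,j<t}$, $\mathbf y_{t-1}=(y_i)_{i<t}$; let $\mu_{t-1}^{\max}=\max_{x\in\mathcal X}\mu_{t-1}(x)$, and let $\mathrm{EI}(m,s,b)=s\,\tau((m-b)/s)$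 for $s>0$ and $\mathrm{EI}(m,0,b)=\max\{m-b,0\}$, where $\tau(c)=c\Phi(c)+\phi(c)$ and $\Phi,\phi$ are the standard normal distribution function and density. Let $\gamma_T=\max_{a_1,\dots,a_T\in\mathcal X} I\big((f(a_i)+\epsilon_i)_{i\le T};(f(a_i))_{i\le T}\big)$ be the maximum information gain ($I$ is Shannon mutual information, repetitions among the $a_i$ are allowed), and let $\mathrm{BCR}_T=\sum_{t=1}^T\mathbb E[f(x^*)-f(x_t)]$ with $f(x^*)=\max_{x\in\mathcal X}f(x)$. Assume one of the following. (i) $\mathcal X$ is finite, and $\beta_t=2\log\big(|\mathcal X|t^2/\sqrt{2\pi}+1\big)$. (ii) $\mathcal X\subseteq[0,r]^d$ is compact and convex, $r>0$; the sample paths of $f$ are almost surely differentiable on $\mathcal X$; there are $a\ge1$, $b>0$ such that $L_j=\sup_{x\in\mathcal X}|\partial f/\partial x_j|$ satisfies $\Pr(L_j>c)\le a\exp(-(c/b)^2)$ for all $c>0$ and $j=1,\dots,d$; and $\beta_t=2d\log\big(\lceil bdrt^2(\sqrt{\log(ad)}+\sqrt\pi/2)\rceil\big)+2\log\big(t^2/\sqrt{2\pi}+1\big)$.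 If $x_t\in\operatorname{argmax}_{x\in\mathcal X}\mathrm{EI}\big(\mu_{t-1}(x),\beta_t^{1/2}\sigma_{t-1}(x),\mu_{t-1}^{\max}\big)$ for every $t\ge1$, then each $f(x^*)-f(x_t)$ is integrable, and $$\mathrm{BCR}_T=O\big(\sqrt{\beta_T\gamma_T T\log T}\big);$$ that is, $\mathrm{BCR}_T\le C\sqrt{\beta_T\gamma_T T\log T}$ for all $T\ge2$, with a constant $C$ that depends only on $\sigma$ and on $\inf_{x\in\mathcal X}k(x,x)$. -/

import Mathlib

open MeasureTheory ProbabilityTheory InformationTheory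
open scoped ENNReal NNReal Matrix

universe u v

noncomputable section

namespace BO

section Posterior

variable {X : Type*} {n : ℕ}

/-- The matrix `K + σ² I`, where `K i j = k (xs i) (xs j)`. -/
def regGram (k : X → X → ℝ) (σ : ℝ) (xs : Fin n → X) : Matrix (Fin n) (Fin n) ℝ :=
  Matrix.of (fun i j => k (xs i) (xs j)) + σ ^ 2 • (1 : Matrix (Fin n) (Fin n) ℝ)

/-- The kernel vector `(k (z, xs 0), …, k (z, xs (n - 1)))`. -/
def kernelVec (k : X → X → ℝ) (xs : Fin n → X) (z : X) : Fin n → ℝ := fun i => k z (xs i)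

/-- The Gaussian process posterior mean at `z`, given the observations `ys` made at `xs`. -/
def postMean (k : X → X → ℝ) (σ : ℝ) (xs : Fin n → X) (ys : Fin n → ℝ) (z : X) : ℝ :=
  kernelVec k xs z ⬝ᵥ ((regGram k σ xs)⁻¹ *ᵥ ys)

/-- The Gaussian process posterior variance at `z`, given observations made at `xs`. -/
def postVar (k : X → X → ℝ) (σ : ℝ) (xs : Fin n → X) (z : X) : ℝ :=
  k z z - kernelVec k xs z ⬝ᵥ ((regGram k σ xs)⁻¹ *ᵥ kernelVec k xs z)

/-- The Gaussian process posterior standard deviation. -/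
def postStd (k : X → X → ℝ) (σ : ℝ) (xs : Fin n → X) (z : X) : ℝ := √(postVar k σ xs z)

/-- The maximum of the posterior mean over the input domain. -/
def postMeanMax (k : X → X → ℝ) (σ : ℝ) (xs : Fin n → X) (ys : Fin n → ℝ) : ℝ :=
  ⨆ z, postMean k σ xs ys z

end Posterior

/-- `τ(c) = c Φ(c) + φ(c)`, with `Φ`, `φ` the distribution function and the density of `N(0, 1)`. -/
def tau (c : ℝ) : ℝ := c * cdf (gaussianReal 0 1) c + gaussianPDFReal 0 1 c

/-- The expected improvement `EI(m, s, b)` over `b` of a Gaussian of mean `m` and standard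
deviation `s`. -/
def EI (m s b : ℝ) : ℝ := if 0 < s then s * tau ((m - b) / s) else max (m - b) 0

section Model

variable {Ω : Type*} [MeasurableSpace Ω] {Θ : Type*} [MeasurableSpace Θ] {X : Type*}

/-- The Bayesian model: the objective `f` is a Gaussian process with mean zero and covariance
kernel `k`, the noise variables `ε i` are independent with law `N(0, σ²)`, and the objective, the
noise and the internal randomness `U` of the algorithm are independent. -/
structure IsModel (P : Measure Ω) (k : X → X → ℝ) (σ : ℝ) (f : X → Ω → ℝ) (ε : ℕ → Ω → ℝ)
    (U : Ω → Θ) : Prop where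
  measurable_f : ∀ z, Measurable (f z)
  gaussian_f : IsGaussianProcess f P
  mean_f : ∀ z, ∫ ω, f z ω ∂P = 0
  cov_f : ∀ z w, cov[f z, f w; P] = k z w
  measurable_noise : ∀ i, Measurable (ε i)
  law_noise : ∀ i, P.map (ε i) = gaussianReal 0 (σ ^ 2).toNNReal
  indep_noise : iIndepFun ε P
  indep_f_noise : IndepFun (fun ω z => f z ω) (fun ω i => ε i ω) P
  measurable_U : Measurable U
  indep_U : IndepFun U (fun ω => ((fun z => f z ω), (fun i => ε i ω))) P

/-- `x n` is the point queried in round `n + 1`, where the observation `f (x n) + ε n` is made.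
It is chosen by a measurable rule from the internal randomness and the data of rounds `1, …, n`,
and it maximizes over the domain the expected improvement with posterior standard deviation
scaled by `√(β (n + 1))` and with the maximal posterior mean as reference value. -/
structure IsRescaledEIRun [MeasurableSpace X] (k : X → X → ℝ) (σ : ℝ) (β : ℕ → ℝ)
    (f : X → Ω → ℝ) (ε : ℕ → Ω → ℝ) (U : Ω → Θ) (x : ℕ → Ω → X) : Prop where
  rule : ∀ n, ∃ π : Θ × (Fin n → X × ℝ) → X, Measurable π ∧
    ∀ ω, x n ω = π (U ω, fun i => (x i ω, f (x i ω) ω + ε i ω))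
  isMax : ∀ n ω z,
    let xs : Fin n → X := fun i => x i ω
    let ys : Fin n → ℝ := fun i => f (x i ω) ω + ε i ω
    EI (postMean k σ xs ys z) (√(β (n + 1)) * postStd k σ xs z) (postMeanMax k σ xs ys) ≤
      EI (postMean k σ xs ys (x n ω)) (√(β (n + 1)) * postStd k σ xs (x n ω))
        (postMeanMax k σ xs ys)

/-- Shannon mutual information: the Kullback-Leibler divergence of the joint law from the
product of the marginal laws. -/
def mutualInfo {A B : Type*} [MeasurableSpace A] [MeasurableSpace B] (P : Measure Ω)
    (Y : Ω → A) (Z : Ω → B) : ℝ≥0∞ :=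
  klDiv (P.map (fun ω => (Y ω, Z ω))) ((P.map Y).prod (P.map Z))

/-- The maximum information gain `γ_T`: the largest mutual information between the values of `f`
at `T` points (repetitions allowed) and the noisy observations there. -/
def maxInfoGain (P : Measure Ω) (f : X → Ω → ℝ) (ε : ℕ → Ω → ℝ) (T : ℕ) : ℝ :=
  (⨆ A : Fin T → X, mutualInfo P (fun ω (i : Fin T) => f (A i) ω + ε i ω)
    (fun ω (i : Fin T) => f (A i) ω)).toReal

/-- The regret `f(x*) - f(x n)` of round `n + 1`, where `f(x*)` is the maximum of `f`. -/
def regret (f : X → Ω → ℝ) (x : ℕ → Ω → X) (n : ℕ) (ω : Ω) : ℝ := (⨆ z, f z ω) - f (x n ω) ω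

/-- The Bayesian cumulative regret of rounds `1, …, T`. -/
def BCR (P : Measure Ω) (f : X → Ω → ℝ) (x : ℕ → Ω → X) (T : ℕ) : ℝ :=
  ∑ n ∈ Finset.range T, ∫ ω, regret f x n ω ∂P

end Model

/-- The smoothness assumption on the sample paths over `S ⊆ ℝ^d`: almost surely `f` is
differentiable on `S`, with derivative `D`, and `L_j`, the supremum over `S` of the modulus of the
`j`-th partial derivative, satisfies `P (L_j > c) ≤ a exp (- (c / b) ^ 2)` for `c > 0`.
The function is differentiated as a function on `S`; its values elsewhere are irrelevant. -/
def SmoothPaths {Ω : Type*} [MeasurableSpace Ω] {d : ℕ} {S : Set (Fin d → ℝ)} (P : Measure Ω)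
    (f : S → Ω → ℝ) (a b : ℝ) : Prop :=
  ∃ D : S → Ω → ((Fin d → ℝ) →L[ℝ] ℝ),
    (∀ᵐ ω ∂P, ∀ z : S,
      HasFDerivWithinAt (Function.extend Subtype.val (fun w : S => f w ω) 0) (D z ω) S z) ∧
    ∀ (j : Fin d) (c : ℝ), 0 < c →
      P {ω | ENNReal.ofReal c < ⨆ z : S, ENNReal.ofReal |D z ω (Pi.single j 1)|} ≤
        ENNReal.ofReal (a * Real.exp (-(c / b) ^ 2))

/-- `β_t` for a finite domain with `N` points. -/
def betaFinite (N t : ℕ) : ℝ := 2 * Real.log (N * t ^ 2 / √(2 * Real.pi) + 1)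

/-- `β_t` for a compact convex domain contained in `[0, r]^d`. -/
def betaConvex (d : ℕ) (r a b : ℝ) (t : ℕ) : ℝ :=
  2 * d * Real.log (⌈b * d * r * t ^ 2 * (√(Real.log (a * d)) + √Real.pi / 2)⌉ : ℤ) +
    2 * Real.log (t ^ 2 / √(2 * Real.pi) + 1)

end BO

end

/-!
The proof compares the algorithm with upper confidence bounds. Write `m` and `s` for the posterior
mean and standard deviation before a round, `x` for the queried point and `x₁` for a maximizer
of `m`.

*Near-maximization.* Since `τ(c)` dominates a multiple of `1 + c` and `τ(c) ≤ φ(c)` for `c ≤ 0`, a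
maximizer `x` of the expected improvement over `m x₁` satisfies
`m z + √β s z ≤ m x + √β (1 / gaussianTail + √(2 log (s x / s x₁))) s x` for all `z`
(`add_le_of_EI_max`, `le_add_of_EI_max`). After `n` observations the posterior variance is still
at least `k z z σ² / (n + σ²)` (`IsModel.le_postVar`), so the ratio costs only a logarithm of `n`
(`upperConfidence_le_of_run`).

*The posterior.* The points are chosen adaptively, so it has to be proved that the formulas for
`m` and `s` describe the conditional law of `f`: `(f ζ - m ζ) / s ζ` is a standard Gaussian
variable independent of the data, for every point `ζ` determined by the data
(`IsModel.map_run_standardized`). For a fixed design this is the uncorrelatedness of the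
prediction error with the observations. It is reformulated as an identity between integrals
against the likelihood of the data `e`, which holds for every `e` by continuity
(`IsModel.bayesIntegral_eq`). The law of the data of an adaptive run has the same likelihood as
its density, with points that depend on `e` (`IsModel.map_run_data`), and by Fubini's theorem the
identity may be applied for each `e` to the design that belongs to it.

*One round.* The maximum of `f` is compared with its values on a finite net (`HasNet`), and there
with the upper confidence bounds; the excess over these has expectation at most
`τ(-√β) ≤ exp (-β / 2) / √(2π)` per point of the net. The error `f x - m x` at the queried point
has expectation zero. Hence the expected regret is at most a summable term plus a
multiple of the expectation of `s x` (`integral_regret_le`).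

*Summation.* The mutual information between the values of `f` at a sequence of points and the
observations there is the sum of `log (1 + s² / σ²) / 2` (`IsModel.mutualInfo_eq`), so the sum of
the `s²` along every run is at most `2 (1 + σ²) γ_T` (`sum_postVar_le`), and the Cauchy–Schwarz
inequality gives the bound for all domains with nets (`regret_bound`). A finite domain is its own
net. For a convex domain, the partial derivatives have integrable majorants by their tail bounds
(`exists_integrable_ge_of_gaussian_tail`), which bound the Lipschitz constant of the paths, and
the nets come from a subdivision of the cube (`exists_net_of_subset_cube`).
-/

noncomputable section

set_option linter.unusedSectionVars false

namespace BO

/-! ### Expected improvement -/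

lemma hasDerivAt_neg_gaussianPDFReal (w : ℝ) :
    HasDerivAt (fun w => -gaussianPDFReal 0 1 w) (w * gaussianPDFReal 0 1 w) w := by
  have h : HasDerivAt (fun w : ℝ => -((√(2 * Real.pi))⁻¹ * Real.exp (-w ^ 2 / 2)))
      (-((√(2 * Real.pi))⁻¹ * (Real.exp (-w ^ 2 / 2) * (-(2 * w) / 2)))) w := by
    refine (HasDerivAt.const_mul _ (HasDerivAt.exp ?_)).neg
    have := ((hasDerivAt_pow 2 w).neg).div_const 2
    simpa using this
  convert h using 1
  · ext w; simp [gaussianPDFReal]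
  · simp [gaussianPDFReal]; ring

lemma integrable_id_gaussianReal : Integrable (fun w : ℝ => w) (gaussianReal 0 1) :=
  (memLp_id_gaussianReal 1).integrable (by simp)

lemma tendsto_gaussianPDFReal_atTop :
    Filter.Tendsto (gaussianPDFReal 0 1) Filter.atTop (nhds 0) := by
  have h : gaussianPDFReal 0 1 = fun w : ℝ => (√(2 * Real.pi))⁻¹ * Real.exp (-(w ^ 2 / 2)) := by
    ext w; simp [gaussianPDFReal, neg_div]
  rw [h]
  have h2 : Filter.Tendsto (fun w : ℝ => w ^ 2 / 2) Filter.atTop Filter.atTop :=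
    (Filter.tendsto_pow_atTop (by norm_num)).atTop_div_const (by norm_num)
  simpa using (Real.tendsto_exp_neg_atTop_nhds_zero.comp h2).const_mul ((√(2 * Real.pi))⁻¹)

lemma integral_Ioi_id_gaussianReal (a : ℝ) :
    ∫ w in Set.Ioi a, w ∂(gaussianReal 0 1) = gaussianPDFReal 0 1 a := by
  have hint : Integrable (fun w : ℝ => w * gaussianPDFReal 0 1 w) := by
    have := integrable_id_gaussianReal
    rw [gaussianReal_of_var_ne_zero _ one_ne_zero,
      integrable_withDensity_iff_integrable_smul' (measurable_gaussianPDF 0 1)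
        (Filter.Eventually.of_forall fun _ => gaussianPDF_lt_top)] at this
    simpa [toReal_gaussianPDF, mul_comm] using this
  rw [gaussianReal_of_var_ne_zero _ one_ne_zero,
    setIntegral_withDensity_eq_setIntegral_toReal_smul (measurable_gaussianPDF 0 1)
      (Filter.Eventually.of_forall fun _ => gaussianPDF_lt_top) _ measurableSet_Ioi]
  have := integral_Ioi_of_hasDerivAt_of_tendsto' (a := a)
    (fun w _ => hasDerivAt_neg_gaussianPDFReal w) hint.integrableOn
    (by simpa using tendsto_gaussianPDFReal_atTop.neg)
  simpa [toReal_gaussianPDF, mul_comm] using this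

lemma integrable_max_add_gaussianReal (c : ℝ) :
    Integrable (fun w : ℝ => max (c + w) 0) (gaussianReal 0 1) :=
  ((integrable_const c).add integrable_id_gaussianReal).sup (integrable_const 0)

/-- `τ(c)` is the expected positive part of a Gaussian of mean `c` and variance one. -/
lemma tau_eq_integral (c : ℝ) : tau c = ∫ w, max (c + w) 0 ∂(gaussianReal 0 1) := by
  have h1 : (fun w : ℝ => max (c + w) 0) = (Set.Ioi (-c)).indicator (fun w => c + w) := by
    ext w
    by_cases hw : w ∈ Set.Ioi (-c)
    · rw [Set.indicator_of_mem hw, max_eq_left]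
      have : -c < w := hw
      linarith
    · rw [Set.indicator_of_notMem hw, max_eq_right]
      have : w ≤ -c := by simpa using hw
      linarith
  have hsymm : (gaussianReal 0 1).real (Set.Ioi (-c)) = cdf (gaussianReal 0 1) c := by
    rw [cdf_eq_real, measureReal_def, measureReal_def]
    congr 1
    have : gaussianReal 0 1 (Set.Iio c) = gaussianReal 0 1 (Set.Iic c) := by
      have := nullSingletonClass_gaussianReal (μ := 0) (v := 1) one_ne_zero
      exact measure_congr Iio_ae_eq_Iic
    rw [← this]
    conv_lhs => rw [← neg_zero (G := ℝ), ← gaussianReal_map_neg]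
    rw [Measure.map_apply measurable_neg measurableSet_Ioi]
    simp
  rw [h1, integral_indicator measurableSet_Ioi,
    integral_add (integrable_const c).integrableOn integrable_id_gaussianReal.integrableOn,
    integral_Ioi_id_gaussianReal, tau]
  simp only [integral_const, smul_eq_mul, measureReal_restrict_apply_univ, hsymm]
  simp [gaussianPDFReal, mul_comm]

lemma tau_le_gaussianPDFReal {c : ℝ} (hc : c ≤ 0) : tau c ≤ gaussianPDFReal 0 1 c := by
  have := mul_nonpos_of_nonpos_of_nonneg hc (cdf_nonneg (gaussianReal 0 1) c)
  simp only [tau]; linarith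

/-- The probability that a standard Gaussian exceeds one. -/
def gaussianTail : ℝ := (gaussianReal 0 1).real (Set.Ici 1)

lemma gaussianTail_pos : 0 < gaussianTail := by
  rw [gaussianTail, measureReal_def, ENNReal.toReal_pos_iff]
  refine ⟨pos_iff_ne_zero.2 fun h => ?_, measure_lt_top _ _⟩
  have := gaussianReal_absolutelyContinuous' 0 (v := 1) one_ne_zero h
  simp at this

/-- `τ` dominates a fixed positive multiple of `1 + c`: this is what turns a maximizer of the
expected improvement into a near-maximizer of the upper confidence bound. -/
lemma gaussianTail_mul_le_tau (c : ℝ) : gaussianTail * (1 + c) ≤ tau c := by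
  rw [tau_eq_integral]
  have h1 : gaussianTail * (1 + c) =
      ∫ w, (Set.Ici (1 : ℝ)).indicator (fun _ => 1 + c) w ∂(gaussianReal 0 1) := by
    rw [integral_indicator measurableSet_Ici]
    simp [gaussianTail]
  rw [h1]
  refine integral_mono ((integrable_const _).indicator measurableSet_Ici)
    (integrable_max_add_gaussianReal c) fun w => ?_
  by_cases hw : w ∈ Set.Ici (1 : ℝ)
  · simp only [Set.indicator_of_mem hw]
    have : 1 ≤ w := hw
    exact le_max_of_le_left (by linarith)
  · simp [Set.indicator_of_notMem hw]

lemma gaussianPDFReal_zero_one (c : ℝ) :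
    gaussianPDFReal 0 1 c = (√(2 * Real.pi))⁻¹ * Real.exp (-c ^ 2 / 2) := by
  simp [gaussianPDFReal]

lemma inv_sqrt_two_pi_le_one : (√(2 * Real.pi))⁻¹ ≤ 1 := by
  apply inv_le_one_of_one_le₀
  rw [Real.one_le_sqrt]
  nlinarith [Real.pi_gt_three]

section Maximizer

variable {X : Type*} {m s : X → ℝ} {x₀ x₁ : X}

/-- If `x₀` maximizes the expected improvement over the largest mean `m x₁`, then the upper
confidence bounds `m + s` exceed `m x₁` by at most a constant times `s x₀`. -/
lemma add_le_of_EI_max (hs : ∀ z, 0 < s z) (hm : ∀ z, m z ≤ m x₁)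
    (hmax : ∀ z, EI (m z) (s z) (m x₁) ≤ EI (m x₀) (s x₀) (m x₁)) (z : X) :
    m z + s z ≤ m x₁ + s x₀ / gaussianTail := by
  have hδ := gaussianTail_pos
  have hz := hmax z
  simp only [EI, hs, if_true] at hz
  have h0 : (m x₀ - m x₁) / s x₀ ≤ 0 :=
    div_nonpos_of_nonpos_of_nonneg (by linarith [hm x₀]) (hs x₀).le
  have h1 : tau ((m x₀ - m x₁) / s x₀) ≤ 1 := by
    refine (tau_le_gaussianPDFReal h0).trans ?_
    rw [gaussianPDFReal_zero_one]
    refine mul_le_one₀ inv_sqrt_two_pi_le_one (Real.exp_nonneg _) ?_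
    rw [Real.exp_le_one_iff]
    nlinarith [sq_nonneg ((m x₀ - m x₁) / s x₀)]
  have h2 : s z * tau ((m z - m x₁) / s z) ≤ s x₀ :=
    hz.trans (mul_le_of_le_one_right (hs x₀).le h1)
  have h4 : s z * (gaussianTail * (1 + (m z - m x₁) / s z)) ≤ s x₀ :=
    (mul_le_mul_of_nonneg_left (gaussianTail_mul_le_tau _) (hs z).le).trans h2
  have h5 : s z * (gaussianTail * (1 + (m z - m x₁) / s z)) =
      (m z + s z - m x₁) * gaussianTail := by
    have := (hs z).ne'
    field_simp
    ring
  rw [h5, ← le_div_iff₀ hδ] at h4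
  linarith

/-- If `x₀` maximizes the expected improvement over the largest mean `m x₁`, then the mean at `x₀`
is not far below `m x₁`: the improvement expected at `x₁` is proportional to `s x₁`, while the one
at `x₀` decays exponentially in the squared gap. -/
lemma le_add_of_EI_max (hs : ∀ z, 0 < s z) (hm : ∀ z, m z ≤ m x₁)
    (hmax : ∀ z, EI (m z) (s z) (m x₁) ≤ EI (m x₀) (s x₀) (m x₁)) :
    m x₁ ≤ m x₀ + s x₀ * √(2 * Real.log (s x₀ / s x₁)) := by
  have hz := hmax x₁
  simp only [EI, hs, if_true, sub_self, zero_div] at hz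
  set c := (m x₀ - m x₁) / s x₀ with hcdef
  have h0 : c ≤ 0 := div_nonpos_of_nonpos_of_nonneg (by linarith [hm x₀]) (hs x₀).le
  have h1 : s x₁ * (√(2 * Real.pi))⁻¹ ≤ s x₀ * ((√(2 * Real.pi))⁻¹ * Real.exp (-c ^ 2 / 2)) := by
    calc s x₁ * (√(2 * Real.pi))⁻¹ = s x₁ * tau 0 := by simp [tau, gaussianPDFReal_zero_one]
      _ ≤ _ := hz
      _ ≤ _ := by
        rw [← gaussianPDFReal_zero_one]
        exact mul_le_mul_of_nonneg_left (tau_le_gaussianPDFReal h0) (hs x₀).le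
  have hpi : 0 < (√(2 * Real.pi))⁻¹ := by positivity
  have h2 : s x₁ ≤ s x₀ * Real.exp (-c ^ 2 / 2) := by
    have : s x₁ * (√(2 * Real.pi))⁻¹ ≤ (s x₀ * Real.exp (-c ^ 2 / 2)) * (√(2 * Real.pi))⁻¹ := by
      linarith
    exact le_of_mul_le_mul_right this hpi
  have h3 : c ^ 2 / 2 ≤ Real.log (s x₀ / s x₁) := by
    rw [Real.le_log_iff_exp_le (div_pos (hs x₀) (hs x₁)), le_div_iff₀ (hs x₁)]
    calc Real.exp (c ^ 2 / 2) * s x₁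
        ≤ Real.exp (c ^ 2 / 2) * (s x₀ * Real.exp (-c ^ 2 / 2)) := by gcongr
      _ = s x₀ * (Real.exp (c ^ 2 / 2) * Real.exp (-c ^ 2 / 2)) := by ring
      _ = s x₀ := by rw [← Real.exp_add]; ring_nf; simp
  have h4 : -c ≤ √(2 * Real.log (s x₀ / s x₁)) := Real.le_sqrt_of_sq_le (by nlinarith)
  have h5 : m x₀ - m x₁ = s x₀ * c := by rw [hcdef]; field_simp [(hs x₀).ne']
  nlinarith [mul_le_mul_of_nonneg_left h4 (hs x₀).le]

end Maximizer

/-! ### Linear regression on noisy observations -/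

section Regression

variable {Ω : Type*} [MeasurableSpace Ω] {Θ : Type*} [MeasurableSpace Θ] {X : Type*}
  {P : Measure Ω} [IsProbabilityMeasure P] {k : X → X → ℝ} {σ : ℝ} {f : X → Ω → ℝ}
  {ε : ℕ → Ω → ℝ} {U : Ω → Θ}

/-- The noisy observations at the points of a fixed design. -/
def obs (f : X → Ω → ℝ) (ε : ℕ → Ω → ℝ) {n : ℕ} (a : Fin n → X) (ω : Ω) : Fin n → ℝ :=
  fun i => f (a i) ω + ε i ω

/-- The coefficients of the best linear predictor of the value at `z` given noisy observations
at the points `a`. -/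
def postWeights (k : X → X → ℝ) (σ : ℝ) {n : ℕ} (a : Fin n → X) (z : X) : Fin n → ℝ :=
  (regGram k σ a)⁻¹ *ᵥ kernelVec k a z

namespace IsModel

lemma memLp_f (hM : IsModel P k σ f ε U) (z : X) : MemLp (f z) 2 P :=
  (hM.gaussian_f.hasGaussianLaw_eval z).memLp_two

lemma kernel_comm (hM : IsModel P k σ f ε U) (z w : X) : k z w = k w z := by
  rw [← hM.cov_f, ← hM.cov_f, covariance_comm]

lemma variance_f (hM : IsModel P k σ f ε U) (z : X) : Var[f z; P] = k z z := by
  rw [← hM.cov_f, covariance_self (hM.measurable_f z).aemeasurable]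

lemma hasGaussianLaw_noise (hM : IsModel P k σ f ε U) (i : ℕ) : HasGaussianLaw (ε i) P :=
  HasLaw.hasGaussianLaw ⟨(hM.measurable_noise i).aemeasurable, hM.law_noise i⟩

lemma memLp_noise (hM : IsModel P k σ f ε U) (i : ℕ) : MemLp (ε i) 2 P :=
  (hM.hasGaussianLaw_noise i).memLp_two

lemma integral_noise (hM : IsModel P k σ f ε U) (i : ℕ) : ∫ ω, ε i ω ∂P = 0 := by
  have h := HasLaw.integral_eq ⟨(hM.measurable_noise i).aemeasurable, hM.law_noise i⟩
  rw [h, integral_id_gaussianReal]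

lemma variance_noise (hM : IsModel P k σ f ε U) (i : ℕ) : Var[ε i; P] = σ ^ 2 := by
  have h := HasLaw.variance_eq ⟨(hM.measurable_noise i).aemeasurable, hM.law_noise i⟩
  rw [h, variance_id_gaussianReal, Real.coe_toNNReal _ (sq_nonneg σ)]

lemma cov_noise (hM : IsModel P k σ f ε U) (i j : ℕ) :
    cov[ε i, ε j; P] = if i = j then σ ^ 2 else 0 := by
  split_ifs with h
  · subst h
    rw [covariance_self (hM.measurable_noise i).aemeasurable, hM.variance_noise]
  · exact (hM.indep_noise.indepFun h).covariance_eq_zero (hM.memLp_noise i) (hM.memLp_noise j)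

lemma cov_f_noise (hM : IsModel P k σ f ε U) (z : X) (i : ℕ) : cov[f z, ε i; P] = 0 := by
  have h : IndepFun (f z) (ε i) P :=
    hM.indep_f_noise.comp (measurable_pi_apply z) (measurable_pi_apply i)
  exact h.covariance_eq_zero (hM.memLp_f z) (hM.memLp_noise i)

lemma memLp_obs (hM : IsModel P k σ f ε U) {n : ℕ} (a : Fin n → X) (i : Fin n) :
    MemLp (fun ω => obs f ε a ω i) 2 P :=
  (hM.memLp_f _).add (hM.memLp_noise _)

lemma measurable_obs (hM : IsModel P k σ f ε U) {n : ℕ} (a : Fin n → X) :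
    Measurable (obs f ε a) :=
  measurable_pi_lambda _ fun _ => (hM.measurable_f _).add (hM.measurable_noise _)

lemma cov_f_obs (hM : IsModel P k σ f ε U) {n : ℕ} (a : Fin n → X) (z : X) (i : Fin n) :
    cov[f z, fun ω => obs f ε a ω i; P] = kernelVec k a z i := by
  have h := covariance_add_right (hM.memLp_f z) (hM.memLp_f (a i)) (hM.memLp_noise i)
  rw [hM.cov_f, hM.cov_f_noise, add_zero] at h
  exact h

lemma cov_obs (hM : IsModel P k σ f ε U) {n : ℕ} (a : Fin n → X) (i j : Fin n) :
    cov[fun ω => obs f ε a ω i, fun ω => obs f ε a ω j; P] = regGram k σ a i j := by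
  have h := covariance_add_left (hM.memLp_f (a i)) (hM.memLp_noise i) (hM.memLp_obs a j)
  have h2 := covariance_add_right (hM.memLp_noise i) (hM.memLp_f (a j)) (hM.memLp_noise j)
  rw [covariance_comm (X := ε i) (Y := f (a j)), hM.cov_f_noise, hM.cov_noise, zero_add] at h2
  rw [hM.cov_f_obs] at h
  refine h.trans ?_
  have h3 : cov[ε i, fun ω => obs f ε a ω j; P] = _ := h2
  rw [h3]
  simp [regGram, kernelVec, Matrix.one_apply, Fin.ext_iff]

lemma regGram_posDef (hM : IsModel P k σ f ε U) (hσ : 0 < σ) {n : ℕ} (a : Fin n → X) :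
    (regGram k σ a).PosDef := by
  have hpsd : (Matrix.of fun i j => k (a i) (a j)).PosSemidef := by
    refine Matrix.PosSemidef.of_dotProduct_mulVec_nonneg ?_ fun w => ?_
    · ext i j
      simpa using hM.kernel_comm (a j) (a i)
    · have h := covariance_fun_sum_fun_sum (μ := P) (X := fun i ω => w i * f (a i) ω)
        (Y := fun i ω => w i * f (a i) ω) (fun i => (hM.memLp_f (a i)).const_mul (w i))
        (fun i => (hM.memLp_f (a i)).const_mul (w i))
      have h2 : star w ⬝ᵥ (Matrix.of fun i j => k (a i) (a j)) *ᵥ w =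
          Var[fun ω => ∑ i, w i * f (a i) ω; P] := by
        rw [← covariance_self, h]
        · simp only [covariance_const_mul_left, covariance_const_mul_right, hM.cov_f]
          simp only [dotProduct, Matrix.mulVec, Finset.mul_sum, Matrix.of_apply]
          refine Finset.sum_congr rfl fun i _ => Finset.sum_congr rfl fun j _ => ?_
          simp; ring
        · exact (Finset.measurable_fun_sum _ fun i _ =>
            (hM.measurable_f (a i)).const_mul _).aemeasurable
      rw [h2]
      exact variance_nonneg _ _
  exact Matrix.PosDef.posSemidef_add hpsd (Matrix.PosDef.one.smul (by positivity))

lemma isUnit_regGram (hM : IsModel P k σ f ε U) (hσ : 0 < σ) {n : ℕ} (a : Fin n → X) :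
    IsUnit (regGram k σ a) := (hM.regGram_posDef hσ a).isUnit

lemma regGram_mulVec_postWeights (hM : IsModel P k σ f ε U) (hσ : 0 < σ) {n : ℕ}
    (a : Fin n → X) (z : X) :
    regGram k σ a *ᵥ postWeights k σ a z = kernelVec k a z := by
  rw [postWeights, Matrix.mulVec_mulVec, Matrix.mul_nonsing_inv, Matrix.one_mulVec]
  exact (Matrix.isUnit_iff_isUnit_det _).1 (hM.isUnit_regGram hσ a)

lemma regGram_comm (hM : IsModel P k σ f ε U) {n : ℕ} (a : Fin n → X) (i j : Fin n) :
    regGram k σ a i j = regGram k σ a j i := by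
  rw [← hM.cov_obs, ← hM.cov_obs, covariance_comm]

lemma postMean_eq (hM : IsModel P k σ f ε U) {n : ℕ} (a : Fin n → X) (y : Fin n → ℝ) (z : X) :
    postMean k σ a y z = ∑ i, postWeights k σ a z i * y i := by
  have hT : (regGram k σ a)ᵀ = regGram k σ a := by
    ext i j; exact hM.regGram_comm a j i
  rw [postMean, Matrix.dotProduct_mulVec, ← Matrix.mulVec_transpose, Matrix.transpose_nonsing_inv,
    hT]
  rfl

/-- The prediction error of the posterior mean for a fixed design. -/
lemma memLp_sub_postMean (hM : IsModel P k σ f ε U) {n : ℕ} (a : Fin n → X) (z : X) :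
    MemLp (fun ω => f z ω - postMean k σ a (obs f ε a ω) z) 2 P := by
  simp only [hM.postMean_eq]
  exact (hM.memLp_f z).sub (memLp_finsetSum _ fun i _ => (hM.memLp_obs a i).const_mul _)

/-- The normal equations: the prediction error is uncorrelated with the observations. -/
lemma cov_sub_postMean_obs (hM : IsModel P k σ f ε U) (hσ : 0 < σ) {n : ℕ} (a : Fin n → X)
    (z : X) (j : Fin n) :
    cov[fun ω => f z ω - postMean k σ a (obs f ε a ω) z, fun ω => obs f ε a ω j; P] = 0 := by
  simp only [hM.postMean_eq]
  rw [covariance_fun_sub_left (hM.memLp_f z)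
    (memLp_finsetSum _ fun i _ => (hM.memLp_obs a i).const_mul _) (hM.memLp_obs a j),
    hM.cov_f_obs, covariance_fun_sum_left (fun i => (hM.memLp_obs a i).const_mul _)
      (hM.memLp_obs a j)]
  simp only [covariance_const_mul_left, hM.cov_obs]
  rw [← hM.regGram_mulVec_postWeights hσ a z, sub_eq_zero]
  simp only [Matrix.mulVec, dotProduct]
  exact Finset.sum_congr rfl fun i _ => by rw [hM.regGram_comm, mul_comm]

lemma variance_sub_postMean (hM : IsModel P k σ f ε U) (hσ : 0 < σ) {n : ℕ} (a : Fin n → X)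
    (z : X) : Var[fun ω => f z ω - postMean k σ a (obs f ε a ω) z; P] = postVar k σ a z := by
  have hW := hM.memLp_sub_postMean a z
  have hS : MemLp (fun ω => postMean k σ a (obs f ε a ω) z) 2 P := by
    simp only [hM.postMean_eq]
    exact memLp_finsetSum _ fun i _ => (hM.memLp_obs a i).const_mul _
  rw [← covariance_self hW.aemeasurable, covariance_fun_sub_right hW (hM.memLp_f z) hS]
  have h1 : cov[fun ω => f z ω - postMean k σ a (obs f ε a ω) z,
      fun ω => postMean k σ a (obs f ε a ω) z; P] = 0 := by
    conv_lhs => rw [show (fun ω => postMean k σ a (obs f ε a ω) z) =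
      fun ω => ∑ i, postWeights k σ a z i * obs f ε a ω i from funext fun ω => hM.postMean_eq _ _ _]
    rw [covariance_fun_sum_right (fun i => (hM.memLp_obs a i).const_mul _) hW]
    exact Finset.sum_eq_zero fun i _ => by
      rw [covariance_const_mul_right, hM.cov_sub_postMean_obs hσ, mul_zero]
  rw [h1, sub_zero, covariance_fun_sub_left (hM.memLp_f z) hS (hM.memLp_f z), hM.cov_f, postVar]
  congr 1
  simp only [hM.postMean_eq]
  rw [covariance_fun_sum_left (fun i => (hM.memLp_obs a i).const_mul _) (hM.memLp_f z)]
  simp only [covariance_const_mul_left, dotProduct]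
  refine Finset.sum_congr rfl fun i _ => ?_
  rw [covariance_comm, hM.cov_f_obs, mul_comm]
  rfl

lemma integral_sub_postMean (hM : IsModel P k σ f ε U) {n : ℕ} (a : Fin n → X) (z : X) :
    ∫ ω, f z ω - postMean k σ a (obs f ε a ω) z ∂P = 0 := by
  simp only [hM.postMean_eq]
  have hi : ∀ i : Fin n, Integrable (fun ω => postWeights k σ a z i * obs f ε a ω i) P :=
    fun i => ((hM.memLp_obs a i).integrable one_le_two).const_mul _
  rw [integral_sub ((hM.memLp_f z).integrable one_le_two) (integrable_finsetSum _ fun i _ => hi i),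
    integral_finsetSum _ fun i _ => hi i, hM.mean_f, zero_sub, neg_eq_zero]
  refine Finset.sum_eq_zero fun i _ => ?_
  rw [integral_const_mul]
  simp only [obs]
  rw [integral_add ((hM.memLp_f _).integrable one_le_two)
    ((hM.memLp_noise _).integrable one_le_two), hM.mean_f, hM.integral_noise]
  simp

lemma postVar_nonneg (hM : IsModel P k σ f ε U) (hσ : 0 < σ) {n : ℕ} (a : Fin n → X)
    (z : X) : 0 ≤ postVar k σ a z := by
  rw [← hM.variance_sub_postMean hσ]
  exact variance_nonneg _ _

lemma postVar_le (hM : IsModel P k σ f ε U) (hσ : 0 < σ) {n : ℕ} (a : Fin n → X)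
    (z : X) : postVar k σ a z ≤ k z z := by
  have h := (hM.regGram_posDef hσ a).inv.posSemidef.dotProduct_mulVec_nonneg (kernelVec k a z)
  simp only [postVar]
  simpa using h

/-- The posterior variance exceeds the variance of the noiseless residual by the variance that
the noise contributes to the predictor. -/
lemma postVar_eq_add (hM : IsModel P k σ f ε U) (hσ : 0 < σ) {n : ℕ} (a : Fin n → X) (z : X) :
    postVar k σ a z = (∫ ω, (f z ω - ∑ i, postWeights k σ a z i * f (a i) ω) ^ 2 ∂P) +
      σ ^ 2 * ∑ i, postWeights k σ a z i ^ 2 := by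
  set w := postWeights k σ a z with hw
  have hB : MemLp (fun ω => ∑ i, w i * f (a i) ω) 2 P :=
    memLp_finsetSum _ fun i _ => (hM.memLp_f (a i)).const_mul _
  have hE : MemLp (fun ω => ∑ i : Fin n, w i * ε i ω) 2 P :=
    memLp_finsetSum _ fun i _ => (hM.memLp_noise i).const_mul _
  have hfi : ∀ i : Fin n, Integrable (fun ω => w i * f (a i) ω) P :=
    fun i => ((hM.memLp_f _).integrable one_le_two).const_mul _
  have hA : MemLp (fun ω => f z ω - ∑ i, w i * f (a i) ω) 2 P := (hM.memLp_f z).sub hB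
  have hA0 : ∫ ω, f z ω - ∑ i, w i * f (a i) ω ∂P = 0 := by
    rw [integral_sub ((hM.memLp_f z).integrable one_le_two)
      (integrable_finsetSum _ fun i _ => hfi i), integral_finsetSum _ fun i _ => hfi i]
    simp [integral_const_mul, hM.mean_f]
  have hcov : cov[fun ω => f z ω - ∑ i, w i * f (a i) ω, fun ω => ∑ i : Fin n, w i * ε i ω; P]
      = 0 := by
    rw [covariance_fun_sub_left (hM.memLp_f z) hB hE,
      covariance_fun_sum_right (fun i : Fin n => (hM.memLp_noise i).const_mul (w i))
        (hM.memLp_f z),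
      covariance_fun_sum_fun_sum (fun i => (hM.memLp_f (a i)).const_mul (w i))
        (fun i : Fin n => (hM.memLp_noise i).const_mul (w i))]
    simp [covariance_const_mul_left, covariance_const_mul_right, hM.cov_f_noise]
  rw [← hM.variance_sub_postMean hσ, ← variance_of_integral_eq_zero hA.aemeasurable hA0]
  have hsplit : (fun ω => f z ω - postMean k σ a (obs f ε a ω) z) =
      (fun ω => f z ω - ∑ i, w i * f (a i) ω) - fun ω => ∑ i : Fin n, w i * ε i ω := by
    ext ω
    simp only [hM.postMean_eq, obs, Pi.sub_apply, mul_add, Finset.sum_add_distrib, ← hw]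
    ring
  rw [hsplit, variance_sub hA hE, hcov, mul_zero, sub_zero]
  congr 1
  rw [← covariance_self hE.aemeasurable,
    covariance_fun_sum_fun_sum (fun i : Fin n => (hM.memLp_noise i).const_mul (w i))
      (fun i : Fin n => (hM.memLp_noise i).const_mul (w i))]
  simp only [covariance_const_mul_left, covariance_const_mul_right, hM.cov_noise, Finset.mul_sum]
  refine Finset.sum_congr rfl fun i _ => ?_
  rw [Finset.sum_eq_single i]
  · simp; ring
  · intro j _ hj
    rw [if_neg (fun h => hj (Fin.ext h).symm)]
    simp
  · simp

/-- `n` noisy observations reduce the variance at most by the factor `σ² / (n + σ²)`, which is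
attained by repeated observation of the point itself. -/
lemma le_postVar (hM : IsModel P k σ f ε U) (hσ : 0 < σ) (hk : ∀ z, k z z ≤ 1) {n : ℕ}
    (a : Fin n → X) (z : X) : k z z * σ ^ 2 ≤ (n + σ ^ 2) * postVar k σ a z := by
  rcases Nat.eq_zero_or_pos n with rfl | hn
  · simp [postVar, mul_comm]
  have hn' : (0 : ℝ) < n := by exact_mod_cast hn
  rw [hM.postVar_eq_add hσ]
  set w := postWeights k σ a z with hw
  have hB : MemLp (fun ω => ∑ i, w i * f (a i) ω) 2 P :=
    memLp_finsetSum _ fun i _ => (hM.memLp_f (a i)).const_mul _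
  have hA : MemLp (fun ω => f z ω - ∑ i, w i * f (a i) ω) 2 P := (hM.memLp_f z).sub hB
  have hsq : ∀ z, ∫ ω, f z ω ^ 2 ∂P = k z z := fun z => by
    rw [← hM.variance_f,
      variance_of_integral_eq_zero (hM.measurable_f z).aemeasurable (hM.mean_f z)]
  have hBle : ∫ ω, (∑ i, w i * f (a i) ω) ^ 2 ∂P ≤ n * ∑ i, w i ^ 2 := by
    have h1 : ∫ ω, (∑ i, w i * f (a i) ω) ^ 2 ∂P ≤
        ∫ ω, (∑ i, w i ^ 2) * ∑ i, f (a i) ω ^ 2 ∂P :=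
      integral_mono hB.integrable_sq
        ((integrable_finsetSum _ fun i _ => (hM.memLp_f (a i)).integrable_sq).const_mul _)
        fun ω => Finset.sum_mul_sq_le_sq_mul_sq _ _ _
    refine h1.trans ?_
    rw [integral_const_mul, integral_finsetSum _ fun i _ => (hM.memLp_f (a i)).integrable_sq,
      mul_comm]
    refine mul_le_mul_of_nonneg_right ?_ (Finset.sum_nonneg fun i _ => sq_nonneg _)
    calc ∑ i, ∫ ω, f (a i) ω ^ 2 ∂P ≤ ∑ _i : Fin n, (1 : ℝ) :=
          Finset.sum_le_sum fun i _ => by rw [hsq]; exact hk _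
      _ = n := by simp
  have hpt : ∫ ω, n * σ ^ 2 * f z ω ^ 2 ∂P ≤
      ∫ ω, (n * (n + σ ^ 2)) * (f z ω - ∑ i, w i * f (a i) ω) ^ 2 +
        ((n + σ ^ 2) * σ ^ 2) * (∑ i, w i * f (a i) ω) ^ 2 ∂P := by
    refine integral_mono ((hM.memLp_f z).integrable_sq.const_mul _)
      ((hA.integrable_sq.const_mul _).add (hB.integrable_sq.const_mul _)) fun ω => ?_
    simp only
    set B := ∑ i, w i * f (a i) ω
    nlinarith [sq_nonneg ((n : ℝ) * (f z ω - B) - σ ^ 2 * B)]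
  rw [integral_const_mul, hsq, integral_add (hA.integrable_sq.const_mul _)
    (hB.integrable_sq.const_mul _), integral_const_mul, integral_const_mul] at hpt
  have h3 := mul_le_mul_of_nonneg_left hBle (show 0 ≤ ((n : ℝ) + σ ^ 2) * σ ^ 2 by positivity)
  refine le_of_mul_le_mul_left ?_ hn'
  nlinarith

lemma postVar_pos (hM : IsModel P k σ f ε U) (hσ : 0 < σ) (hk : ∀ z, 0 < k z z ∧ k z z ≤ 1)
    {n : ℕ} (a : Fin n → X) (z : X) : 0 < postVar k σ a z := by
  have h := hM.le_postVar hσ (fun z => (hk z).2) a z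
  have h1 : 0 < k z z * σ ^ 2 := mul_pos (hk z).1 (by positivity)
  have h2 : (0 : ℝ) < n + σ ^ 2 := by positivity
  by_contra hc
  nlinarith [mul_nonpos_of_nonneg_of_nonpos h2.le (not_lt.1 hc)]

/-- For a fixed design, the prediction error is a centered Gaussian variable, independent of the
observations, whose variance is the posterior variance. -/
lemma indepFun_sub_postMean (hM : IsModel P k σ f ε U) (hσ : 0 < σ) {n : ℕ} (a : Fin n → X)
    (z : X) :
    IndepFun (obs f ε a) (fun ω => f z ω - postMean k σ a (obs f ε a ω) z) P ∧
      P.map (fun ω => f z ω - postMean k σ a (obs f ε a ω) z) =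
        gaussianReal 0 (postVar k σ a z).toNNReal := by
  have hf : HasGaussianLaw (fun ω (o : Option (Fin n)) => f (o.elim z a) ω) P := by
    have h := (hM.gaussian_f.comp_right (fun o : Option (Fin n) => o.elim z a)).hasGaussianLaw
      Finset.univ
    let L : ({o // o ∈ (Finset.univ : Finset (Option (Fin n)))} → ℝ) →L[ℝ] (Option (Fin n) → ℝ) :=
      ContinuousLinearMap.pi fun o => ContinuousLinearMap.proj ⟨o, Finset.mem_univ o⟩
    exact h.map L
  have he : HasGaussianLaw (fun ω (i : Fin n) => ε i ω) P :=
    iIndepFun.hasGaussianLaw (fun i => hM.hasGaussianLaw_noise i)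
      (hM.indep_noise.precomp Fin.val_injective)
  have hind : IndepFun (fun ω (o : Option (Fin n)) => f (o.elim z a) ω)
      (fun ω (i : Fin n) => ε i ω) P :=
    hM.indep_f_noise.comp (φ := fun p (o : Option (Fin n)) => p (o.elim z a))
      (ψ := fun e (i : Fin n) => e i)
      (measurable_pi_lambda _ fun o => measurable_pi_apply _)
      (measurable_pi_lambda _ fun i => measurable_pi_apply _)
  have hjoint := hind.hasGaussianLaw hf he
  let p1 (o : Option (Fin n)) : (Option (Fin n) → ℝ) × (Fin n → ℝ) →L[ℝ] ℝ :=
    (ContinuousLinearMap.proj o).comp (ContinuousLinearMap.fst ℝ _ _)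
  let p2 (i : Fin n) : (Option (Fin n) → ℝ) × (Fin n → ℝ) →L[ℝ] ℝ :=
    (ContinuousLinearMap.proj i).comp (ContinuousLinearMap.snd ℝ _ _)
  let Lw : (Option (Fin n) → ℝ) × (Fin n → ℝ) →L[ℝ] ℝ :=
    p1 none - ∑ i, postWeights k σ a z i • (p1 (some i) + p2 i)
  let Ly : (Option (Fin n) → ℝ) × (Fin n → ℝ) →L[ℝ] (Fin n → ℝ) :=
    ContinuousLinearMap.pi fun i => p1 (some i) + p2 i
  let Lu : (Option (Fin n) → ℝ) × (Fin n → ℝ) →L[ℝ] (Unit → ℝ) :=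
    ContinuousLinearMap.pi fun _ => Lw
  have hLw : ∀ ω, Lw (fun o => f (o.elim z a) ω, fun i => ε i ω) =
      f z ω - postMean k σ a (obs f ε a ω) z := by
    intro ω
    simp [Lw, p1, p2, hM.postMean_eq, obs, mul_add]
  have hWlaw : HasGaussianLaw (fun ω => f z ω - postMean k σ a (obs f ε a ω) z) P := by
    have h := hjoint.map_fun Lw
    simpa only [hLw] using h
  constructor
  · have h := hjoint.map_fun (Ly.prod Lu)
    have h2 : HasGaussianLaw (fun ω => ((fun i => obs f ε a ω i),
        fun _ : Unit => f z ω - postMean k σ a (obs f ε a ω) z)) P := by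
      refine h.congr (ae_of_all _ fun ω => Prod.ext (funext fun i => ?_) (funext fun i => ?_))
      · simp [Ly, p1, p2, obs]
      · exact hLw ω
    have h3 := h2.indepFun_of_covariance_eval
      (X := fun i ω => obs f ε a ω i)
      (Y := fun (_ : Unit) ω => f z ω - postMean k σ a (obs f ε a ω) z) fun i j => by
      rw [covariance_comm]; exact hM.cov_sub_postMean_obs hσ a z i
    exact h3.comp (φ := id) (ψ := fun g : Unit → ℝ => g ()) measurable_id (measurable_pi_apply ())
  · rw [hWlaw.map_eq_gaussianReal, hM.variance_sub_postMean hσ, hM.integral_sub_postMean]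

end IsModel
end Regression

/-! ### Continuity of the kernel and of the posterior -/

section Continuity

variable {Ω : Type*} [MeasurableSpace Ω] {Θ : Type*} [MeasurableSpace Θ] {X : Type*}
  {P : Measure Ω} [IsProbabilityMeasure P] {k : X → X → ℝ} {σ : ℝ} {f : X → Ω → ℝ}
  {ε : ℕ → Ω → ℝ} {U : Ω → Θ} [TopologicalSpace X] [FirstCountableTopology X]

namespace IsModel

lemma integral_cos_sub_f (hM : IsModel P k σ f ε U) (z w : X) :
    ∫ ω, Real.cos (f z ω - f w ω) ∂P = Real.exp (-Var[fun ω => f z ω - f w ω; P] / 2) := by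
  have hG : HasGaussianLaw (fun ω => f z ω - f w ω) P := hM.gaussian_f.hasGaussianLaw_fun_sub
  have hm : ∫ ω, f z ω - f w ω ∂P = 0 := by
    rw [integral_sub ((hM.memLp_f z).integrable one_le_two)
      ((hM.memLp_f w).integrable one_le_two), hM.mean_f, hM.mean_f, sub_zero]
  have hmeas : Measurable fun ω => f z ω - f w ω := (hM.measurable_f z).sub (hM.measurable_f w)
  have hlaw := hG.map_eq_gaussianReal
  rw [hm] at hlaw
  set V := Var[fun ω => f z ω - f w ω; P] with hV
  have hchar := charFun_gaussianReal (μ := 0) (v := V.toNNReal) 1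
  rw [← hlaw, charFun_apply_real, integral_map hmeas.aemeasurable (by fun_prop)] at hchar
  have hint : Integrable (fun ω => Complex.exp ((1 : ℝ) * (f z ω - f w ω : ℝ) * Complex.I)) P := by
    refine Integrable.of_bound (C := 1) (Measurable.aestronglyMeasurable
      (Complex.measurable_exp.comp
      (((Complex.measurable_ofReal.comp hmeas).const_mul _).mul_const _))) (ae_of_all _ fun ω => ?_)
    rw [← Complex.ofReal_mul, Complex.norm_exp_ofReal_mul_I]
  have h1 : (∫ ω, Complex.exp ((1 : ℝ) * (f z ω - f w ω : ℝ) * Complex.I) ∂P).re =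
      ∫ ω, Real.cos (f z ω - f w ω) ∂P := by
    have := integral_re (𝕜 := ℂ) hint
    simp only [RCLike.re_eq_complex_re] at this
    rw [← this]
    refine integral_congr_ae (ae_of_all _ fun ω => ?_)
    simp only [Complex.ofReal_one, one_mul, Complex.exp_ofReal_mul_I_re]
  have hVc : (((V.toNNReal : ℝ≥0) : ℝ) : ℂ) = (V : ℂ) := by
    rw [Real.coe_toNNReal _ (variance_nonneg _ _)]
  rw [← h1, hchar, hVc, show ((1 : ℝ) : ℂ) * ((0 : ℝ) : ℂ) * Complex.I -
    (V : ℂ) * ((1 : ℝ) : ℂ) ^ 2 / 2 = ((-V / 2 : ℝ) : ℂ) by push_cast; ring, Complex.exp_ofReal_re]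

/-- Almost sure convergence of Gaussian variables implies convergence in mean square. -/
lemma tendsto_variance_sub_f (hM : IsModel P k σ f ε U)
    (hc : ∀ᵐ ω ∂P, Continuous fun z => f z ω) (w : X) :
    Filter.Tendsto (fun z => Var[fun ω => f z ω - f w ω; P]) (nhds w) (nhds 0) := by
  have h1 : Filter.Tendsto (fun z => ∫ ω, Real.cos (f z ω - f w ω) ∂P) (nhds w)
      (nhds (∫ ω, Real.cos (f w ω - f w ω) ∂P)) := by
    refine tendsto_integral_filter_of_dominated_convergence (fun _ => 1) ?_ ?_
      (integrable_const _) ?_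
    · exact Filter.Eventually.of_forall fun z =>
        (Real.measurable_cos.comp ((hM.measurable_f z).sub
          (hM.measurable_f w))).aestronglyMeasurable
    · exact Filter.Eventually.of_forall fun z => ae_of_all _ fun ω => Real.abs_cos_le_one _
    · filter_upwards [hc] with ω hω
      have : Continuous fun z => Real.cos (f z ω - f w ω) := by fun_prop
      exact this.tendsto w
  simp only [sub_self, Real.cos_zero, integral_const, probReal_univ, smul_eq_mul,
    mul_one] at h1
  have h2 := (h1.log one_ne_zero).const_mul (-2)
  simp only [hM.integral_cos_sub_f, Real.log_exp, Real.log_one, mul_zero] at h2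
  refine h2.congr fun z => ?_
  ring

lemma abs_kernel_sub_le (hM : IsModel P k σ f ε U) (hk : ∀ z, k z z ≤ 1) (z w v : X) :
    |k z v - k w v| ≤ √Var[fun ω => f z ω - f w ω; P] := by
  have hD : MemLp (fun ω => f z ω - f w ω) 2 P := (hM.memLp_f z).sub (hM.memLp_f w)
  set c := k z v - k w v with hc
  have h1 : cov[fun ω => f z ω - f w ω, f v; P] = c := by
    rw [covariance_fun_sub_left (hM.memLp_f z) (hM.memLp_f w) (hM.memLp_f v), hM.cov_f, hM.cov_f]
  refine Real.abs_le_sqrt ?_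
  -- the variance of `f z - f w - c f v` is nonnegative
  have h2 := variance_nonneg (fun ω => (f z ω - f w ω) - c * f v ω) P
  rw [variance_fun_sub hD ((hM.memLp_f v).const_mul c), covariance_const_mul_right, h1,
    variance_const_mul, hM.variance_f] at h2
  nlinarith [mul_le_mul_of_nonneg_left (hk v) (sq_nonneg c)]

lemma continuous_kernel (hM : IsModel P k σ f ε U) (hk : ∀ z, k z z ≤ 1)
    (hc : ∀ᵐ ω ∂P, Continuous fun z => f z ω) : Continuous fun q : X × X => k q.1 q.2 := by
  rw [continuous_iff_continuousAt]
  rintro ⟨z₀, w₀⟩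
  have hV : ∀ w, Filter.Tendsto (fun z => √Var[fun ω => f z ω - f w ω; P]) (nhds w) (nhds 0) :=
    fun w => by simpa using (hM.tendsto_variance_sub_f hc w).sqrt
  have h : Filter.Tendsto (fun q : X × X => √Var[fun ω => f q.1 ω - f z₀ ω; P] +
      √Var[fun ω => f q.2 ω - f w₀ ω; P]) (nhds (z₀, w₀)) (nhds 0) := by
    simpa using ((hV z₀).comp (continuous_fst.tendsto (z₀, w₀))).add
      ((hV w₀).comp (continuous_snd.tendsto (z₀, w₀)))
  rw [ContinuousAt, tendsto_iff_norm_sub_tendsto_zero]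
  refine squeeze_zero (fun _ => norm_nonneg _) (fun q => ?_) h
  have h1 := hM.abs_kernel_sub_le hk q.1 z₀ q.2
  have h2 := hM.abs_kernel_sub_le hk q.2 w₀ z₀
  rw [hM.kernel_comm q.2, hM.kernel_comm w₀] at h2
  rw [Real.norm_eq_abs]
  exact (abs_sub_le _ (k z₀ q.2) _).trans (add_le_add h1 h2)

lemma continuous_inv_regGram (hM : IsModel P k σ f ε U) (hσ : 0 < σ) (hk : ∀ z, k z z ≤ 1)
    (hc : ∀ᵐ ω ∂P, Continuous fun z => f z ω) (n : ℕ) :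
    Continuous fun a : Fin n → X => (regGram k σ a)⁻¹ := by
  have hG : Continuous fun a : Fin n → X => regGram k σ a := by
    refine Continuous.add (continuous_matrix fun i j => ?_) continuous_const
    exact (hM.continuous_kernel hk hc).comp
      (g := fun q : X × X => k q.1 q.2) (f := fun a : Fin n → X => (a i, a j)) (by fun_prop)
  simp only [Matrix.inv_def, Ring.inverse_eq_inv']
  exact (hG.matrix_det.inv₀ fun a => (hM.regGram_posDef hσ a).det_pos.ne').smul
    hG.matrix_adjugate

lemma continuous_kernelVec (hM : IsModel P k σ f ε U) (hk : ∀ z, k z z ≤ 1)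
    (hc : ∀ᵐ ω ∂P, Continuous fun z => f z ω) (n : ℕ) :
    Continuous fun q : (Fin n → X) × X => kernelVec k q.1 q.2 :=
  continuous_pi fun i => (hM.continuous_kernel hk hc).comp
    (continuous_snd.prodMk ((continuous_apply i).comp continuous_fst))

lemma continuous_postMean (hM : IsModel P k σ f ε U) (hσ : 0 < σ) (hk : ∀ z, k z z ≤ 1)
    (hc : ∀ᵐ ω ∂P, Continuous fun z => f z ω) (n : ℕ) :
    Continuous fun q : (Fin n → X) × (Fin n → ℝ) × X => postMean k σ q.1 q.2.1 q.2.2 := by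
  have h1 := (hM.continuous_inv_regGram hσ hk hc n).comp
    (continuous_fst (X := Fin n → X) (Y := (Fin n → ℝ) × X))
  have h2 : Continuous fun q : (Fin n → X) × (Fin n → ℝ) × X => kernelVec k q.1 q.2.2 :=
    (hM.continuous_kernelVec hk hc n).comp (continuous_fst.prodMk (by fun_prop))
  exact h2.dotProduct (h1.matrix_mulVec (by fun_prop))

lemma continuous_postVar (hM : IsModel P k σ f ε U) (hσ : 0 < σ) (hk : ∀ z, k z z ≤ 1)
    (hc : ∀ᵐ ω ∂P, Continuous fun z => f z ω) (n : ℕ) :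
    Continuous fun q : (Fin n → X) × X => postVar k σ q.1 q.2 := by
  have h1 := (hM.continuous_inv_regGram hσ hk hc n).comp (continuous_fst (Y := X))
  have h2 := hM.continuous_kernelVec hk hc n
  have h3 : Continuous fun q : (Fin n → X) × X => k q.2 q.2 :=
    (hM.continuous_kernel hk hc).comp (continuous_snd.prodMk continuous_snd)
  exact h3.sub (h2.dotProduct (h1.matrix_mulVec h2))

end IsModel
end Continuity

/-! ### Densities of sequentially generated Gaussian data -/

section Density

lemma lintegral_fin_succ {n : ℕ} {H : (Fin (n + 1) → ℝ) → ℝ≥0∞} (hH : Measurable H) :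
    ∫⁻ e, H e = ∫⁻ e : Fin n → ℝ, ∫⁻ r : ℝ, H (Fin.snoc e r) := by
  have hmp := (volume_preserving_piFinSuccAbove (fun _ : Fin (n + 1) => ℝ) (Fin.last n)).symm
  rw [← hmp.lintegral_comp hH]
  have hm : Measurable fun q : ℝ × (Fin n → ℝ) =>
      H ((MeasurableEquiv.piFinSuccAbove (fun _ : Fin (n + 1) => ℝ) (Fin.last n)).symm q) :=
    hH.comp (MeasurableEquiv.measurable _)
  rw [Measure.volume_eq_prod, lintegral_prod_symm _ hm.aemeasurable]
  refine lintegral_congr fun e => lintegral_congr fun r => ?_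
  congr 1
  simp [MeasurableEquiv.piFinSuccAbove, Fin.insertNthEquiv, Fin.insertNth_last']

lemma lintegral_gaussianReal_const_add (c : ℝ) {v : ℝ≥0} (hv : v ≠ 0) {G : ℝ → ℝ≥0∞}
    (hG : Measurable G) :
    ∫⁻ w, G (c + w) ∂(gaussianReal 0 v) =
      ∫⁻ r, ENNReal.ofReal (gaussianPDFReal c v r) * G r := by
  rw [← lintegral_map hG (measurable_const_add c), gaussianReal_map_const_add, zero_add,
    gaussianReal_of_var_ne_zero _ hv,
    lintegral_withDensity_eq_lintegral_mul _ (measurable_gaussianPDF c v) hG]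
  rfl

variable {Ω : Type*} [MeasurableSpace Ω] {P : Measure Ω} [IsProbabilityMeasure P]
  {𝔻 : Type*} [MeasurableSpace 𝔻]

/-- The joint density at `(d, e)` of data `e 0, …, e (n - 1)` such that, given `d` and the data
before it, `e i` is Gaussian with mean `c i (d, e 0, …, e (i - 1))` and variance `v i`. -/
def seqDensity (c : ∀ i : ℕ, 𝔻 × (Fin i → ℝ) → ℝ) (v : ℕ → ℝ≥0) (n : ℕ) (d : 𝔻)
    (e : Fin n → ℝ) : ℝ :=
  ∏ i : Fin n, gaussianPDFReal (c i (d, fun j : Fin i => e (Fin.castLE i.2.le j))) (v i) (e i)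

variable {c : ∀ i : ℕ, 𝔻 × (Fin i → ℝ) → ℝ} {v : ℕ → ℝ≥0}

lemma seqDensity_nonneg (n : ℕ) (d : 𝔻) (e : Fin n → ℝ) : 0 ≤ seqDensity c v n d e :=
  Finset.prod_nonneg fun _ _ => gaussianPDFReal_nonneg _ _ _

lemma seqDensity_pos (hv : ∀ i, v i ≠ 0) (n : ℕ) (d : 𝔻) (e : Fin n → ℝ) :
    0 < seqDensity c v n d e :=
  Finset.prod_pos fun i _ => gaussianPDFReal_pos _ _ _ (hv i)

lemma measurable_seqDensity (hc : ∀ i, Measurable (c i)) (n : ℕ) :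
    Measurable fun q : 𝔻 × (Fin n → ℝ) => seqDensity c v n q.1 q.2 := by
  refine Finset.measurable_fun_prod _ fun i _ => ?_
  have h1 : Measurable fun q : 𝔻 × (Fin n → ℝ) =>
      c i (q.1, fun j : Fin i => q.2 (Fin.castLE i.2.le j)) :=
    (hc i).comp (measurable_fst.prodMk (measurable_pi_lambda _ fun j =>
      (measurable_pi_apply _).comp measurable_snd))
  exact measurable_uncurry_gaussianPDFReal.comp
    (h1.prodMk (measurable_const.prodMk ((measurable_pi_apply i).comp measurable_snd)))

lemma seqDensity_snoc (n : ℕ) (d : 𝔻) (e : Fin n → ℝ) (r : ℝ) :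
    seqDensity c v (n + 1) d (Fin.snoc e r) =
      seqDensity c v n d e * gaussianPDFReal (c n (d, e)) (v n) r := by
  rw [seqDensity, Fin.prod_univ_castSucc, seqDensity]
  congr 1
  · refine Finset.prod_congr rfl fun i _ => ?_
    have h : ∀ j : Fin (i : ℕ), (Fin.snoc e r : Fin (n + 1) → ℝ)
        (Fin.castLE (Fin.castSucc i).2.le j) = e (Fin.castLE i.2.le j) := fun j => by
      have : Fin.castLE (Fin.castSucc i).2.le j = Fin.castSucc (Fin.castLE i.2.le j) := rfl
      rw [this, Fin.snoc_castSucc (α := fun _ => ℝ)]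
    simp only [Fin.snoc_castSucc (α := fun _ => ℝ)]
    congr 1
    exact congrArg (fun g => c i (d, g)) (funext h)
  · have h : ∀ j : Fin n, (Fin.snoc e r : Fin (n + 1) → ℝ)
        (Fin.castLE (Fin.last n).2.le j) = e j := fun j => by
      have : Fin.castLE (Fin.last n).2.le j = Fin.castSucc j := rfl
      rw [this, Fin.snoc_castSucc (α := fun _ => ℝ)]
    simp only [Fin.snoc_last]
    congr 1
    exact congrArg (fun g => c n (d, g)) (funext h)

variable {D : Ω → 𝔻} {y : ℕ → Ω → ℝ}

/-- If each `y i` is a function of `D` and of the earlier data plus a centered Gaussian variable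
independent of these, then the law of the data has the sequential density with respect to the law
of `D` times Lebesgue measure. -/
theorem map_data_eq_withDensity (hD : AEMeasurable D P) (hy : ∀ i, AEMeasurable (y i) P)
    (hc : ∀ i, Measurable (c i)) (hv : ∀ i, v i ≠ 0)
    (h : ∀ i, P.map (fun ω => ((D ω, fun j : Fin i => y j ω),
        y i ω - c i (D ω, fun j : Fin i => y j ω))) =
      (P.map (fun ω => (D ω, fun j : Fin i => y j ω))).prod (gaussianReal 0 (v i))) (n : ℕ) :
    P.map (fun ω => (D ω, fun j : Fin n => y j ω)) =
      ((P.map D).prod volume).withDensity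
        fun q => ENNReal.ofReal (seqDensity c v n q.1 q.2) := by
  have hmeas : ∀ n, AEMeasurable (fun ω => (D ω, fun j : Fin n => y j ω)) P := fun n =>
    hD.prodMk (aemeasurable_pi_lambda _ fun j => hy j)
  have : SFinite (P.map D) := inferInstance
  have hdens : ∀ n, Measurable fun q : 𝔻 × (Fin n → ℝ) =>
      ENNReal.ofReal (seqDensity c v n q.1 q.2) := fun n =>
    (measurable_seqDensity hc n).ennreal_ofReal
  induction n with
  | zero =>
    refine Measure.ext_of_lintegral _ fun F hF => ?_
    rw [lintegral_map' hF.aemeasurable (hmeas 0),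
      lintegral_withDensity_eq_lintegral_mul _ (hdens 0) hF,
      lintegral_prod _ (((hdens 0).mul hF).aemeasurable)]
    simp only [seqDensity, Finset.univ_eq_empty, Finset.prod_empty, Pi.mul_apply,
      ENNReal.ofReal_one, one_mul]
    have hvol : (volume : Measure (Fin 0 → ℝ)) = Measure.dirac default := by
      rw [volume_pi, Measure.pi_of_empty _ default]
    have hF2 : Measurable fun d => F (d, (default : Fin 0 → ℝ)) :=
      hF.comp (measurable_id.prodMk measurable_const)
    simp only [hvol, lintegral_dirac]
    rw [lintegral_map' hF2.aemeasurable hD]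
    refine lintegral_congr fun ω => ?_
    congr 2
    exact Subsingleton.elim _ _
  | succ n ih =>
    refine Measure.ext_of_lintegral _ fun F hF => ?_
    have hsn : Measurable fun q : (𝔻 × (Fin n → ℝ)) × ℝ =>
        (q.1.1, (Fin.snoc q.1.2 q.2 : Fin (n + 1) → ℝ)) := by
      refine (measurable_fst.comp measurable_fst).prodMk (measurable_pi_lambda _ fun j => ?_)
      refine Fin.lastCases ?_ (fun j => ?_) j
      · simpa only [Fin.snoc_last] using measurable_snd
      · simp only [Fin.snoc_castSucc (α := fun _ => ℝ)]
        exact (measurable_pi_apply j).comp (measurable_snd.comp measurable_fst)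
    have hF3 : Measurable fun q : (𝔻 × (Fin n → ℝ)) × ℝ =>
        F (q.1.1, (Fin.snoc q.1.2 q.2 : Fin (n + 1) → ℝ)) := hF.comp hsn
    have hadd : Measurable fun q : (𝔻 × (Fin n → ℝ)) × ℝ => (q.1, c n q.1 + q.2) :=
      measurable_fst.prodMk (((hc n).comp measurable_fst).add measurable_snd)
    have hF4 : Measurable fun q : (𝔻 × (Fin n → ℝ)) × ℝ =>
        F (q.1.1, (Fin.snoc q.1.2 (c n q.1 + q.2) : Fin (n + 1) → ℝ)) := hF3.comp hadd
    have hres : AEMeasurable (fun ω => ((D ω, fun j : Fin n => y j ω),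
        y n ω - c n (D ω, fun j : Fin n => y j ω))) P :=
      (hmeas n).prodMk ((hy n).sub ((hc n).comp_aemeasurable (hmeas n)))
    calc ∫⁻ q, F q ∂(P.map fun ω => (D ω, fun j : Fin (n + 1) => y j ω))
        = ∫⁻ ω, F (D ω, Fin.snoc (fun j : Fin n => y j ω)
            (c n (D ω, fun j : Fin n => y j ω) +
              (y n ω - c n (D ω, fun j : Fin n => y j ω)))) ∂P := by
          rw [lintegral_map' hF.aemeasurable (hmeas (n + 1))]
          refine lintegral_congr fun ω => ?_
          congr 2
          ext j
          refine Fin.lastCases ?_ (fun j => ?_) j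
          · simp
          · simp
      _ = ∫⁻ q, F (q.1.1, Fin.snoc q.1.2 (c n q.1 + q.2))
            ∂((P.map (fun ω => (D ω, fun j : Fin n => y j ω))).prod (gaussianReal 0 (v n))) := by
          rw [← h n]
          exact (lintegral_map' hF4.aemeasurable hres).symm
      _ = ∫⁻ q, (∫⁻ r, ENNReal.ofReal (gaussianPDFReal (c n q) (v n) r) *
            F (q.1, Fin.snoc q.2 r)) ∂(P.map (fun ω => (D ω, fun j : Fin n => y j ω))) := by
          rw [lintegral_prod _ hF4.aemeasurable]
          refine lintegral_congr fun q => ?_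
          exact lintegral_gaussianReal_const_add (G := fun r => F (q.1, Fin.snoc q.2 r))
            (c n q) (hv n)
            (hF3.comp (measurable_const.prodMk measurable_id))
      _ = ∫⁻ d, (∫⁻ e, ENNReal.ofReal (seqDensity c v n d e) *
            ∫⁻ r, ENNReal.ofReal (gaussianPDFReal (c n (d, e)) (v n) r) *
              F (d, Fin.snoc e r)) ∂(P.map D) := by
          have hpm : Measurable fun q : (𝔻 × (Fin n → ℝ)) × ℝ =>
              ENNReal.ofReal (gaussianPDFReal (c n q.1) (v n) q.2) *
                F (q.1.1, Fin.snoc q.1.2 q.2) :=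
            ((measurable_uncurry_gaussianPDFReal.comp (((hc n).comp measurable_fst).prodMk
              (measurable_const.prodMk measurable_snd))).ennreal_ofReal).mul hF3
          have hinner := hpm.lintegral_prod_right' (ν := (volume : Measure ℝ))
          rw [ih, lintegral_withDensity_eq_lintegral_mul _ (hdens n) hinner,
            lintegral_prod _ ((hdens n).mul hinner).aemeasurable]
          rfl
      _ = ∫⁻ q, F q ∂(((P.map D).prod volume).withDensity
            fun q => ENNReal.ofReal (seqDensity c v (n + 1) q.1 q.2)) := by
          rw [lintegral_withDensity_eq_lintegral_mul _ (hdens (n + 1)) hF,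
            lintegral_prod _ ((hdens (n + 1)).mul hF).aemeasurable]
          refine lintegral_congr fun d => ?_
          have hG : Measurable fun e : Fin (n + 1) → ℝ =>
              ((fun q : 𝔻 × (Fin (n + 1) → ℝ) =>
                ENNReal.ofReal (seqDensity c v (n + 1) q.1 q.2)) * F) (d, e) :=
            ((hdens (n + 1)).mul hF).comp (measurable_const.prodMk measurable_id)
          rw [lintegral_fin_succ hG]
          refine lintegral_congr fun e => ?_
          rw [← lintegral_const_mul']
          · refine lintegral_congr fun r => ?_
            simp only [Pi.mul_apply, seqDensity_snoc]
            rw [ENNReal.ofReal_mul (seqDensity_nonneg _ _ _), mul_assoc]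
          · exact ENNReal.ofReal_ne_top

end Density

/-! ### Evaluation of random functions at random points -/

section Evaluation

variable {X : Type*} [PseudoEMetricSpace X] [SecondCountableTopology X] [Nonempty X]
  [MeasurableSpace X] [OpensMeasurableSpace X]

/-- The value at `z` of a function on `X`, as the limit of its values at points of a countable
dense set that converge to `z`. For continuous functions this is the value at `z`, and in contrast
to it, it is jointly measurable in the point and the function. -/
def evalLim (q : X × (X → ℝ)) : ℝ :=
  Filter.limsup (fun m => q.2 (SimpleFunc.nearestPt (TopologicalSpace.denseSeq X) m q.1))
    Filter.atTop

lemma measurable_evalLim : Measurable (evalLim (X := X)) := by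
  refine Measurable.limsup fun m => ?_
  exact SimpleFunc.measurable_bind
    ((SimpleFunc.nearestPt (TopologicalSpace.denseSeq X) m).comp Prod.fst measurable_fst)
    (fun x (q : X × (X → ℝ)) => q.2 x) fun x => (measurable_pi_apply x).comp measurable_snd

lemma evalLim_of_continuous {p : X → ℝ} (hp : Continuous p) (z : X) : evalLim (z, p) = p z := by
  refine Filter.Tendsto.limsup_eq ?_
  exact (hp.tendsto z).comp (SimpleFunc.tendsto_nearestPt
    (by simp [(TopologicalSpace.denseRange_denseSeq X).closure_range]))

end Evaluation

/-! ### The posterior for a fixed design -/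

lemma indepFun_prodMk_left {Ω A B C : Type*} [MeasurableSpace Ω] [MeasurableSpace A]
    [MeasurableSpace B] [MeasurableSpace C] {P : Measure Ω} [IsProbabilityMeasure P]
    {a : Ω → A} {b : Ω → B} {c : Ω → C} (ha : Measurable a) (hb : Measurable b)
    (hc : Measurable c) (h1 : IndepFun a (fun ω => (b ω, c ω)) P) (h2 : IndepFun b c P) :
    IndepFun (fun ω => (a ω, b ω)) c P := by
  have hab : IndepFun a b P := h1.comp (φ := id) (ψ := Prod.fst) measurable_id measurable_fst
  rw [indepFun_iff_map_prod_eq_prod_map_map (by fun_prop) (by fun_prop)] at h1 h2 hab ⊢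
  rw [h2] at h1
  refine MeasurableEquiv.prodAssoc.map_measurableEquiv_injective ?_
  rw [Measure.map_map (by fun_prop) (by fun_prop), hab, Measure.prodAssoc_prod, ← h1]
  rfl

section FixedDesign

variable {Ω : Type*} [MeasurableSpace Ω] {Θ : Type*} [MeasurableSpace Θ] {X : Type*}
  {P : Measure Ω} [IsProbabilityMeasure P] {k : X → X → ℝ} {σ : ℝ} {f : X → Ω → ℝ}
  {ε : ℕ → Ω → ℝ} {U : Ω → Θ}

/-- The sample path of a process. -/
def path (f : X → Ω → ℝ) (ω : Ω) : X → ℝ := fun z => f z ω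

/-- The density at `e` of the observations at the points `a` of a function with values `p` there. -/
def likelihood (σ : ℝ) {n : ℕ} (p e : Fin n → ℝ) : ℝ :=
  ∏ i, gaussianPDFReal (p i) (σ ^ 2).toNNReal (e i)

lemma likelihood_le {n : ℕ} (p e : Fin n → ℝ) :
    likelihood σ p e ≤ ((√(2 * Real.pi * (σ ^ 2).toNNReal))⁻¹) ^ n := by
  have h : likelihood σ p e ≤ ∏ _i : Fin n, (√(2 * Real.pi * (σ ^ 2).toNNReal))⁻¹ := by
    refine Finset.prod_le_prod (fun _ _ => gaussianPDFReal_nonneg _ _ _) fun i _ => ?_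
    rw [gaussianPDFReal]
    refine mul_le_of_le_one_right (by positivity) ?_
    rw [Real.exp_le_one_iff]
    exact div_nonpos_of_nonpos_of_nonneg (neg_nonpos.2 (sq_nonneg _)) (by positivity)
  simpa using h

lemma continuous_likelihood {n : ℕ} (p : Fin n → ℝ) : Continuous (likelihood σ p) := by
  refine continuous_finsetProd _ fun i _ => ?_
  simp only [gaussianPDFReal]
  fun_prop

lemma measurable_likelihood {n : ℕ} :
    Measurable fun q : (Fin n → ℝ) × (Fin n → ℝ) => likelihood σ q.1 q.2 := by
  refine Finset.measurable_fun_prod _ fun i _ => ?_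
  have h : Measurable fun q : (Fin n → ℝ) × (Fin n → ℝ) => (q.1 i, (σ ^ 2).toNNReal, q.2 i) := by
    fun_prop
  exact measurable_uncurry_gaussianPDFReal.comp h

lemma toNNReal_sq_ne_zero (hσ : 0 < σ) : (σ ^ 2).toNNReal ≠ 0 := by
  simpa using hσ.ne'

lemma measurable_postMean_data (k : X → X → ℝ) (σ : ℝ) {n : ℕ} (a : Fin n → X) (z : X) :
    Measurable fun y => postMean k σ a y z := by
  simp only [postMean, dotProduct, Matrix.mulVec]
  fun_prop

lemma continuous_postMean_data (k : X → X → ℝ) (σ : ℝ) {n : ℕ} (a : Fin n → X) (z : X) :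
    Continuous fun y => postMean k σ a y z := by
  simp only [postMean, dotProduct, Matrix.mulVec]
  fun_prop

namespace IsModel

lemma measurable_path (hM : IsModel P k σ f ε U) : Measurable (path f) :=
  measurable_pi_lambda _ hM.measurable_f

lemma indepFun_noise (hM : IsModel P k σ f ε U) (n : ℕ) :
    IndepFun (fun ω => (U ω, (path f ω, fun i : Fin n => ε i ω))) (ε n) P := by
  have hε : IndepFun (fun ω (i : Fin n) => ε i ω) (ε n) P := by
    have h := hM.indep_noise.indepFun_finset (Finset.range n) {n} (by simp) hM.measurable_noise
    have h1 : Measurable fun (g : Finset.range n → ℝ) (i : Fin n) =>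
        g ⟨i, Finset.mem_range.2 i.2⟩ := measurable_pi_lambda _ fun _ => measurable_pi_apply _
    have h2 : Measurable fun g : ({n} : Finset ℕ) → ℝ => g ⟨n, Finset.mem_singleton_self n⟩ :=
      measurable_pi_apply _
    exact h.comp h1 h2
  have hεm : Measurable fun ω (i : Fin n) => ε i ω :=
    measurable_pi_lambda _ fun i => hM.measurable_noise i
  have hsel : Measurable fun e : ℕ → ℝ => ((fun i : Fin n => e i), e n) :=
    (measurable_pi_lambda _ fun _ => measurable_pi_apply _).prodMk (measurable_pi_apply _)
  have h1 : IndepFun (fun ω => (path f ω, fun i : Fin n => ε i ω)) (ε n) P :=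
    indepFun_prodMk_left hM.measurable_path hεm (hM.measurable_noise n)
      (hM.indep_f_noise.comp measurable_id hsel) hε
  refine indepFun_prodMk_left hM.measurable_U (hM.measurable_path.prodMk hεm)
    (hM.measurable_noise n) ?_ h1
  exact hM.indep_U.comp (φ := id)
    (ψ := fun q : (X → ℝ) × (ℕ → ℝ) => ((q.1, fun i : Fin n => q.2 i), q.2 n)) measurable_id
    ((measurable_fst.prodMk (measurable_fst.comp (hsel.comp measurable_snd))).prodMk
      (measurable_snd.comp (hsel.comp measurable_snd)))

/-- The noise of a round is independent of whatever is determined by the randomness of the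
algorithm, the objective, and the noise of earlier rounds. -/
lemma map_prodMk_noise (hM : IsModel P k σ f ε U) (n : ℕ) {E : Type*} [MeasurableSpace E]
    {Z : Ω → E} {Ψ : Θ × ((X → ℝ) × (Fin n → ℝ)) → E} (hΨ : Measurable Ψ)
    (hZ : ∀ᵐ ω ∂P, Z ω = Ψ (U ω, (path f ω, fun i : Fin n => ε i ω))) {η : Ω → ℝ}
    (hη : η =ᵐ[P] ε n) :
    P.map (fun ω => (Z ω, η ω)) = (P.map Z).prod (gaussianReal 0 (σ ^ 2).toNNReal) := by
  have hεm : Measurable fun ω (i : Fin n) => ε i ω :=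
    measurable_pi_lambda _ fun i => hM.measurable_noise i
  have hm : Measurable fun ω => Ψ (U ω, (path f ω, fun i : Fin n => ε i ω)) :=
    hΨ.comp (hM.measurable_U.prodMk (hM.measurable_path.prodMk hεm))
  have h : IndepFun (fun ω => Ψ (U ω, (path f ω, fun i : Fin n => ε i ω))) (ε n) P :=
    (hM.indepFun_noise n).comp hΨ measurable_id
  rw [indepFun_iff_map_prod_eq_prod_map_map hm.aemeasurable
    (hM.measurable_noise n).aemeasurable] at h
  have h1 : P.map (fun ω => (Z ω, η ω)) =
      P.map (fun ω => (Ψ (U ω, (path f ω, fun i : Fin n => ε i ω)), ε n ω)) := by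
    refine Measure.map_congr ?_
    filter_upwards [hZ, hη] with ω h1 h2
    rw [h1, h2]
  have h2 : P.map Z = P.map (fun ω => Ψ (U ω, (path f ω, fun i : Fin n => ε i ω))) :=
    Measure.map_congr hZ
  rw [h1, h2, ← hM.law_noise n]
  exact h

lemma map_path_obs (hM : IsModel P k σ f ε U) (hσ : 0 < σ) {n : ℕ} (a : Fin n → X) :
    P.map (fun ω => (path f ω, obs f ε a ω)) = ((P.map (path f)).prod volume).withDensity
      fun q => ENNReal.ofReal (likelihood σ (q.1 ∘ a) q.2) := by
  rcases Nat.eq_zero_or_pos n with h0 | h0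
  swap
  · let a' : ℕ → X := fun i => if h : i < n then a ⟨i, h⟩ else a ⟨0, h0⟩
    have ha' : ∀ i : Fin n, a' i = a i := fun i => by simp [a']
    have h := map_data_eq_withDensity (P := P) (D := path f) (y := fun i ω => f (a' i) ω + ε i ω)
      (c := fun i (q : (X → ℝ) × (Fin i → ℝ)) => q.1 (a' i)) (v := fun _ => (σ ^ 2).toNNReal)
      hM.measurable_path.aemeasurable
      (fun i => ((hM.measurable_f _).add (hM.measurable_noise i)).aemeasurable)
      (fun i => (measurable_pi_apply _).comp measurable_fst) (fun _ => toNNReal_sq_ne_zero hσ)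
      (fun i => by
        refine hM.map_prodMk_noise i
          (Ψ := fun q => (q.2.1, fun j : Fin i => q.2.1 (a' j) + q.2.2 j)) ?_
          (ae_of_all _ fun ω => rfl) (ae_of_all _ fun ω => ?_)
        · refine (measurable_fst.comp measurable_snd).prodMk (measurable_pi_lambda _ fun j => ?_)
          exact ((measurable_pi_apply _).comp (measurable_fst.comp measurable_snd)).add
            ((measurable_pi_apply _).comp (measurable_snd.comp measurable_snd))
        · simp [path]) n
    simp only [seqDensity, ha'] at h
    exact h
  · subst h0
    have h := map_data_eq_withDensity (P := P) (D := path f) (y := fun i ω => ε i ω)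
      (c := fun _ _ => 0) (v := fun _ => (σ ^ 2).toNNReal)
      hM.measurable_path.aemeasurable (fun i => (hM.measurable_noise i).aemeasurable)
      (fun _ => measurable_const) (fun _ => toNNReal_sq_ne_zero hσ)
      (fun i => hM.map_prodMk_noise i (Ψ := fun q => q.2) measurable_snd
          (ae_of_all _ fun ω => rfl) (ae_of_all _ fun ω => by simp)) 0
    simp only [seqDensity, Finset.univ_eq_empty, Finset.prod_empty] at h
    simp only [likelihood, Finset.univ_eq_empty, Finset.prod_empty]
    rw [← h]
    congr 1
    exact funext fun ω => Prod.ext rfl (Subsingleton.elim _ _)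

/-- For a fixed design, the standardized prediction error is a standard Gaussian variable
independent of the observations. -/
lemma indepFun_standardized (hM : IsModel P k σ f ε U) (hσ : 0 < σ)
    (hk : ∀ z, 0 < k z z ∧ k z z ≤ 1) {n : ℕ} (a : Fin n → X) (z : X) :
    IndepFun (obs f ε a)
        (fun ω => (f z ω - postMean k σ a (obs f ε a ω) z) / postStd k σ a z) P ∧
      P.map (fun ω => (f z ω - postMean k σ a (obs f ε a ω) z) / postStd k σ a z) =
        gaussianReal 0 1 := by
  obtain ⟨h1, h2⟩ := hM.indepFun_sub_postMean hσ a z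
  have hv := hM.postVar_pos hσ hk a z
  refine ⟨h1.comp measurable_id (measurable_id.div_const _), ?_⟩
  have h3 := Measure.map_map (μ := P)
    (f := fun ω => f z ω - postMean k σ a (obs f ε a ω) z)
    (measurable_id.div_const (postStd k σ a z))
    ((hM.measurable_f z).sub ((measurable_postMean_data k σ a z).comp (hM.measurable_obs a)))
  simp only [id, h2] at h3
  refine h3.symm.trans ?_
  rw [gaussianReal_map_div_const, zero_div]
  congr 1
  ext
  have : (postStd k σ a z) ^ 2 = postVar k σ a z := Real.sq_sqrt hv.le
  simp [this, hv.le, hv.ne']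

/-- The numerator of Bayes' rule: the integral over the objective of a function of the standardized
prediction error against the likelihood of the data `e`. -/
def bayesIntegral (P : Measure Ω) (k : X → X → ℝ) (σ : ℝ) (f : X → Ω → ℝ) (h : ℝ → ℝ≥0) {n : ℕ}
    (a : Fin n → X) (z : X) (e : Fin n → ℝ) : ℝ≥0∞ :=
  ∫⁻ ω, h ((f z ω - postMean k σ a e z) / postStd k σ a z) *
    ENNReal.ofReal (likelihood σ (path f ω ∘ a) e) ∂P

lemma measurable_likelihood_path {n : ℕ} (a : Fin n → X) :
    Measurable fun q : (X → ℝ) × (Fin n → ℝ) => ENNReal.ofReal (likelihood σ (q.1 ∘ a) q.2) := by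
  refine (measurable_likelihood.comp (Measurable.prodMk ?_ measurable_snd)).ennreal_ofReal
  exact measurable_pi_lambda _ fun i => (measurable_pi_apply (a i)).comp measurable_fst

lemma measurable_standardized (k : X → X → ℝ) (σ : ℝ) {h : ℝ → ℝ≥0} (hh : Continuous h) {n : ℕ}
    (a : Fin n → X) (z : X) : Measurable fun q : (X → ℝ) × (Fin n → ℝ) =>
      (h ((q.1 z - postMean k σ a q.2 z) / postStd k σ a z) : ℝ≥0∞) := by
  refine (hh.measurable.comp ((Measurable.sub ?_ ?_).div_const _)).coe_nnreal_ennreal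
  · exact (measurable_pi_apply z).comp measurable_fst
  · exact (measurable_postMean_data k σ a z).comp measurable_snd

lemma measurable_bayes_integrand {h : ℝ → ℝ≥0} (hh : Continuous h) {n : ℕ} (a : Fin n → X)
    (z : X) : Measurable fun q : (X → ℝ) × (Fin n → ℝ) =>
      (h ((q.1 z - postMean k σ a q.2 z) / postStd k σ a z) : ℝ≥0∞) *
        ENNReal.ofReal (likelihood σ (q.1 ∘ a) q.2) := by
  exact (measurable_standardized k σ hh a z).mul (measurable_likelihood_path a)

lemma setLIntegral_bayesIntegral (hM : IsModel P k σ f ε U) (hσ : 0 < σ)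
    (hk : ∀ z, 0 < k z z ∧ k z z ≤ 1) {h : ℝ → ℝ≥0} (hh : Continuous h) {n : ℕ} (a : Fin n → X)
    (z : X) {B : Set (Fin n → ℝ)} (hB : MeasurableSet B) :
    ∫⁻ e in B, bayesIntegral P k σ f h a z e =
      P.map (obs f ε a) B * ∫⁻ w, h w ∂(gaussianReal 0 1) := by
  have hG := measurable_bayes_integrand (k := k) (σ := σ) hh a z
  have hIm : Measurable (B.indicator (fun _ => (1 : ℝ≥0∞))) := measurable_const.indicator hB
  have hH : Measurable fun q : (X → ℝ) × (Fin n → ℝ) => B.indicator (fun _ => (1 : ℝ≥0∞)) q.2 *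
      h ((q.1 z - postMean k σ a q.2 z) / postStd k σ a z) := by
    have hB' : Measurable fun q : (X → ℝ) × (Fin n → ℝ) =>
        B.indicator (fun _ => (1 : ℝ≥0∞)) q.2 := hIm.comp measurable_snd
    exact hB'.mul (measurable_standardized k σ hh a z)
  have hlik := measurable_likelihood_path (σ := σ) a
  obtain ⟨h1, h2⟩ := hM.indepFun_standardized hσ hk a z
  have hWm : Measurable fun ω =>
      (f z ω - postMean k σ a (obs f ε a ω) z) / postStd k σ a z :=
    ((hM.measurable_f z).sub ((measurable_postMean_data k σ a z).comp
      (hM.measurable_obs a))).div_const _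
  calc ∫⁻ e in B, bayesIntegral P k σ f h a z e
      = ∫⁻ e, ∫⁻ p, B.indicator (fun _ => (1 : ℝ≥0∞)) e *
          (h ((p z - postMean k σ a e z) / postStd k σ a z) *
            ENNReal.ofReal (likelihood σ (p ∘ a) e)) ∂(P.map (path f)) := by
        rw [← lintegral_indicator hB]
        refine lintegral_congr fun e => ?_
        have hGe : Measurable fun p : X → ℝ =>
            (h ((p z - postMean k σ a e z) / postStd k σ a z) : ℝ≥0∞) *
              ENNReal.ofReal (likelihood σ (p ∘ a) e) :=
          hG.comp (measurable_id.prodMk measurable_const)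
        rw [lintegral_const_mul _ hGe]
        by_cases he : e ∈ B
        · simp only [Set.indicator_of_mem he, one_mul]
          rw [lintegral_map hGe hM.measurable_path]
          rfl
        · simp [Set.indicator_of_notMem he]
    _ = ∫⁻ q, B.indicator (fun _ => (1 : ℝ≥0∞)) q.2 *
          h ((q.1 z - postMean k σ a q.2 z) / postStd k σ a z)
          ∂(P.map (fun ω => (path f ω, obs f ε a ω))) := by
        rw [hM.map_path_obs hσ, lintegral_withDensity_eq_lintegral_mul _ hlik hH,
          lintegral_prod_symm _ (hlik.mul hH).aemeasurable]
        refine lintegral_congr fun e => lintegral_congr fun p => ?_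
        simp only [Pi.mul_apply]
        ring
    _ = ∫⁻ ω, B.indicator (fun _ => (1 : ℝ≥0∞)) (obs f ε a ω) *
          h ((f z ω - postMean k σ a (obs f ε a ω) z) / postStd k σ a z) ∂P := by
        rw [lintegral_map hH (hM.measurable_path.prodMk (hM.measurable_obs a))]
        rfl
    _ = _ := by
        have h3 := lintegral_mul_eq_lintegral_mul_lintegral_of_indepFun (μ := P)
          (f := fun ω => B.indicator (fun _ => (1 : ℝ≥0∞)) (obs f ε a ω))
          (g := fun ω => (h ((f z ω - postMean k σ a (obs f ε a ω) z) / postStd k σ a z) : ℝ≥0∞))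
          (hIm.comp (hM.measurable_obs a)) (hh.measurable.comp hWm).coe_nnreal_ennreal
          (h1.comp hIm hh.measurable.coe_nnreal_ennreal)
        refine h3.trans ?_
        congr 1
        · rw [← lintegral_map (f := B.indicator (fun _ => (1 : ℝ≥0∞))) hIm (hM.measurable_obs a),
            lintegral_indicator hB]
          simp
        · rw [← h2, lintegral_map hh.measurable.coe_nnreal_ennreal hWm]

lemma continuous_bayesIntegral (hM : IsModel P k σ f ε U) {h : ℝ → ℝ≥0} (hh : Continuous h)
    {C : ℝ≥0} (hC : ∀ w, h w ≤ C) {n : ℕ} (a : Fin n → X) (z : X) :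
    Continuous (bayesIntegral P k σ f h a z) := by
  have hcont : ∀ ω, Continuous fun e => (h ((f z ω - postMean k σ a e z) / postStd k σ a z)
      : ℝ≥0∞) * ENNReal.ofReal (likelihood σ (path f ω ∘ a) e) := fun ω => by
    have h1 : Continuous fun e => h ((f z ω - postMean k σ a e z) / postStd k σ a z) *
        (likelihood σ (path f ω ∘ a) e).toNNReal :=
      (hh.comp ((continuous_const.sub (continuous_postMean_data k σ a z)).div_const _)).mul
        (continuous_real_toNNReal.comp (continuous_likelihood _))
    have h2 := ENNReal.continuous_coe.comp h1
    simpa [Function.comp_def, ENNReal.ofReal] using h2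
  rw [continuous_iff_continuousAt]
  intro e₀
  refine tendsto_lintegral_filter_of_dominated_convergence
    (fun _ => (C : ℝ≥0∞) * ENNReal.ofReal (((√(2 * Real.pi * (σ ^ 2).toNNReal))⁻¹) ^ n))
    (Filter.Eventually.of_forall fun e => ?_) (Filter.Eventually.of_forall fun e => ?_) ?_ ?_
  · exact (measurable_bayes_integrand (k := k) (σ := σ) hh a z).comp
      (hM.measurable_path.prodMk measurable_const)
  · refine ae_of_all _ fun ω => ?_
    gcongr
    · exact hC _
    · exact likelihood_le _ _
  · simp [ENNReal.mul_eq_top]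
  · exact ae_of_all _ fun ω => (hcont ω).tendsto e₀

/-- Bayes' rule for a fixed design. It holds at every data point `e`, and not merely at almost
every one, since both sides are continuous: this makes it applicable to adaptive designs, where
the points `a` are functions of `e`. -/
lemma bayesIntegral_eq (hM : IsModel P k σ f ε U) (hσ : 0 < σ)
    (hk : ∀ z, 0 < k z z ∧ k z z ≤ 1) {h : ℝ → ℝ≥0} (hh : Continuous h) {C : ℝ≥0}
    (hC : ∀ w, h w ≤ C) {n : ℕ} (a : Fin n → X) (z : X) (e : Fin n → ℝ) :
    bayesIntegral P k σ f h a z e =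
      (∫⁻ ω, ENNReal.ofReal (likelihood σ (path f ω ∘ a) e) ∂P) *
        ∫⁻ w, h w ∂(gaussianReal 0 1) := by
  have hone : ∀ e, bayesIntegral P k σ f (fun _ => 1) a z e =
      ∫⁻ ω, ENNReal.ofReal (likelihood σ (path f ω ∘ a) e) ∂P := fun e => by
    simp [bayesIntegral]
  have hfin : ∫⁻ w, h w ∂(gaussianReal 0 1) ≠ ∞ := by
    refine ne_top_of_le_ne_top (ENNReal.coe_ne_top (r := C)) ?_
    calc ∫⁻ w, h w ∂(gaussianReal 0 1) ≤ ∫⁻ _, (C : ℝ≥0∞) ∂(gaussianReal 0 1) :=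
          lintegral_mono fun w => ENNReal.coe_le_coe.2 (hC w)
      _ = C := by simp
  have hc1 := hM.continuous_bayesIntegral hh hC a z
  have hc2 := hM.continuous_bayesIntegral (continuous_const (y := (1 : ℝ≥0)))
    (fun _ => le_rfl) a z
  have hc3 := (ENNReal.continuous_mul_const hfin).comp hc2
  have hae : bayesIntegral P k σ f h a z =ᵐ[volume] fun e =>
      bayesIntegral P k σ f (fun _ => 1) a z e * ∫⁻ w, h w ∂(gaussianReal 0 1) := by
    refine ae_eq_of_forall_setLIntegral_eq_of_sigmaFinite hc1.measurable hc3.measurable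
      fun B hB _ => ?_
    rw [lintegral_mul_const _ hc2.measurable, hM.setLIntegral_bayesIntegral hσ hk hh a z hB,
      hM.setLIntegral_bayesIntegral hσ hk continuous_const a z hB]
    simp
  have := congrFun ((hc1.ae_eq_iff_eq volume hc3).1 hae) e
  rw [this]
  simp only [Function.comp, hone]

end IsModel
end FixedDesign

/-! ### The posterior for an adaptive design -/

section Adaptive

variable {Ω : Type*} [MeasurableSpace Ω] {Θ : Type*} [MeasurableSpace Θ] {X : Type*}
  {P : Measure Ω} [IsProbabilityMeasure P] {k : X → X → ℝ} {σ : ℝ} {f : X → Ω → ℝ}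
  {ε : ℕ → Ω → ℝ} {U : Ω → Θ} {x : ℕ → Ω → X} [MeasurableSpace X]

/-- The observation made in round `i + 1`. -/
def runObs (f : X → Ω → ℝ) (ε : ℕ → Ω → ℝ) (x : ℕ → Ω → X) (i : ℕ) (ω : Ω) : ℝ :=
  f (x i ω) ω + ε i ω

/-- The points queried in the first `n` rounds. -/
def runPts (x : ℕ → Ω → X) (n : ℕ) (ω : Ω) : Fin n → X := fun i => x i ω

/-- The observations made in the first `n` rounds. -/
def runData (f : X → Ω → ℝ) (ε : ℕ → Ω → ℝ) (x : ℕ → Ω → X) (n : ℕ) (ω : Ω) : Fin n → ℝ :=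
  fun i => runObs f ε x i ω

/-- Every point is chosen by a measurable rule from the internal randomness and the past data. -/
def HasRule (f : X → Ω → ℝ) (ε : ℕ → Ω → ℝ) (U : Ω → Θ) (x : ℕ → Ω → X) : Prop :=
  ∀ n, ∃ π : Θ × (Fin n → X × ℝ) → X, Measurable π ∧
    ∀ ω, x n ω = π (U ω, fun i => (x i ω, f (x i ω) ω + ε i ω))

/-- The past points can be reconstructed from the internal randomness and the past observations,
so the rule can be taken to depend on these alone. -/
lemma HasRule.exists_of_data (hx : HasRule f ε U x) (n : ℕ) :
    ∃ ξ : Θ × (Fin n → ℝ) → X, Measurable ξ ∧ ∀ ω, x n ω = ξ (U ω, runData f ε x n ω) := by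
  induction n using Nat.strong_induction_on with
  | _ n ih =>
    choose ξ hξm hξ using ih
    obtain ⟨π, hπm, hπ⟩ := hx n
    refine ⟨fun q => π (q.1, fun i => (ξ i i.2
      (q.1, fun j : Fin i => q.2 (Fin.castLE i.2.le j)), q.2 i)), ?_, fun ω => ?_⟩
    · refine hπm.comp (measurable_fst.prodMk (measurable_pi_lambda _ fun i => ?_))
      refine Measurable.prodMk ((hξm i i.2).comp ?_)
        ((measurable_pi_apply i).comp measurable_snd)
      exact measurable_fst.prodMk (measurable_pi_lambda _ fun j =>
        (measurable_pi_apply _).comp measurable_snd)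
    · rw [hπ]
      congr 2
      funext i
      exact Prod.ext (hξ i i.2 ω) rfl

/-- The points queried in the first `n` rounds, as a function of the internal randomness and of the
observations. -/
def designOf (ξ : ∀ n : ℕ, Θ × (Fin n → ℝ) → X) (n : ℕ) (q : Θ × (Fin n → ℝ)) : Fin n → X :=
  fun i => ξ i (q.1, fun j : Fin i => q.2 (Fin.castLE i.2.le j))

lemma measurable_designOf {ξ : ∀ n : ℕ, Θ × (Fin n → ℝ) → X} (hξ : ∀ n, Measurable (ξ n))
    (n : ℕ) : Measurable (designOf ξ n) :=
  measurable_pi_lambda _ fun i => (hξ i).comp (measurable_fst.prodMk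
    (measurable_pi_lambda _ fun _ => (measurable_pi_apply _).comp measurable_snd))

variable [PseudoEMetricSpace X] [SecondCountableTopology X] [Nonempty X] [BorelSpace X]

namespace IsModel

lemma ae_evalLim (hc : ∀ᵐ ω ∂P, Continuous fun z => f z ω) :
    ∀ᵐ ω ∂P, ∀ z, evalLim (z, path f ω) = f z ω := by
  filter_upwards [hc] with ω hω z
  exact evalLim_of_continuous hω z

lemma exists_runData_eq (hc : ∀ᵐ ω ∂P, Continuous fun z => f z ω) (hx : HasRule f ε U x)
    (n : ℕ) :
    ∃ Ψ : Θ × ((X → ℝ) × (Fin n → ℝ)) → (Fin n → ℝ), Measurable Ψ ∧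
      ∀ᵐ ω ∂P, runData f ε x n ω = Ψ (U ω, (path f ω, fun i : Fin n => ε i ω)) := by
  induction n with
  | zero => exact ⟨fun _ => default, measurable_const, ae_of_all _ fun ω => Subsingleton.elim _ _⟩
  | succ n ih =>
    obtain ⟨Ψ, hΨm, hΨ⟩ := ih
    obtain ⟨ξ, hξm, hξ⟩ := hx.exists_of_data n
    let ρ : Θ × ((X → ℝ) × (Fin (n + 1) → ℝ)) → Θ × ((X → ℝ) × (Fin n → ℝ)) :=
      fun q => (q.1, (q.2.1, fun i : Fin n => q.2.2 i.castSucc))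
    have hρ : Measurable ρ := measurable_fst.prodMk ((measurable_fst.comp measurable_snd).prodMk
      (measurable_pi_lambda _ fun i =>
        (measurable_pi_apply _).comp (measurable_snd.comp measurable_snd)))
    refine ⟨fun q => Fin.snoc (Ψ (ρ q))
      (evalLim (ξ (q.1, Ψ (ρ q)), q.2.1) + q.2.2 (Fin.last n)), ?_, ?_⟩
    · refine measurable_pi_lambda _ fun i => Fin.lastCases ?_ (fun i => ?_) i
      · simp only [Fin.snoc_last]
        refine Measurable.add (measurable_evalLim.comp (Measurable.prodMk (hξm.comp
          (measurable_fst.prodMk (hΨm.comp hρ))) (measurable_fst.comp measurable_snd)))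
          ((measurable_pi_apply _).comp (measurable_snd.comp measurable_snd))
      · simp only [Fin.snoc_castSucc (α := fun _ => ℝ)]
        exact (measurable_pi_apply i).comp (hΨm.comp hρ)
    · filter_upwards [hΨ, ae_evalLim hc] with ω h1 h2
      have h3 : Ψ (ρ (U ω, (path f ω, fun i : Fin (n + 1) => ε i ω))) = runData f ε x n ω := by
        rw [h1]; rfl
      funext i
      refine Fin.lastCases ?_ (fun i => ?_) i
      · simp only [Fin.snoc_last, h3, ← hξ, h2]
        rfl
      · simp only [Fin.snoc_castSucc (α := fun _ => ℝ), h3]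
        rfl

lemma aemeasurable_runData (hM : IsModel P k σ f ε U)
    (hc : ∀ᵐ ω ∂P, Continuous fun z => f z ω) (hx : HasRule f ε U x) (n : ℕ) :
    AEMeasurable (runData f ε x n) P := by
  obtain ⟨Ψ, hΨm, hΨ⟩ := exists_runData_eq hc hx n
  exact ⟨_, hΨm.comp (hM.measurable_U.prodMk (hM.measurable_path.prodMk
    (measurable_pi_lambda _ fun i => hM.measurable_noise i))), hΨ⟩

lemma aemeasurable_runObs (hM : IsModel P k σ f ε U)
    (hc : ∀ᵐ ω ∂P, Continuous fun z => f z ω) (hx : HasRule f ε U x) (n : ℕ) :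
    AEMeasurable (runObs f ε x n) P :=
  (measurable_pi_apply (Fin.last n)).comp_aemeasurable (hM.aemeasurable_runData hc hx (n + 1))

lemma map_U_path (hM : IsModel P k σ f ε U) :
    P.map (fun ω => (U ω, path f ω)) = (P.map U).prod (P.map (path f)) := by
  have h : IndepFun U (path f) P := hM.indep_U.comp measurable_id measurable_fst
  exact (indepFun_iff_map_prod_eq_prod_map_map hM.measurable_U.aemeasurable
    hM.measurable_path.aemeasurable).1 h

lemma map_run_data (hM : IsModel P k σ f ε U) (hσ : 0 < σ)
    (hc : ∀ᵐ ω ∂P, Continuous fun z => f z ω) (hx : HasRule f ε U x)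
    {ξ : ∀ n : ℕ, Θ × (Fin n → ℝ) → X} (hξm : ∀ n, Measurable (ξ n))
    (hξ : ∀ n ω, x n ω = ξ n (U ω, runData f ε x n ω)) (n : ℕ) :
    P.map (fun ω => ((U ω, path f ω), runData f ε x n ω)) =
      (((P.map U).prod (P.map (path f))).prod volume).withDensity fun q =>
        ENNReal.ofReal (likelihood σ
          (fun i => evalLim (designOf ξ n (q.1.1, q.2) i, q.1.2)) q.2) := by
  rw [← hM.map_U_path]
  refine map_data_eq_withDensity (P := P) (D := fun ω => (U ω, path f ω))
    (y := runObs f ε x)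
    (c := fun i (q : (Θ × (X → ℝ)) × (Fin i → ℝ)) => evalLim (ξ i (q.1.1, q.2), q.1.2))
    (v := fun _ => (σ ^ 2).toNNReal)
    (hM.measurable_U.prodMk hM.measurable_path).aemeasurable
    (fun i => hM.aemeasurable_runObs hc hx i) (fun i => ?_) (fun _ => toNNReal_sq_ne_zero hσ)
    (fun i => ?_) n
  · exact measurable_evalLim.comp (((hξm i).comp ((measurable_fst.comp measurable_fst).prodMk
      measurable_snd)).prodMk (measurable_snd.comp measurable_fst))
  · obtain ⟨Ψ, hΨm, hΨ⟩ := exists_runData_eq hc hx i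
    refine hM.map_prodMk_noise i (Ψ := fun q => ((q.1, q.2.1), Ψ q)) ?_ ?_ ?_
    · exact (measurable_fst.prodMk (measurable_fst.comp measurable_snd)).prodMk hΨm
    · filter_upwards [hΨ] with ω hω
      rw [← hω]; rfl
    · filter_upwards [ae_evalLim hc] with ω hω
      have h : ξ i (U ω, fun j : Fin i => runObs f ε x j ω) = x i ω := (hξ i ω).symm
      simp only [hω, h]
      simp [runObs]

/-- The posterior disintegrated along the data of an adaptive run: Fubini's theorem reduces it to
fixed designs, since given the internal randomness and the observations, the points are fixed. -/
lemma lintegral_run (hM : IsModel P k σ f ε U) (hσ : 0 < σ) (hk : ∀ z, k z z ≤ 1)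
    (hc : ∀ᵐ ω ∂P, Continuous fun z => f z ω) (hx : HasRule f ε U x)
    {ξ : ∀ n : ℕ, Θ × (Fin n → ℝ) → X} (hξm : ∀ n, Measurable (ξ n))
    (hξ : ∀ n ω, x n ω = ξ n (U ω, runData f ε x n ω)) {n : ℕ}
    {ζ : Θ × (Fin n → ℝ) → X} (hζ : Measurable ζ) {h : ℝ → ℝ≥0} (hh : Continuous h)
    {B : Set (Θ × (Fin n → ℝ))} (hB : MeasurableSet B) :
    ∫⁻ ω, B.indicator (fun _ => (1 : ℝ≥0∞)) (U ω, runData f ε x n ω) *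
        h ((f (ζ (U ω, runData f ε x n ω)) ω - postMean k σ (runPts x n ω) (runData f ε x n ω)
          (ζ (U ω, runData f ε x n ω))) /
            postStd k σ (runPts x n ω) (ζ (U ω, runData f ε x n ω))) ∂P =
      ∫⁻ u, (∫⁻ e, B.indicator (fun _ => (1 : ℝ≥0∞)) (u, e) *
        bayesIntegral P k σ f h (designOf ξ n (u, e)) (ζ (u, e)) e) ∂(P.map U) := by
  have hIm : Measurable (B.indicator (fun _ => (1 : ℝ≥0∞))) := measurable_const.indicator hB
  have hdes := measurable_designOf hξm n
  -- reindexing of the triples of internal randomness, path and data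
  have hue : Measurable fun q : (Θ × (X → ℝ)) × (Fin n → ℝ) => (q.1.1, q.2) :=
    (measurable_fst.comp measurable_fst).prodMk measurable_snd
  have hp : Measurable fun q : (Θ × (X → ℝ)) × (Fin n → ℝ) => q.1.2 :=
    measurable_snd.comp measurable_fst
  have hmean : Measurable fun q : Θ × (Fin n → ℝ) =>
      postMean k σ (designOf ξ n q) q.2 (ζ q) :=
    (hM.continuous_postMean hσ hk hc n).measurable.comp
      (hdes.prodMk (measurable_snd.prodMk hζ))
  have hstd : Measurable fun q : Θ × (Fin n → ℝ) => postStd k σ (designOf ξ n q) (ζ q) :=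
    ((hM.continuous_postVar hσ hk hc n).measurable.comp (hdes.prodMk hζ)).sqrt
  have hval : Measurable fun q : (Θ × (X → ℝ)) × (Fin n → ℝ) =>
      evalLim (ζ (q.1.1, q.2), q.1.2) :=
    measurable_evalLim.comp ((hζ.comp hue).prodMk hp)
  have hW : Measurable fun q : (Θ × (X → ℝ)) × (Fin n → ℝ) =>
      (h ((evalLim (ζ (q.1.1, q.2), q.1.2) -
        postMean k σ (designOf ξ n (q.1.1, q.2)) q.2 (ζ (q.1.1, q.2))) /
          postStd k σ (designOf ξ n (q.1.1, q.2)) (ζ (q.1.1, q.2))) : ℝ≥0∞) :=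
    (hh.measurable.comp ((hval.sub (hmean.comp hue)).div (hstd.comp hue))).coe_nnreal_ennreal
  have hB' : Measurable fun q : (Θ × (X → ℝ)) × (Fin n → ℝ) =>
      B.indicator (fun _ => (1 : ℝ≥0∞)) (q.1.1, q.2) := hIm.comp hue
  have hG := hB'.mul hW
  have hlik : Measurable fun q : (Θ × (X → ℝ)) × (Fin n → ℝ) => ENNReal.ofReal (likelihood σ
      (fun i => evalLim (designOf ξ n (q.1.1, q.2) i, q.1.2)) q.2) := by
    refine (measurable_likelihood.comp (Measurable.prodMk ?_ measurable_snd)).ennreal_ofReal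
    exact measurable_pi_lambda _ fun i => measurable_evalLim.comp
      (((measurable_pi_apply i).comp (hdes.comp hue)).prodMk hp)
  have hpts : ∀ ω, runPts x n ω = designOf ξ n (U ω, runData f ε x n ω) := fun ω =>
    funext fun i => hξ i ω
  calc _ = ∫⁻ q, B.indicator (fun _ => (1 : ℝ≥0∞)) (q.1.1, q.2) *
        h ((evalLim (ζ (q.1.1, q.2), q.1.2) -
        postMean k σ (designOf ξ n (q.1.1, q.2)) q.2 (ζ (q.1.1, q.2))) /
          postStd k σ (designOf ξ n (q.1.1, q.2)) (ζ (q.1.1, q.2)))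
        ∂(P.map fun ω => ((U ω, path f ω), runData f ε x n ω)) := by
        refine Eq.trans ?_ (lintegral_map' hG.aemeasurable
          ((hM.measurable_U.prodMk hM.measurable_path).aemeasurable.prodMk
            (hM.aemeasurable_runData hc hx n))).symm
        refine lintegral_congr_ae ?_
        filter_upwards [ae_evalLim hc] with ω hω
        simp only [Pi.mul_apply, hω, hpts]
    _ = ∫⁻ u, (∫⁻ p, (∫⁻ e, ENNReal.ofReal (likelihood σ
          (fun i => evalLim (designOf ξ n (u, e) i, p)) e) *
        (B.indicator (fun _ => (1 : ℝ≥0∞)) (u, e) *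
        h ((evalLim (ζ (u, e), p) - postMean k σ (designOf ξ n (u, e)) e (ζ (u, e))) /
          postStd k σ (designOf ξ n (u, e)) (ζ (u, e))))) ∂(P.map (path f))) ∂(P.map U) := by
        rw [hM.map_run_data hσ hc hx hξm hξ n]
        refine (lintegral_withDensity_eq_lintegral_mul _ hlik hG).trans ?_
        rw [lintegral_prod _ (hlik.mul hG).aemeasurable,
          lintegral_prod _ (hlik.mul hG).lintegral_prod_right'.aemeasurable]
        rfl
    _ = _ := by
        refine lintegral_congr fun u => ?_
        have hpe : Measurable fun q : (X → ℝ) × (Fin n → ℝ) => ((u, q.1), q.2) :=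
          (measurable_const.prodMk measurable_fst).prodMk measurable_snd
        have hsw : AEMeasurable (Function.uncurry fun (p : X → ℝ) (e : Fin n → ℝ) =>
            ENNReal.ofReal (likelihood σ (fun i => evalLim (designOf ξ n (u, e) i, p)) e) *
              (B.indicator (fun _ => (1 : ℝ≥0∞)) (u, e) *
                h ((evalLim (ζ (u, e), p) - postMean k σ (designOf ξ n (u, e)) e (ζ (u, e))) /
                  postStd k σ (designOf ξ n (u, e)) (ζ (u, e)))))
            ((P.map (path f)).prod volume) := ((hlik.mul hG).comp hpe).aemeasurable
        rw [lintegral_lintegral_swap hsw]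
        refine lintegral_congr fun e => ?_
        have hpe2 : Measurable fun p : X → ℝ => ((u, p), e) :=
          (measurable_const.prodMk measurable_id).prodMk measurable_const
        refine (lintegral_map ((hlik.mul hG).comp hpe2) hM.measurable_path).trans ?_
        rw [bayesIntegral, ← lintegral_const_mul' _ _ (by
          by_cases he : (u, e) ∈ B <;> simp [he])]
        refine lintegral_congr_ae ?_
        filter_upwards [ae_evalLim hc] with ω hω
        simp only [Function.comp, Pi.mul_apply, hω]
        have : (fun i => f (designOf ξ n (u, e) i) ω) = path f ω ∘ designOf ξ n (u, e) := rfl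
        rw [this, mul_left_comm, mul_comm (ENNReal.ofReal _)]

/-- In an adaptive run, at any point determined by the data, the standardized prediction error of
the posterior mean is a standard Gaussian variable independent of the data. -/
theorem map_run_standardized (hM : IsModel P k σ f ε U) (hσ : 0 < σ)
    (hk : ∀ z, 0 < k z z ∧ k z z ≤ 1)
    (hc : ∀ᵐ ω ∂P, Continuous fun z => f z ω) (hx : HasRule f ε U x) {n : ℕ}
    {ζ : Θ × (Fin n → ℝ) → X} (hζ : Measurable ζ) :
    AEMeasurable (fun ω => (f (ζ (U ω, runData f ε x n ω)) ω -
        postMean k σ (runPts x n ω) (runData f ε x n ω) (ζ (U ω, runData f ε x n ω))) /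
          postStd k σ (runPts x n ω) (ζ (U ω, runData f ε x n ω))) P ∧
    P.map (fun ω => ((U ω, runData f ε x n ω), (f (ζ (U ω, runData f ε x n ω)) ω -
        postMean k σ (runPts x n ω) (runData f ε x n ω) (ζ (U ω, runData f ε x n ω))) /
          postStd k σ (runPts x n ω) (ζ (U ω, runData f ε x n ω)))) =
      (P.map fun ω => (U ω, runData f ε x n ω)).prod (gaussianReal 0 1) := by
  choose ξ hξm hξ using fun n => hx.exists_of_data n
  have hpts : ∀ ω, runPts x n ω = designOf ξ n (U ω, runData f ε x n ω) := fun ω =>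
    funext fun i => hξ i ω
  have hdata : AEMeasurable (fun ω => (U ω, runData f ε x n ω)) P :=
    hM.measurable_U.aemeasurable.prodMk (hM.aemeasurable_runData hc hx n)
  set W : Ω → ℝ := fun ω => (f (ζ (U ω, runData f ε x n ω)) ω -
        postMean k σ (runPts x n ω) (runData f ε x n ω) (ζ (U ω, runData f ε x n ω))) /
          postStd k σ (runPts x n ω) (ζ (U ω, runData f ε x n ω)) with hW
  have hWm : AEMeasurable W P := by
    have h1 : AEMeasurable (fun ω => evalLim (ζ (U ω, runData f ε x n ω), path f ω)) P :=
      measurable_evalLim.comp_aemeasurable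
        ((hζ.comp_aemeasurable hdata).prodMk hM.measurable_path.aemeasurable)
    have h2 : AEMeasurable (fun ω => f (ζ (U ω, runData f ε x n ω)) ω) P := by
      refine h1.congr ?_
      filter_upwards [ae_evalLim hc] with ω hω using hω _
    have hd := (measurable_designOf hξm n).comp_aemeasurable hdata
    have h3 := (hM.continuous_postMean hσ (fun z => (hk z).2) hc n).measurable.comp_aemeasurable
      (hd.prodMk ((measurable_snd.comp_aemeasurable hdata).prodMk (hζ.comp_aemeasurable hdata)))
    have h4 := ((hM.continuous_postVar hσ (fun z => (hk z).2) hc n).measurable.comp_aemeasurable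
      (hd.prodMk (hζ.comp_aemeasurable hdata))).sqrt
    simp only [hW, hpts]
    exact (h2.sub h3).div h4
  refine ⟨hWm, ?_⟩
  have hjoint : AEMeasurable (fun ω => ((U ω, runData f ε x n ω), W ω)) P := hdata.prodMk hWm
  have hprob : IsProbabilityMeasure (P.map fun ω => (U ω, runData f ε x n ω)) :=
    Measure.isProbabilityMeasure_map hdata
  have hprob2 : IsProbabilityMeasure (P.map fun ω => ((U ω, runData f ε x n ω), W ω)) :=
    Measure.isProbabilityMeasure_map hjoint
  have key : ∀ (h : BoundedContinuousFunction ℝ ℝ≥0) {B : Set (Θ × (Fin n → ℝ))},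
      MeasurableSet B → ∫⁻ ω, B.indicator (fun _ => (1 : ℝ≥0∞)) (U ω, runData f ε x n ω) *
        h (W ω) ∂P = (P.map fun ω => (U ω, runData f ε x n ω)) B *
          ∫⁻ w, h w ∂(gaussianReal 0 1) := by
    intro h B hB
    obtain ⟨C, hC⟩ : ∃ C : ℝ≥0, ∀ w, h w ≤ C := ⟨nndist h 0, fun w => by
      have := h.dist_coe_le_dist (g := 0) w
      rw [← NNReal.coe_le_coe, coe_nndist]
      simpa [NNReal.dist_eq] using this⟩
    have hfin : ∫⁻ w, h w ∂(gaussianReal 0 1) ≠ ∞ := by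
      refine ne_top_of_le_ne_top (ENNReal.coe_ne_top (r := C)) ?_
      calc ∫⁻ w, h w ∂(gaussianReal 0 1) ≤ ∫⁻ _, (C : ℝ≥0∞) ∂(gaussianReal 0 1) :=
            lintegral_mono fun w => ENNReal.coe_le_coe.2 (hC w)
        _ = C := by simp
    have hIm : Measurable (B.indicator (fun _ => (1 : ℝ≥0∞))) := measurable_const.indicator hB
    have e1 := hM.lintegral_run hσ (fun z => (hk z).2) hc hx hξm hξ hζ h.continuous hB
    have e2 := hM.lintegral_run hσ (fun z => (hk z).2) hc hx hξm hξ hζ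
      (continuous_const (y := (1 : ℝ≥0))) hB
    simp only [hM.bayesIntegral_eq hσ hk h.continuous hC] at e1
    simp only [hM.bayesIntegral_eq hσ hk (continuous_const (y := (1 : ℝ≥0))) (fun _ => le_rfl),
      ENNReal.coe_one, lintegral_const, measure_univ, mul_one] at e2
    have e3 : (P.map fun ω => (U ω, runData f ε x n ω)) B =
        ∫⁻ ω, B.indicator (fun _ => (1 : ℝ≥0∞)) (U ω, runData f ε x n ω) ∂P := by
      rw [← lintegral_map' hIm.aemeasurable hdata, lintegral_indicator hB]
      simp
    refine e1.trans ?_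
    rw [e3, e2, ← lintegral_mul_const' _ _ hfin]
    refine lintegral_congr fun u => ?_
    rw [← lintegral_mul_const' _ _ hfin]
    exact lintegral_congr fun e => (mul_assoc _ _ _).symm
  refine (Measure.prod_eq fun B C hB hC => ?_).symm
  -- for fixed `B`, both sides are finite measures in `C`
  have hmeas : ((P.map fun ω => ((U ω, runData f ε x n ω), W ω)).restrict
      (B ×ˢ Set.univ)).map Prod.snd =
      (P.map fun ω => (U ω, runData f ε x n ω)) B • gaussianReal 0 1 := by
    have : IsFiniteMeasure ((P.map fun ω => (U ω, runData f ε x n ω)) B • gaussianReal 0 1) :=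
      Measure.smul_finite _ (measure_ne_top _ _)
    refine ext_of_forall_lintegral_eq_of_IsFiniteMeasure fun h => ?_
    have hhm : Measurable fun w => (h w : ℝ≥0∞) := h.continuous.measurable.coe_nnreal_ennreal
    rw [lintegral_map hhm measurable_snd, lintegral_smul_measure, smul_eq_mul, ← key h hB,
      ← lintegral_indicator (hB.prod MeasurableSet.univ)]
    have hm : Measurable ((B ×ˢ (Set.univ : Set ℝ)).indicator
        fun q : (Θ × (Fin n → ℝ)) × ℝ => (h q.2 : ℝ≥0∞)) :=
      (hhm.comp measurable_snd).indicator (hB.prod MeasurableSet.univ)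
    rw [lintegral_map' hm.aemeasurable hjoint]
    refine lintegral_congr fun ω => ?_
    by_cases hω : (U ω, runData f ε x n ω) ∈ B <;> simp [Set.indicator, hω]
  have := congrArg (fun μ : Measure ℝ => μ C) hmeas
  simp only [Measure.smul_apply, smul_eq_mul] at this
  rw [← this, Measure.map_apply measurable_snd hC,
    Measure.restrict_apply (measurable_snd hC)]
  congr 1
  ext q
  simp [and_comm]

end IsModel
end Adaptive

/-! ### The information gain of a fixed design -/

lemma integrable_log_gaussianPDFReal {v : ℝ≥0} (hv : v ≠ 0) :
    Integrable (fun w => Real.log (gaussianPDFReal 0 v w)) (gaussianReal 0 v) ∧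
      ∫ w, Real.log (gaussianPDFReal 0 v w) ∂(gaussianReal 0 v) =
        -(Real.log (2 * Real.pi * v) / 2) - 1 / 2 := by
  have hv' : (0 : ℝ) < v := by positivity
  have h1 : (fun w => Real.log (gaussianPDFReal 0 v w)) =
      fun w => -(Real.log (2 * Real.pi * v) / 2) - w ^ 2 / (2 * v) := by
    ext w
    rw [gaussianPDFReal, Real.log_mul (by positivity) (Real.exp_pos _).ne', Real.log_inv,
      Real.log_sqrt (by positivity), Real.log_exp]
    ring
  have h2 : Integrable (fun w : ℝ => w ^ 2) (gaussianReal 0 v) :=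
    (memLp_id_gaussianReal 2).integrable_sq
  have h3 : ∫ w, w ^ 2 ∂(gaussianReal 0 v) = v := by
    have := variance_fun_id_gaussianReal (μ := 0) (v := v)
    rwa [variance_of_integral_eq_zero aemeasurable_id' (by simp)] at this
  rw [h1]
  refine ⟨(integrable_const _).sub (h2.div_const _), ?_⟩
  rw [integral_sub (integrable_const _) (h2.div_const _), integral_div, h3]
  simp
  field_simp

section InfoGain

variable {Ω : Type*} [MeasurableSpace Ω] {Θ : Type*} [MeasurableSpace Θ] {X : Type*}
  {P : Measure Ω} [IsProbabilityMeasure P] {k : X → X → ℝ} {σ : ℝ} {f : X → Ω → ℝ}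
  {ε : ℕ → Ω → ℝ} {U : Ω → Θ}

/-- If `R` is a centered Gaussian variable of variance `v`, then the logarithm of its density at
`R` is integrable, with an integral that depends on `v` only. -/
lemma integrable_log_density {R : Ω → ℝ} {v : ℝ≥0} (hv : v ≠ 0) (hR : AEMeasurable R P)
    (hlaw : P.map R = gaussianReal 0 v) :
    Integrable (fun ω => Real.log (gaussianPDFReal 0 v (R ω))) P ∧
      ∫ ω, Real.log (gaussianPDFReal 0 v (R ω)) ∂P =
        -(Real.log (2 * Real.pi * v) / 2) - 1 / 2 := by
  obtain ⟨h1, h2⟩ := integrable_log_gaussianPDFReal hv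
  have hm : Measurable fun w => Real.log (gaussianPDFReal 0 v w) :=
    (measurable_gaussianPDFReal 0 v).log
  rw [← hlaw] at h1 h2
  exact ⟨h1.comp_aemeasurable hR, by
    rw [← h2, integral_map hR hm.aestronglyMeasurable]⟩

lemma measurable_likelihood_swap {n : ℕ} :
    Measurable fun q : (Fin n → ℝ) × (Fin n → ℝ) => likelihood σ q.2 q.1 := by
  have h : (fun q : (Fin n → ℝ) × (Fin n → ℝ) => likelihood σ q.2 q.1) =
      (fun q : (Fin n → ℝ) × (Fin n → ℝ) => likelihood σ q.1 q.2) ∘ Prod.swap := rfl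
  rw [h]
  exact measurable_likelihood.comp measurable_swap

/-- The first `n` points of a sequential design. -/
def prefixOf (a : ℕ → X) (n : ℕ) : Fin n → X := fun i => a i

/-- The variance of the prediction of the observation number `i` from the previous ones. -/
def predVar (k : X → X → ℝ) (σ : ℝ) (a : ℕ → X) (i : ℕ) : ℝ≥0 :=
  (postVar k σ (prefixOf a i) (a i)).toNNReal + (σ ^ 2).toNNReal

/-- The mean of the prediction of the observation number `i` from the previous ones. -/
def predMean (k : X → X → ℝ) (σ : ℝ) (a : ℕ → X) (i : ℕ) (q : Unit × (Fin i → ℝ)) : ℝ :=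
  postMean k σ (prefixOf a i) q.2 (a i)

/-- The density of the first `n` observations. -/
def predDensity (k : X → X → ℝ) (σ : ℝ) (a : ℕ → X) (n : ℕ) (e : Fin n → ℝ) : ℝ :=
  seqDensity (predMean k σ a) (predVar k σ a) n () e

lemma measurable_predMean (k : X → X → ℝ) (σ : ℝ) (a : ℕ → X) (i : ℕ) :
    Measurable (predMean k σ a i) :=
  (measurable_postMean_data k σ _ _).comp measurable_snd

lemma measurable_predDensity (k : X → X → ℝ) (σ : ℝ) (a : ℕ → X) (n : ℕ) :
    Measurable (predDensity k σ a n) := by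
  have h : Measurable fun q : Unit × (Fin n → ℝ) =>
    seqDensity (predMean k σ a) (predVar k σ a) n q.1 q.2 :=
      measurable_seqDensity (measurable_predMean k σ a) n
  have h2 : predDensity k σ a n = (fun q : Unit × (Fin n → ℝ) =>
    seqDensity (predMean k σ a) (predVar k σ a) n q.1 q.2) ∘ fun e => ((), e) := by
    funext e; rfl
  rw [h2]
  exact h.comp measurable_prodMk_left

lemma predVar_ne_zero (hσ : 0 < σ) (a : ℕ → X) (i : ℕ) : predVar k σ a i ≠ 0 := by
  simp [predVar, hσ.ne']

namespace IsModel

/-- The error in predicting an observation from the previous ones. -/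
lemma indepFun_prediction (hM : IsModel P k σ f ε U) (hσ : 0 < σ) (a : ℕ → X) (i : ℕ) :
    IndepFun (obs f ε (prefixOf a i))
        (fun ω => f (a i) ω + ε i ω -
          postMean k σ (prefixOf a i) (obs f ε (prefixOf a i) ω) (a i)) P ∧
      P.map (fun ω => f (a i) ω + ε i ω -
          postMean k σ (prefixOf a i) (obs f ε (prefixOf a i) ω) (a i)) =
        gaussianReal 0 (predVar k σ a i) := by
  obtain ⟨h1, h2⟩ := hM.indepFun_sub_postMean hσ (prefixOf a i) (a i)
  set Y := obs f ε (prefixOf a i) with hY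
  set W : Ω → ℝ := fun ω => f (a i) ω - postMean k σ (prefixOf a i) (Y ω) (a i) with hW
  have hYm : Measurable Y := hM.measurable_obs _
  have hWm : Measurable W :=
    (hM.measurable_f _).sub ((measurable_postMean_data k σ _ _).comp hYm)
  have hεm := hM.measurable_noise i
  have hΨ : Measurable fun q : Θ × ((X → ℝ) × (Fin i → ℝ)) =>
      (fun j : Fin i => q.2.1 (prefixOf a i j) + q.2.2 j) :=
    measurable_pi_lambda _ fun j => ((measurable_pi_apply _).comp (measurable_fst.comp
      measurable_snd)).add ((measurable_pi_apply _).comp (measurable_snd.comp measurable_snd))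
  have hval : Measurable fun q : Θ × ((X → ℝ) × (Fin i → ℝ)) => q.2.1 (a i) :=
    (measurable_pi_apply _).comp (measurable_fst.comp measurable_snd)
  have h3 : IndepFun (fun ω => (W ω, Y ω)) (ε i) P :=
    (hM.indepFun_noise i).comp (φ := fun q : Θ × ((X → ℝ) × (Fin i → ℝ)) =>
      (q.2.1 (a i) - postMean k σ (prefixOf a i)
        (fun j : Fin i => q.2.1 (prefixOf a i j) + q.2.2 j) (a i),
        fun j : Fin i => q.2.1 (prefixOf a i j) + q.2.2 j)) (ψ := id)
      ((hval.sub ((measurable_postMean_data k σ _ _).comp hΨ)).prodMk hΨ) measurable_id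
  have h4 : IndepFun W (ε i) P := h3.comp measurable_fst measurable_id
  have h5 := indepFun_prodMk_left hεm hWm hYm h3.symm h1.symm
  have hsum : (fun ω => f (a i) ω + ε i ω - postMean k σ (prefixOf a i) (Y ω) (a i)) =
      W + ε i := by
    ext ω; simp only [hW, Pi.add_apply]; ring
  rw [hsum]
  constructor
  · refine (h5.comp (φ := fun q : ℝ × ℝ => q.2 + q.1) (ψ := id)
      (measurable_snd.add measurable_fst) measurable_id).symm
  · have := gaussianReal_add_gaussianReal_of_indepFun h4 h2 (hM.law_noise i)
    rw [this, predVar, add_zero]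

lemma map_obs (hM : IsModel P k σ f ε U) (hσ : 0 < σ) (a : ℕ → X) (n : ℕ) :
    P.map (obs f ε (prefixOf a n)) = volume.withDensity fun e =>
      ENNReal.ofReal (predDensity k σ a n e) := by
  have hm := measurable_predMean k σ a
  have h := map_data_eq_withDensity (P := P) (D := fun _ => ())
    (y := fun i ω => f (a i) ω + ε i ω)
    (c := predMean k σ a) (v := predVar k σ a) aemeasurable_const
    (fun i => ((hM.measurable_f _).add (hM.measurable_noise i)).aemeasurable) hm
    (predVar_ne_zero hσ a) (fun i => by
      obtain ⟨h1, h2⟩ := hM.indepFun_prediction hσ a i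
      have hY : Measurable fun ω => ((), obs f ε (prefixOf a i) ω) :=
        measurable_const.prodMk (hM.measurable_obs _)
      have hpair : Measurable fun e : Fin i → ℝ => ((), e) :=
        measurable_const.prodMk measurable_id
      have h3 := h1.comp hpair measurable_id
      rw [← h2]
      exact (indepFun_iff_map_prod_eq_prod_map_map hY.aemeasurable
        (((hM.measurable_f _).add (hM.measurable_noise i)).sub
          ((measurable_postMean_data k σ _ _).comp (hM.measurable_obs _))).aemeasurable).1 h3) n
  have hdens := (measurable_predDensity k σ a n).ennreal_ofReal
  have h2 : P.map (obs f ε (prefixOf a n)) =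
      (P.map fun ω => ((), obs f ε (prefixOf a n) ω)).map Prod.snd := by
    rw [Measure.map_map measurable_snd (measurable_const.prodMk (hM.measurable_obs _))]
    rfl
  rw [h2]
  refine (congrArg (Measure.map Prod.snd) h).trans ?_
  refine Measure.ext_of_lintegral _ fun F hF => ?_
  have hF2 : Measurable fun q : Unit × (Fin n → ℝ) => F q.2 := hF.comp measurable_snd
  rw [lintegral_map hF measurable_snd, lintegral_withDensity_eq_lintegral_mul _ hdens hF,
    lintegral_withDensity_eq_lintegral_mul _ (measurable_seqDensity hm n).ennreal_ofReal hF2,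
    lintegral_prod _ ((measurable_seqDensity hm n).ennreal_ofReal.mul hF2).aemeasurable]
  simp [predDensity]

lemma map_obs_values (hM : IsModel P k σ f ε U) (hσ : 0 < σ) {n : ℕ} (a : Fin n → X) :
    P.map (fun ω => (obs f ε a ω, path f ω ∘ a)) =
      (volume.prod (P.map fun ω => path f ω ∘ a)).withDensity fun q =>
        ENNReal.ofReal (likelihood σ q.2 q.1) := by
  have hZ : Measurable fun ω => path f ω ∘ a := measurable_pi_lambda _ fun i => hM.measurable_f _
  have hlik := (measurable_likelihood_swap (σ := σ) (n := n)).ennreal_ofReal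
  have hsel : Measurable fun p : X → ℝ => p ∘ a :=
    measurable_pi_lambda _ fun i => measurable_pi_apply _
  refine Measure.ext_of_lintegral _ fun F hF => ?_
  have hF2 : Measurable fun q : (X → ℝ) × (Fin n → ℝ) => F (q.2, q.1 ∘ a) :=
    hF.comp (measurable_snd.prodMk (hsel.comp measurable_fst))
  have hlp := measurable_likelihood_path (σ := σ) a
  calc ∫⁻ q, F q ∂(P.map fun ω => (obs f ε a ω, path f ω ∘ a))
      = ∫⁻ q, F (q.2, q.1 ∘ a) ∂(P.map fun ω => (path f ω, obs f ε a ω)) := by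
        rw [lintegral_map hF ((hM.measurable_obs a).prodMk hZ),
          lintegral_map hF2 (hM.measurable_path.prodMk (hM.measurable_obs a))]
    _ = ∫⁻ e, (∫⁻ p, ENNReal.ofReal (likelihood σ (p ∘ a) e) * F (e, p ∘ a)
          ∂(P.map (path f))) := by
        rw [hM.map_path_obs hσ, lintegral_withDensity_eq_lintegral_mul _ hlp hF2,
          lintegral_prod_symm _ (hlp.mul hF2).aemeasurable]
        rfl
    _ = _ := by
        rw [lintegral_withDensity_eq_lintegral_mul _ hlik hF,
          lintegral_prod _ (hlik.mul hF).aemeasurable]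
        refine lintegral_congr fun e => ?_
        have hpair : Measurable fun z : Fin n → ℝ => (e, z) :=
          measurable_const.prodMk measurable_id
        have h1 : Measurable fun z : Fin n → ℝ =>
            ENNReal.ofReal (likelihood σ z e) * F (e, z) :=
          (hlik.comp hpair).mul (hF.comp hpair)
        have h2 : ∫⁻ p, ENNReal.ofReal (likelihood σ (p ∘ a) e) * F (e, p ∘ a)
            ∂(P.map (path f)) = ∫⁻ ω, ENNReal.ofReal (likelihood σ (path f ω ∘ a) e) *
              F (e, path f ω ∘ a) ∂P := lintegral_map (h1.comp hsel) hM.measurable_path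
        have h3 : ∫⁻ z, ENNReal.ofReal (likelihood σ z e) * F (e, z)
            ∂(P.map fun ω => path f ω ∘ a) = ∫⁻ ω, ENNReal.ofReal
              (likelihood σ (path f ω ∘ a) e) * F (e, path f ω ∘ a) ∂P := lintegral_map h1 hZ
        exact h2.trans h3.symm

/-- The chain rule for the information gain: every observation contributes the logarithm of the
ratio of its predictive variance and the noise variance. -/
theorem mutualInfo_eq (hM : IsModel P k σ f ε U) (hσ : 0 < σ) (a : ℕ → X) (n : ℕ) :
    mutualInfo P (obs f ε (prefixOf a n)) (fun ω => path f ω ∘ prefixOf a n) =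
      ENNReal.ofReal (∑ i : Fin n,
        Real.log (1 + postVar k σ (prefixOf a i) (a i) / σ ^ 2) / 2) := by
  set A := prefixOf a n with hA
  have hrm := measurable_predDensity k σ a n
  have hrpos : ∀ e, 0 < predDensity k σ a n e := fun e =>
    seqDensity_pos (predVar_ne_zero hσ a) n () e
  have hlpos : ∀ z e : Fin n → ℝ, 0 < likelihood σ z e := fun z e =>
    Finset.prod_pos fun i _ => gaussianPDFReal_pos _ _ _ (toNNReal_sq_ne_zero hσ)
  have hZ : Measurable fun ω => path f ω ∘ A := measurable_pi_lambda _ fun i => hM.measurable_f _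
  have hY : Measurable (obs f ε A) := hM.measurable_obs A
  have hYZ : Measurable fun ω => (obs f ε A ω, path f ω ∘ A) := hY.prodMk hZ
  have hlik := measurable_likelihood_swap (σ := σ) (n := n)
  have hrat : Measurable fun q : (Fin n → ℝ) × (Fin n → ℝ) =>
      likelihood σ q.2 q.1 / predDensity k σ a n q.1 :=
    hlik.div (hrm.comp measurable_fst)
  have hpY : IsProbabilityMeasure (P.map (obs f ε A)) :=
    Measure.isProbabilityMeasure_map hY.aemeasurable
  have hpZ : IsProbabilityMeasure (P.map fun ω => path f ω ∘ A) :=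
    Measure.isProbabilityMeasure_map hZ.aemeasurable
  have hpJ : IsProbabilityMeasure (P.map fun ω => (obs f ε A ω, path f ω ∘ A)) :=
    Measure.isProbabilityMeasure_map hYZ.aemeasurable
  set Q := (P.map (obs f ε A)).prod (P.map fun ω => path f ω ∘ A) with hQ
  have hJ : P.map (fun ω => (obs f ε A ω, path f ω ∘ A)) =
      Q.withDensity fun q => ENNReal.ofReal (likelihood σ q.2 q.1 / predDensity k σ a n q.1) := by
    have hYlaw : P.map (obs f ε A) = volume.withDensity fun e =>
        ENNReal.ofReal (predDensity k σ a n e) :=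
      hM.map_obs hσ a n
    have hrm' : Measurable fun q : (Fin n → ℝ) × (Fin n → ℝ) =>
        ENNReal.ofReal (predDensity k σ a n q.1) := (hrm.comp measurable_fst).ennreal_ofReal
    rw [hQ, hM.map_obs_values hσ, hYlaw, prod_withDensity_left hrm.ennreal_ofReal,
      ← withDensity_mul _ hrm' hrat.ennreal_ofReal]
    congr 1
    ext q
    rw [Pi.mul_apply, ← ENNReal.ofReal_mul (hrpos _).le, mul_div_cancel₀ _ (hrpos _).ne']
  have hac : P.map (fun ω => (obs f ε A ω, path f ω ∘ A)) ≪ Q := by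
    rw [hJ]; exact withDensity_absolutelyContinuous _ _
  have hllr : llr (P.map fun ω => (obs f ε A ω, path f ω ∘ A)) Q
      =ᵐ[P.map fun ω => (obs f ε A ω, path f ω ∘ A)]
        fun q => Real.log (likelihood σ q.2 q.1) - Real.log (predDensity k σ a n q.1) := by
    have h1 : (P.map fun ω => (obs f ε A ω, path f ω ∘ A)).rnDeriv Q =ᵐ[Q]
        fun q => ENNReal.ofReal (likelihood σ q.2 q.1 / predDensity k σ a n q.1) := by
      rw [hJ]; exact Measure.rnDeriv_withDensity Q hrat.ennreal_ofReal
    filter_upwards [hac.ae_le h1] with q hq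
    rw [llr, hq, ENNReal.toReal_ofReal (div_nonneg (hlpos _ _).le (hrpos _).le),
      Real.log_div (hlpos _ _).ne' (hrpos _).ne']
  have hlogm : Measurable fun q : (Fin n → ℝ) × (Fin n → ℝ) =>
      Real.log (likelihood σ q.2 q.1) - Real.log (predDensity k σ a n q.1) :=
    hlik.log.sub (hrm.comp measurable_fst).log
  -- the logarithms of the densities are sums of functions of the prediction errors
  have hlog1 : ∀ ω, Real.log (likelihood σ (path f ω ∘ A) (obs f ε A ω)) =
      ∑ i : Fin n, Real.log (gaussianPDFReal 0 (σ ^ 2).toNNReal (ε i ω)) := fun ω => by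
    rw [likelihood, Real.log_prod fun i _ =>
      (gaussianPDFReal_pos _ _ _ (toNNReal_sq_ne_zero hσ)).ne']
    refine Finset.sum_congr rfl fun i _ => ?_
    simp [gaussianPDFReal, obs, path]
  have hlog2 : ∀ ω, Real.log (predDensity k σ a n (obs f ε A ω)) = ∑ i : Fin n,
      Real.log (gaussianPDFReal 0 (predVar k σ a i) (f (a i) ω + ε i ω -
          postMean k σ (prefixOf a i) (obs f ε (prefixOf a i) ω) (a i))) := fun ω => by
    simp only [predDensity, seqDensity, predMean]
    rw [Real.log_prod fun (i : Fin n) _ =>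
      (gaussianPDFReal_pos _ _ _ (predVar_ne_zero (k := k) hσ a i)).ne']
    refine Finset.sum_congr rfl fun i _ => ?_
    have h : (fun j : Fin i => obs f ε A ω (Fin.castLE i.2.le j)) =
        obs f ε (prefixOf a i) ω := rfl
    rw [h]
    simp [gaussianPDFReal, obs, hA, prefixOf]
  have hI1 : ∀ i : Fin n, _ := fun i => integrable_log_density (toNNReal_sq_ne_zero hσ)
    (hM.measurable_noise i).aemeasurable (hM.law_noise i)
  have hI2 : ∀ i : Fin n, _ := fun i => integrable_log_density (R := fun ω =>
      f (a i) ω + ε i ω - postMean k σ (prefixOf a i) (obs f ε (prefixOf a i) ω) (a i))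
    (predVar_ne_zero hσ a i) (((hM.measurable_f _).add (hM.measurable_noise i)).sub
      ((measurable_postMean_data k σ _ _).comp (hM.measurable_obs _))).aemeasurable
    (hM.indepFun_prediction hσ a i).2
  have hint : Integrable (fun ω => Real.log (likelihood σ (path f ω ∘ A) (obs f ε A ω)) -
      Real.log (predDensity k σ a n (obs f ε A ω))) P := by
    simp only [hlog1, hlog2]
    exact (integrable_finsetSum _ fun i _ => (hI1 i).1).sub
      (integrable_finsetSum _ fun i _ => (hI2 i).1)
  have hllrint : Integrable (llr (P.map fun ω => (obs f ε A ω, path f ω ∘ A)) Q)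
      (P.map fun ω => (obs f ε A ω, path f ω ∘ A)) := by
    rw [integrable_congr hllr, integrable_map_measure hlogm.aestronglyMeasurable
      hYZ.aemeasurable]
    exact hint
  have hkl := toReal_klDiv_of_measure_eq hac (by simp)
  rw [integral_congr_ae hllr, integral_map hYZ.aemeasurable hlogm.aestronglyMeasurable] at hkl
  simp only [hlog1, hlog2] at hkl
  rw [integral_sub (integrable_finsetSum _ fun i _ => (hI1 i).1)
      (integrable_finsetSum _ fun i _ => (hI2 i).1),
    integral_finsetSum _ fun i _ => (hI1 i).1, integral_finsetSum _ fun i _ => (hI2 i).1,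
    ← Finset.sum_sub_distrib] at hkl
  rw [mutualInfo, ← ENNReal.ofReal_toReal (klDiv_ne_top hac hllrint), hkl]
  congr 1
  refine Finset.sum_congr rfl fun i _ => ?_
  rw [(hI1 i).2, (hI2 i).2]
  have hpv := hM.postVar_nonneg hσ (prefixOf a i) (a i)
  have hv : (predVar k σ a i : ℝ) = postVar k σ (prefixOf a i) (a i) + σ ^ 2 := by
    rw [predVar, NNReal.coe_add, Real.coe_toNNReal _ hpv, Real.coe_toNNReal _ (sq_nonneg σ)]
  have h1 : 1 + postVar k σ (prefixOf a i) (a i) / σ ^ 2 =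
      (2 * Real.pi * (predVar k σ a i)) / (2 * Real.pi * σ ^ 2) := by
    rw [hv]
    field_simp
    ring
  rw [h1, Real.log_div (by rw [hv]; positivity) (by positivity),
    Real.coe_toNNReal _ (sq_nonneg σ)]
  ring

/-- The information gained along any sequence of points is at most the maximum information gain;
in particular the supremum that defines the latter is finite. -/
theorem sum_log_le_maxInfoGain [Nonempty X] (hM : IsModel P k σ f ε U) (hσ : 0 < σ)
    (hk : ∀ z, k z z ≤ 1) (a : ℕ → X) (n : ℕ) :
    ∑ i ∈ Finset.range n, Real.log (1 + postVar k σ (prefixOf a i) (a i) / σ ^ 2) / 2 ≤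
      maxInfoGain P f ε n := by
  have hnn : ∀ (a : ℕ → X) (i : ℕ), 0 ≤ postVar k σ (prefixOf a i) (a i) / σ ^ 2 := fun a i =>
    div_nonneg (hM.postVar_nonneg hσ _ _) (sq_nonneg σ)
  have hbound : ∀ A : Fin n → X, mutualInfo P (fun ω (i : Fin n) => f (A i) ω + ε i ω)
      (fun ω (i : Fin n) => f (A i) ω) ≤ ENNReal.ofReal (n * (1 / σ ^ 2 / 2)) := by
    intro A
    let b : ℕ → X := fun i => if h : i < n then A ⟨i, h⟩ else Classical.arbitrary X
    have hb : prefixOf b n = A := by ext i; simp [prefixOf, b]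
    have h := hM.mutualInfo_eq hσ b n
    rw [hb] at h
    refine (le_of_eq h).trans (ENNReal.ofReal_le_ofReal ?_)
    calc _ ≤ ∑ _i : Fin n, 1 / σ ^ 2 / 2 := by
          refine Finset.sum_le_sum fun i _ => ?_
          have h1 := Real.log_le_sub_one_of_pos
            (show 0 < 1 + postVar k σ (prefixOf b i) (b i) / σ ^ 2 by linarith [hnn b i])
          have h2 : postVar k σ (prefixOf b i) (b i) / σ ^ 2 ≤ 1 / σ ^ 2 := by
            gcongr
            exact (hM.postVar_le hσ _ _).trans (hk _)
          linarith
      _ = _ := by simp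
  have hfin : (⨆ A : Fin n → X, mutualInfo P (fun ω (i : Fin n) => f (A i) ω + ε i ω)
      (fun ω (i : Fin n) => f (A i) ω)) ≠ ∞ :=
    ne_top_of_le_ne_top ENNReal.ofReal_ne_top (iSup_le hbound)
  have h1 := le_iSup (fun A : Fin n → X => mutualInfo P (fun ω (i : Fin n) => f (A i) ω + ε i ω)
      (fun ω (i : Fin n) => f (A i) ω)) (prefixOf a n)
  have h2 := ENNReal.toReal_mono hfin h1
  refine le_trans (le_of_eq ?_) h2
  have h3 := congrArg ENNReal.toReal (hM.mutualInfo_eq hσ a n)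
  rw [ENNReal.toReal_ofReal] at h3
  · rw [Finset.sum_range]
    exact h3.symm
  · exact Finset.sum_nonneg fun i _ => div_nonneg (Real.log_nonneg (by linarith [hnn a i]))
      zero_le_two

end IsModel
end InfoGain

/-! ### The regret of one round -/

section Regret

variable {Ω : Type*} [MeasurableSpace Ω] {Θ : Type*} [MeasurableSpace Θ] {X : Type*}
  {P : Measure Ω} [IsProbabilityMeasure P] {k : X → X → ℝ} {σ : ℝ} {f : X → Ω → ℝ}
  {ε : ℕ → Ω → ℝ} {U : Ω → Θ} {x : ℕ → Ω → X} {β : ℕ → ℝ} [MeasurableSpace X]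
  [PseudoEMetricSpace X] [SecondCountableTopology X] [Nonempty X] [BorelSpace X]

lemma IsRescaledEIRun.hasRule (hrun : IsRescaledEIRun k σ β f ε U x) : HasRule f ε U x :=
  hrun.rule

namespace IsModel

lemma aemeasurable_U_runData (hM : IsModel P k σ f ε U)
    (hc : ∀ᵐ ω ∂P, Continuous fun z => f z ω) (hx : HasRule f ε U x) (n : ℕ) :
    AEMeasurable (fun ω => (U ω, runData f ε x n ω)) P :=
  hM.measurable_U.aemeasurable.prodMk (hM.aemeasurable_runData hc hx n)

lemma aemeasurable_f_run (hM : IsModel P k σ f ε U)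
    (hc : ∀ᵐ ω ∂P, Continuous fun z => f z ω) (hx : HasRule f ε U x) (n : ℕ) :
    AEMeasurable (fun ω => f (x n ω) ω) P := by
  obtain ⟨ξ, hξm, hξ⟩ := hx.exists_of_data n
  have h1 : AEMeasurable (fun ω => evalLim (ξ (U ω, runData f ε x n ω), path f ω)) P :=
    measurable_evalLim.comp_aemeasurable ((hξm.comp_aemeasurable
      (hM.aemeasurable_U_runData hc hx n)).prodMk hM.measurable_path.aemeasurable)
  refine h1.congr ?_
  filter_upwards [ae_evalLim hc] with ω hω
  rw [hω, ← hξ]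

lemma postStd_le_one (hM : IsModel P k σ f ε U) (hσ : 0 < σ) (hk : ∀ z, k z z ≤ 1) {n : ℕ}
    (a : Fin n → X) (z : X) : postStd k σ a z ≤ 1 :=
  Real.sqrt_le_one.2 ((hM.postVar_le hσ a z).trans (hk z))

lemma postStd_pos (hM : IsModel P k σ f ε U) (hσ : 0 < σ) (hk : ∀ z, 0 < k z z ∧ k z z ≤ 1)
    {n : ℕ} (a : Fin n → X) (z : X) : 0 < postStd k σ a z :=
  Real.sqrt_pos.2 (hM.postVar_pos hσ hk a z)

/-- The posterior standard deviation at the point about to be queried is a measurable function of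
the internal randomness and of the past observations. -/
lemma exists_postStd_run_eq (hM : IsModel P k σ f ε U) (hσ : 0 < σ) (hk : ∀ z, k z z ≤ 1)
    (hc : ∀ᵐ ω ∂P, Continuous fun z => f z ω) (hx : HasRule f ε U x) (n : ℕ) :
    ∃ g : Θ × (Fin n → ℝ) → ℝ, Measurable g ∧
      ∀ ω, postStd k σ (runPts x n ω) (x n ω) = g (U ω, runData f ε x n ω) := by
  choose ξ hξm hξ using fun n => hx.exists_of_data n
  refine ⟨fun q => postStd k σ (designOf ξ n q) (ξ n q),
    ((hM.continuous_postVar hσ hk hc n).measurable.comp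
      ((measurable_designOf hξm n).prodMk (hξm n))).sqrt, fun ω => ?_⟩
  have hpts : runPts x n ω = designOf ξ n (U ω, runData f ε x n ω) := funext fun i => hξ i ω
  rw [hpts, hξ n ω]

lemma integrable_postStd_run (hM : IsModel P k σ f ε U) (hσ : 0 < σ) (hk : ∀ z, k z z ≤ 1)
    (hc : ∀ᵐ ω ∂P, Continuous fun z => f z ω) (hx : HasRule f ε U x) (n : ℕ) :
    Integrable (fun ω => postStd k σ (runPts x n ω) (x n ω)) P := by
  obtain ⟨g, hg, hgeq⟩ := hM.exists_postStd_run_eq hσ hk hc hx n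
  have hm : AEMeasurable (fun ω => postStd k σ (runPts x n ω) (x n ω)) P := by
    simp only [hgeq]
    exact hg.comp_aemeasurable (hM.aemeasurable_U_runData hc hx n)
  refine (integrable_const (1 : ℝ)).mono' hm.aestronglyMeasurable (ae_of_all _ fun ω => ?_)
  have h0 : 0 ≤ postStd k σ (runPts x n ω) (x n ω) := Real.sqrt_nonneg _
  rw [Real.norm_of_nonneg h0]
  exact hM.postStd_le_one hσ hk _ _

/-- The posterior mean at the queried point is an unbiased prediction of its value: the error is
the posterior standard deviation times an independent standard Gaussian variable. -/
lemma integral_sub_postMean_run (hM : IsModel P k σ f ε U) (hσ : 0 < σ)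
    (hk : ∀ z, 0 < k z z ∧ k z z ≤ 1)
    (hc : ∀ᵐ ω ∂P, Continuous fun z => f z ω) (hx : HasRule f ε U x) (n : ℕ) :
    Integrable (fun ω => f (x n ω) ω -
        postMean k σ (runPts x n ω) (runData f ε x n ω) (x n ω)) P ∧
      ∫ ω, f (x n ω) ω - postMean k σ (runPts x n ω) (runData f ε x n ω) (x n ω) ∂P = 0 := by
  obtain ⟨ξ, hξm, hξ⟩ := hx.exists_of_data n
  obtain ⟨hWm, hW⟩ := hM.map_run_standardized hσ hk hc hx hξm
  simp only [← hξ] at hWm hW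
  set W : Ω → ℝ := fun ω => (f (x n ω) ω -
    postMean k σ (runPts x n ω) (runData f ε x n ω) (x n ω)) /
      postStd k σ (runPts x n ω) (x n ω) with hWdef
  have hD := hM.aemeasurable_U_runData hc hx n
  have hprob : IsProbabilityMeasure (P.map fun ω => (U ω, runData f ε x n ω)) :=
    Measure.isProbabilityMeasure_map hD
  have hWlaw : P.map W = gaussianReal 0 1 := by
    have h := congrArg (Measure.map Prod.snd) hW
    rw [AEMeasurable.map_map_of_aemeasurable measurable_snd.aemeasurable (hD.prodMk hWm)] at h
    simpa [Function.comp_def, Measure.map_snd_prod] using h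
  have hind : IndepFun (fun ω => (U ω, runData f ε x n ω)) W P :=
    (indepFun_iff_map_prod_eq_prod_map_map hD hWm).2 (by rw [hWlaw]; exact hW)
  obtain ⟨g, hg, hgeq⟩ := hM.exists_postStd_run_eq hσ (fun z => (hk z).2) hc hx n
  have hind2 : IndepFun (fun ω => postStd k σ (runPts x n ω) (x n ω)) W P := by
    simp only [hgeq]
    exact hind.comp hg measurable_id
  have hWint : Integrable W P := by
    have h := integrable_id_gaussianReal
    rw [← hWlaw] at h
    exact h.comp_aemeasurable hWm
  have hWzero : ∫ ω, W ω ∂P = 0 := by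
    have h := integral_map hWm (f := fun w : ℝ => w) (by rw [hWlaw]; exact
      integrable_id_gaussianReal.aestronglyMeasurable)
    rw [← h, hWlaw, integral_id_gaussianReal]
  have hs := hM.integrable_postStd_run hσ (fun z => (hk z).2) hc hx n
  have heq : (fun ω => f (x n ω) ω -
      postMean k σ (runPts x n ω) (runData f ε x n ω) (x n ω)) =
      fun ω => postStd k σ (runPts x n ω) (x n ω) * W ω := by
    funext ω
    rw [hWdef, mul_div_cancel₀ _ (hM.postStd_pos hσ hk _ _).ne']
  rw [heq]
  refine ⟨hind2.integrable_mul hs hWint, ?_⟩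
  refine (hind2.integral_mul_eq_mul_integral hs.aestronglyMeasurable
    hWint.aestronglyMeasurable).trans ?_
  rw [hWzero, mul_zero]

/-- The value at a fixed point exceeds its upper confidence bound by a variable whose expectation
is exponentially small in the confidence parameter. -/
lemma exists_excess_bound (hM : IsModel P k σ f ε U) (hσ : 0 < σ)
    (hk : ∀ z, 0 < k z z ∧ k z z ≤ 1)
    (hc : ∀ᵐ ω ∂P, Continuous fun z => f z ω) (hx : HasRule f ε U x) (n : ℕ) {b : ℝ}
    (hb : 0 ≤ b) (z : X) :
    ∃ G : Ω → ℝ, Integrable G P ∧ (∀ ω, 0 ≤ G ω) ∧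
      ∫ ω, G ω ∂P ≤ (√(2 * Real.pi))⁻¹ * Real.exp (-b / 2) ∧
      ∀ ω, f z ω ≤ postMean k σ (runPts x n ω) (runData f ε x n ω) z +
        √b * postStd k σ (runPts x n ω) z + G ω := by
  obtain ⟨hWm, hW⟩ := hM.map_run_standardized hσ hk hc hx (n := n)
    (ζ := fun _ => z) measurable_const
  set W : Ω → ℝ := fun ω => (f z ω -
    postMean k σ (runPts x n ω) (runData f ε x n ω) z) / postStd k σ (runPts x n ω) z with hWdef
  have hD := hM.aemeasurable_U_runData hc hx n
  have hprob : IsProbabilityMeasure (P.map fun ω => (U ω, runData f ε x n ω)) :=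
    Measure.isProbabilityMeasure_map hD
  have hWlaw : P.map W = gaussianReal 0 1 := by
    have h := congrArg (Measure.map Prod.snd) hW
    rw [AEMeasurable.map_map_of_aemeasurable measurable_snd.aemeasurable (hD.prodMk hWm)] at h
    simpa [Function.comp_def, Measure.map_snd_prod] using h
  have hint := integrable_max_add_gaussianReal (-√b)
  have hint' : Integrable (fun w : ℝ => max (-√b + w) 0) (P.map W) := by rw [hWlaw]; exact hint
  refine ⟨fun ω => max (-√b + W ω) 0, hint'.comp_aemeasurable hWm,
    fun ω => le_max_right _ _, ?_, fun ω => ?_⟩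
  · have h := integral_map hWm hint'.aestronglyMeasurable
    rw [← h, hWlaw, ← tau_eq_integral]
    refine (tau_le_gaussianPDFReal (neg_nonpos.2 (Real.sqrt_nonneg b))).trans ?_
    rw [gaussianPDFReal_zero_one, neg_sq, Real.sq_sqrt hb]
  · have hs := hM.postStd_pos hσ hk (runPts x n ω) z
    have hs1 := hM.postStd_le_one hσ (fun z => (hk z).2) (runPts x n ω) z
    have hWs : f z ω - postMean k σ (runPts x n ω) (runData f ε x n ω) z =
        postStd k σ (runPts x n ω) z * W ω := by
      rw [hWdef, mul_div_cancel₀ _ hs.ne']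
    have h1 := le_max_left (-√b + W ω) 0
    have h2 := le_max_right (-√b + W ω) 0
    nlinarith [mul_le_mul_of_nonneg_left h1 hs.le, mul_le_mul_of_nonneg_right hs1 h2]

end IsModel

variable [CompactSpace X]

lemma iInf_kernel_pos (hM : IsModel P k σ f ε U) (hk : ∀ z, 0 < k z z ∧ k z z ≤ 1)
    (hc : ∀ᵐ ω ∂P, Continuous fun z => f z ω) : 0 < ⨅ z, k z z := by
  have hcont : Continuous fun z => k z z :=
    (hM.continuous_kernel (fun z => (hk z).2) hc).comp (continuous_id.prodMk continuous_id)
  obtain ⟨z₀, -, hz₀⟩ := isCompact_univ.exists_isMinOn Set.univ_nonempty hcont.continuousOn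
  exact (hk z₀).1.trans_le (le_ciInf fun z => hz₀ (Set.mem_univ z))

/-- The point queried by the algorithm nearly maximizes the upper confidence bound. -/
lemma upperConfidence_le_of_run (hM : IsModel P k σ f ε U) (hσ : 0 < σ)
    (hk : ∀ z, 0 < k z z ∧ k z z ≤ 1) (hc : ∀ᵐ ω ∂P, Continuous fun z => f z ω)
    (hrun : IsRescaledEIRun k σ β f ε U x) {n : ℕ} (hβ : 0 < β (n + 1)) (ω : Ω) (z : X) :
    postMean k σ (runPts x n ω) (runData f ε x n ω) z +
        √(β (n + 1)) * postStd k σ (runPts x n ω) z ≤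
      postMean k σ (runPts x n ω) (runData f ε x n ω) (x n ω) +
        √(β (n + 1)) * (1 / gaussianTail +
          √(Real.log ((n + σ ^ 2) / ((⨅ z, k z z) * σ ^ 2)))) *
            postStd k σ (runPts x n ω) (x n ω) := by
  have hκ := iInf_kernel_pos hM hk hc
  have hκ' : ∀ z, (⨅ z, k z z) ≤ k z z := fun z =>
    ciInf_le ⟨0, by rintro _ ⟨z, rfl⟩; exact (hk z).1.le⟩ z
  set κ := ⨅ z, k z z
  set a := runPts x n ω with ha
  set y := runData f ε x n ω with hy
  have hb : 0 < √(β (n + 1)) := Real.sqrt_pos.2 hβ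
  have hmc : Continuous fun z => postMean k σ a y z :=
    (hM.continuous_postMean hσ (fun z => (hk z).2) hc n).comp
      (continuous_const.prodMk (continuous_const.prodMk continuous_id))
  obtain ⟨x₁, -, hx₁⟩ := isCompact_univ.exists_isMaxOn Set.univ_nonempty hmc.continuousOn
  have hx₁' : ∀ z, postMean k σ a y z ≤ postMean k σ a y x₁ := fun z => hx₁ (Set.mem_univ z)
  have hmax : postMeanMax k σ a y = postMean k σ a y x₁ :=
    le_antisymm (ciSup_le hx₁') (le_ciSup (f := fun z => postMean k σ a y z)
      ⟨_, by rintro _ ⟨z, rfl⟩; exact hx₁' z⟩ x₁)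
  have hs : ∀ z, 0 < √(β (n + 1)) * postStd k σ a z := fun z =>
    mul_pos hb (hM.postStd_pos hσ hk a z)
  have hEI : ∀ z, EI (postMean k σ a y z) (√(β (n + 1)) * postStd k σ a z)
      (postMean k σ a y x₁) ≤ EI (postMean k σ a y (x n ω))
        (√(β (n + 1)) * postStd k σ a (x n ω)) (postMean k σ a y x₁) := by
    intro z
    rw [← hmax]
    exact hrun.isMax n ω z
  have h1 := add_le_of_EI_max hs hx₁' hEI z
  have h2 := le_add_of_EI_max hs hx₁' hEI
  have h3 : 2 * Real.log (√(β (n + 1)) * postStd k σ a (x n ω) /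
      (√(β (n + 1)) * postStd k σ a x₁)) ≤ Real.log ((n + σ ^ 2) / (κ * σ ^ 2)) := by
    have hv0 := hM.postVar_pos hσ hk a (x n ω)
    have hv1 := hM.postVar_pos hσ hk a x₁
    rw [mul_div_mul_left _ _ hb.ne', postStd, postStd, ← Real.sqrt_div hv0.le,
      Real.log_sqrt (div_pos hv0 hv1).le, mul_div_cancel₀ _ two_ne_zero]
    refine Real.log_le_log (div_pos hv0 hv1) ?_
    have hκσ : 0 < κ * σ ^ 2 := by positivity
    rw [div_le_div_iff₀ hv1 hκσ]
    have h4 := hM.le_postVar hσ (fun z => (hk z).2) a x₁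
    have h5 := (hM.postVar_le hσ a (x n ω)).trans (hk _).2
    calc postVar k σ a (x n ω) * (κ * σ ^ 2) ≤ 1 * (k x₁ x₁ * σ ^ 2) := by
          gcongr
          exact hκ' x₁
      _ ≤ _ := by rw [one_mul]; exact h4
  have h6 := mul_le_mul_of_nonneg_left (Real.sqrt_le_sqrt h3) (hs (x n ω)).le
  calc _ ≤ postMean k σ a y (x n ω) + √(β (n + 1)) * postStd k σ a (x n ω) *
        √(Real.log ((n + σ ^ 2) / (κ * σ ^ 2))) +
          √(β (n + 1)) * postStd k σ a (x n ω) / gaussianTail := by linarith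
    _ = _ := by ring

/-- A finite set of points at which, up to an error `V` of small expectation, every sample path
takes all its values, and which is small enough for a union bound over it to cost little at the
confidence parameter `b`. -/
structure HasNet (P : Measure Ω) (f : X → Ω → ℝ) (b δ : ℝ) (F : Finset X) (V : Ω → ℝ) :
    Prop where
  integrable : Integrable V P
  integral_le : ∫ ω, V ω ∂P ≤ δ
  exists_near : ∀ᵐ ω ∂P, ∀ z, ∃ w ∈ F, |f z ω - f w ω| ≤ V ω
  card_le : F.card * ((√(2 * Real.pi))⁻¹ * Real.exp (-b / 2)) ≤ δ

lemma HasNet.abs_le {b δ : ℝ} {F : Finset X} {V : Ω → ℝ} (h : HasNet P f b δ F V) :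
    ∀ᵐ ω ∂P, ∀ z, |f z ω| ≤ V ω + ∑ w ∈ F, |f w ω| := by
  filter_upwards [h.exists_near] with ω hω z
  obtain ⟨w, hw, hzw⟩ := hω z
  have h1 := Finset.single_le_sum (f := fun w => |f w ω|) (fun _ _ => abs_nonneg _) hw
  have h2 := abs_add_le (f z ω - f w ω) (f w ω)
  rw [sub_add_cancel] at h2
  linarith

lemma aemeasurable_iSup_f (hM : IsModel P k σ f ε U)
    (hc : ∀ᵐ ω ∂P, Continuous fun z => f z ω) : AEMeasurable (fun ω => ⨆ z, f z ω) P := by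
  refine AEMeasurable.isLUB (f := fun (i : ℕ) ω => f (TopologicalSpace.denseSeq X i) ω)
    (fun i => (hM.measurable_f _).aemeasurable) ?_
  filter_upwards [hc] with ω hω
  constructor
  · rintro _ ⟨i, rfl⟩
    exact le_ciSup (f := fun z => f z ω) (isCompact_range hω).bddAbove _
  · intro c hcb
    refine ciSup_le fun z => ?_
    have hcl : IsClosed {z | f z ω ≤ c} := isClosed_le hω continuous_const
    have hsub : Set.range (TopologicalSpace.denseSeq X) ⊆ {z | f z ω ≤ c} := by
      rintro _ ⟨i, rfl⟩
      exact hcb ⟨i, rfl⟩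
    exact hcl.closure_subset_iff.2 hsub (TopologicalSpace.denseRange_denseSeq X z)

lemma integrable_iSup_f (hM : IsModel P k σ f ε U)
    (hc : ∀ᵐ ω ∂P, Continuous fun z => f z ω) {b δ : ℝ} {F : Finset X} {V : Ω → ℝ}
    (hF : HasNet P f b δ F V) : Integrable (fun ω => ⨆ z, f z ω) P := by
  have hdom : Integrable (fun ω => V ω + ∑ w ∈ F, |f w ω|) P :=
    hF.integrable.add (integrable_finsetSum _ fun w _ => ((hM.memLp_f w).integrable one_le_two).abs)
  refine hdom.mono' (aemeasurable_iSup_f hM hc).aestronglyMeasurable ?_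
  filter_upwards [hF.abs_le, hc] with ω hω hcω
  rw [Real.norm_eq_abs, abs_le]
  refine ⟨?_, ciSup_le fun z => (le_abs_self _).trans (hω z)⟩
  obtain ⟨z⟩ := ‹Nonempty X›
  exact (neg_le_of_abs_le (hω z)).trans (le_ciSup (f := fun z => f z ω)
    (isCompact_range hcω).bddAbove z)

lemma integrable_f_run (hM : IsModel P k σ f ε U)
    (hc : ∀ᵐ ω ∂P, Continuous fun z => f z ω) (hx : HasRule f ε U x) {b δ : ℝ} {F : Finset X}
    {V : Ω → ℝ} (hF : HasNet P f b δ F V) (n : ℕ) : Integrable (fun ω => f (x n ω) ω) P := by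
  have hdom : Integrable (fun ω => V ω + ∑ w ∈ F, |f w ω|) P :=
    hF.integrable.add (integrable_finsetSum _ fun w _ => ((hM.memLp_f w).integrable one_le_two).abs)
  refine hdom.mono' (hM.aemeasurable_f_run hc hx n).aestronglyMeasurable ?_
  filter_upwards [hF.abs_le] with ω hω
  exact hω _

lemma integrable_regret (hM : IsModel P k σ f ε U)
    (hc : ∀ᵐ ω ∂P, Continuous fun z => f z ω) (hx : HasRule f ε U x) {b δ : ℝ} {F : Finset X}
    {V : Ω → ℝ} (hF : HasNet P f b δ F V) (n : ℕ) : Integrable (regret f x n) P :=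
  (integrable_iSup_f hM hc hF).sub (integrable_f_run hM hc hx hF n)

/-- The expected regret of one round is at most a multiple of the expected posterior standard
deviation at the queried point, up to the errors of the net. -/
lemma integral_regret_le (hM : IsModel P k σ f ε U) (hσ : 0 < σ)
    (hk : ∀ z, 0 < k z z ∧ k z z ≤ 1) (hc : ∀ᵐ ω ∂P, Continuous fun z => f z ω)
    (hrun : IsRescaledEIRun k σ β f ε U x) {n : ℕ} (hβ : 0 < β (n + 1)) {δ : ℝ} {F : Finset X}
    {V : Ω → ℝ} (hF : HasNet P f (β (n + 1)) δ F V) :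
    ∫ ω, regret f x n ω ∂P ≤ 2 * δ + √(β (n + 1)) * (1 / gaussianTail +
          √(Real.log ((n + σ ^ 2) / ((⨅ z, k z z) * σ ^ 2)))) *
            ∫ ω, postStd k σ (runPts x n ω) (x n ω) ∂P := by
  have hx := hrun.hasRule
  choose G hGint hG0 hGle hG using fun z => hM.exists_excess_bound hσ hk hc hx n hβ.le z
  set B := √(β (n + 1)) * (1 / gaussianTail +
          √(Real.log ((n + σ ^ 2) / ((⨅ z, k z z) * σ ^ 2)))) with hB
  obtain ⟨hdint, hd0⟩ := hM.integral_sub_postMean_run hσ hk hc hx n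
  have hs := hM.integrable_postStd_run hσ (fun z => (hk z).2) hc hx n
  have hGs : Integrable (fun ω => ∑ w ∈ F, G w ω) P := integrable_finsetSum _ fun w _ => hGint w
  have hVG : Integrable (fun ω => V ω + ∑ w ∈ F, G w ω) P := hF.integrable.add hGs
  have hBs : Integrable (fun ω => B * postStd k σ (runPts x n ω) (x n ω)) P := hs.const_mul B
  have hVGB : Integrable (fun ω => V ω + ∑ w ∈ F, G w ω +
      B * postStd k σ (runPts x n ω) (x n ω)) P := hVG.add hBs
  calc ∫ ω, regret f x n ω ∂P
      ≤ ∫ ω, (V ω + ∑ w ∈ F, G w ω + B * postStd k σ (runPts x n ω) (x n ω) -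
        (f (x n ω) ω - postMean k σ (runPts x n ω) (runData f ε x n ω) (x n ω))) ∂P := by
        refine integral_mono_ae (integrable_regret hM hc hx hF n) (hVGB.sub hdint) ?_
        filter_upwards [hF.exists_near] with ω hω
        have hsup : (⨆ z, f z ω) ≤ V ω + ∑ w ∈ F, G w ω +
            B * postStd k σ (runPts x n ω) (x n ω) +
              postMean k σ (runPts x n ω) (runData f ε x n ω) (x n ω) := by
          refine ciSup_le fun z => ?_
          obtain ⟨w, hw, hzw⟩ := hω z
          have h1 := hG w ω
          have h2 := upperConfidence_le_of_run hM hσ hk hc hrun hβ ω w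
          have h3 : G w ω ≤ ∑ w ∈ F, G w ω :=
            Finset.single_le_sum (f := fun w => G w ω) (fun w _ => hG0 w ω) hw
          have h4 := le_of_abs_le hzw
          rw [← hB] at h2
          linarith
        simp only [regret]
        linarith
    _ = ∫ ω, V ω ∂P + ∑ w ∈ F, ∫ ω, G w ω ∂P +
        B * ∫ ω, postStd k σ (runPts x n ω) (x n ω) ∂P := by
        rw [integral_sub hVGB hdint, hd0, sub_zero, integral_add hVG hBs,
          integral_add hF.integrable hGs, integral_finsetSum _ fun w _ => hGint w,
          integral_const_mul]
    _ ≤ _ := by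
        have h1 : ∑ w ∈ F, ∫ ω, G w ω ∂P ≤ δ := by
          refine (Finset.sum_le_sum fun w _ => hGle w).trans ?_
          rw [Finset.sum_const, nsmul_eq_mul]
          exact hF.card_le
        have h2 := hF.integral_le
        linarith

end Regret

/-! ### The cumulative regret -/

/-- The constant of the regret bound, as a function of the noise level and of the smallest prior
variance. -/
def regretConst (σ κ : ℝ) : ℝ :=
  4 / √(Real.log (1 + κ / σ ^ 2) / 2) +
    (√2 / gaussianTail + √(1 + 2 * Real.log ((1 + σ ^ 2) / (κ * σ ^ 2)))) *
      √(2 * (1 + σ ^ 2))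

lemma sum_inv_sq_le (T : ℕ) : ∑ n ∈ Finset.range T, 1 / ((n : ℝ) + 1) ^ 2 ≤ 2 := by
  rcases Nat.eq_zero_or_pos T with rfl | hT
  · simp
  have h : ∀ T : ℕ, 0 < T → ∑ n ∈ Finset.range T, 1 / ((n : ℝ) + 1) ^ 2 ≤ 2 - 1 / (T : ℝ) := by
    intro T hT
    induction T, hT using Nat.le_induction with
    | base => norm_num
    | succ T hT ih =>
      rw [Finset.sum_range_succ]
      have hT' : (0 : ℝ) < T := by exact_mod_cast hT
      have h2 : 1 / ((T : ℝ) + 1) ^ 2 ≤ 1 / T - 1 / (T + 1) := by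
        rw [div_sub_div _ _ hT'.ne' (by positivity),
          div_le_div_iff₀ (by positivity) (by positivity)]
        nlinarith
      push_cast
      linarith
  have : (0 : ℝ) ≤ 1 / T := by positivity
  linarith [h T hT]

/-- The analytic part of the regret bound: all logarithmic factors are absorbed in `log T`. -/
lemma add_le_regretConst_mul {σ κ β γ t : ℝ} (hσ : 0 < σ) (hκ : 0 < κ) (hκ1 : κ ≤ 1) (hβ : 1 ≤ β)
    (ht : 2 ≤ t) (hγ : Real.log (1 + κ / σ ^ 2) / 2 ≤ γ) :
    4 + √β * (1 / gaussianTail + √(Real.log ((t + σ ^ 2) / (κ * σ ^ 2)))) *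
        √(t * (2 * (1 + σ ^ 2) * γ)) ≤
      regretConst σ κ * √(β * γ * t * Real.log t) := by
  have hq := gaussianTail_pos
  have hlogt : 1 / 2 ≤ Real.log t := by
    have h1 := Real.log_two_gt_d9
    have h2 := Real.log_le_log two_pos ht
    linarith
  set g₀ := Real.log (1 + κ / σ ^ 2) / 2 with hg₀
  have hσ2 : 0 < σ ^ 2 := by positivity
  have hg₀pos : 0 < g₀ := by
    have : 0 < κ / σ ^ 2 := by positivity
    have := Real.log_pos (by linarith : 1 < 1 + κ / σ ^ 2)
    positivity
  have hγ0 : 0 < γ := hg₀pos.trans_le hγ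
  set L := Real.log ((1 + σ ^ 2) / (κ * σ ^ 2)) with hL
  have hκσ : 0 < κ * σ ^ 2 := by positivity
  have hL0 : 0 ≤ L := by
    refine Real.log_nonneg ?_
    rw [one_le_div hκσ]
    nlinarith
  have h1 : 4 ≤ 4 / √g₀ * √(β * γ * t * Real.log t) := by
    have h2 : √g₀ ≤ √(β * γ * t * Real.log t) := by
      refine Real.sqrt_le_sqrt ?_
      calc g₀ ≤ γ := hγ
        _ = 1 * γ * 2 * (1 / 2) := by ring
        _ ≤ _ := by gcongr
    have h3 : 0 < √g₀ := Real.sqrt_pos.2 hg₀pos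
    rw [div_mul_eq_mul_div, le_div_iff₀ h3]
    linarith
  have h2 : Real.log ((t + σ ^ 2) / (κ * σ ^ 2)) ≤ (1 + 2 * L) * Real.log t := by
    have h3 : Real.log ((t + σ ^ 2) / (κ * σ ^ 2)) ≤
        Real.log (t * ((1 + σ ^ 2) / (κ * σ ^ 2))) := by
      refine Real.log_le_log (by positivity) ?_
      rw [← mul_div_assoc]
      gcongr
      nlinarith
    rw [Real.log_mul (by positivity) (by positivity)] at h3
    nlinarith
  have h3 : √(Real.log ((t + σ ^ 2) / (κ * σ ^ 2))) ≤ √(1 + 2 * L) * √(Real.log t) := by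
    rw [← Real.sqrt_mul (by positivity)]
    exact Real.sqrt_le_sqrt h2
  have h4 : 1 / gaussianTail ≤ √2 / gaussianTail * √(Real.log t) := by
    rw [div_mul_eq_mul_div]
    gcongr
    rw [← Real.sqrt_mul two_pos.le, Real.one_le_sqrt]
    linarith
  have h5 : √β * (1 / gaussianTail + √(Real.log ((t + σ ^ 2) / (κ * σ ^ 2)))) *
        √(t * (2 * (1 + σ ^ 2) * γ)) ≤ √β * ((√2 / gaussianTail + √(1 + 2 * L)) * √(Real.log t)) *
        √(t * (2 * (1 + σ ^ 2) * γ)) := by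
    gcongr
    linarith
  have h6 : √(β * γ * t * Real.log t) = √β * √γ * √t * √(Real.log t) := by
    rw [Real.sqrt_mul (by positivity), Real.sqrt_mul (by positivity), Real.sqrt_mul (by positivity)]
  have h7 : √(t * (2 * (1 + σ ^ 2) * γ)) = √t * (√(2 * (1 + σ ^ 2)) * √γ) := by
    rw [Real.sqrt_mul (by positivity), Real.sqrt_mul (by positivity)]
  have h8 : regretConst σ κ = 4 / √g₀ + (√2 / gaussianTail + √(1 + 2 * L)) *
      √(2 * (1 + σ ^ 2)) := rfl
  rw [h8, add_mul]
  refine add_le_add h1 (h5.trans (le_of_eq ?_))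
  rw [h6, h7]
  ring

section Cumulative

variable {Ω : Type*} [MeasurableSpace Ω] {Θ : Type*} [MeasurableSpace Θ] {X : Type*}
  {P : Measure Ω} [IsProbabilityMeasure P] {k : X → X → ℝ} {σ : ℝ} {f : X → Ω → ℝ}
  {ε : ℕ → Ω → ℝ} {U : Ω → Θ} {x : ℕ → Ω → X} {β : ℕ → ℝ}

/-- The information gain controls the sum of the posterior variances along any sequence. -/
lemma sum_postVar_le (hM : IsModel P k σ f ε U) (hσ : 0 < σ) (hk : ∀ z, k z z ≤ 1) [Nonempty X]
    (a : ℕ → X) (T : ℕ) :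
    ∑ n ∈ Finset.range T, postVar k σ (prefixOf a n) (a n) ≤
      2 * (1 + σ ^ 2) * maxInfoGain P f ε T := by
  have h := hM.sum_log_le_maxInfoGain hσ hk a T
  have hσ2 : 0 < σ ^ 2 := by positivity
  have h1 : ∀ n ∈ Finset.range T, postVar k σ (prefixOf a n) (a n) ≤ 2 * (1 + σ ^ 2) *
      (Real.log (1 + postVar k σ (prefixOf a n) (a n) / σ ^ 2) / 2) := by
    intro n _
    have h0 := hM.postVar_nonneg hσ (prefixOf a n) (a n)
    have h2 := (hM.postVar_le hσ (prefixOf a n) (a n)).trans (hk _)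
    set v := postVar k σ (prefixOf a n) (a n)
    have h3 := Real.one_sub_inv_le_log_of_pos (x := 1 + v / σ ^ 2) (by positivity)
    have h4 : v / (1 + σ ^ 2) ≤ 1 - (1 + v / σ ^ 2)⁻¹ := by
      have : 1 - (1 + v / σ ^ 2)⁻¹ = v / (σ ^ 2 + v) := by field_simp; ring
      rw [this]
      exact div_le_div_of_nonneg_left h0 (by positivity) (by linarith)
    rw [div_le_iff₀ (by positivity)] at h4
    nlinarith
  refine (Finset.sum_le_sum h1).trans ?_
  rw [← Finset.mul_sum]
  gcongr

lemma le_maxInfoGain (hM : IsModel P k σ f ε U) (hσ : 0 < σ) (hk : ∀ z, k z z ≤ 1) {κ : ℝ}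
    (hκ : 0 < κ) [Nonempty X] (hκ' : ∀ z, κ ≤ k z z) {T : ℕ} (hT : 0 < T) :
    Real.log (1 + κ / σ ^ 2) / 2 ≤ maxInfoGain P f ε T := by
  obtain ⟨z⟩ := ‹Nonempty X›
  have : Nonempty X := ⟨z⟩
  refine le_trans ?_ (hM.sum_log_le_maxInfoGain hσ hk (fun _ => z) T)
  have h := Finset.single_le_sum (s := Finset.range T)
    (f := fun n => Real.log (1 + postVar k σ (prefixOf (fun _ => z) n) z / σ ^ 2) / 2)
    (fun n _ => ?_) (Finset.mem_range.2 hT)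
  · refine le_trans ?_ h
    have h0 : postVar k σ (prefixOf (fun _ => z) 0) z = k z z := by simp [postVar]
    simp only [h0]
    gcongr
    exact hκ' z
  · have := hM.postVar_nonneg hσ (prefixOf (fun _ => z) n) z
    have h2 : 0 ≤ postVar k σ (prefixOf (fun _ => z) n) z / σ ^ 2 := by positivity
    have := Real.log_nonneg (by linarith : 1 ≤ 1 + postVar k σ (prefixOf (fun _ => z) n) z / σ ^ 2)
    positivity

variable [MeasurableSpace X]
  [PseudoEMetricSpace X] [SecondCountableTopology X] [Nonempty X] [BorelSpace X] [CompactSpace X]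

/-- The regret bound for any domain and confidence parameters for which finite nets exist. -/
theorem regret_bound (hM : IsModel P k σ f ε U) (hσ : 0 < σ)
    (hk : ∀ z, 0 < k z z ∧ k z z ≤ 1) (hc : ∀ᵐ ω ∂P, Continuous fun z => f z ω)
    (hrun : IsRescaledEIRun k σ β f ε U x) (hβmono : ∀ n m : ℕ, n ≤ m → β (n + 1) ≤ β (m + 1))
    (hβ0 : 0 < β 1) (hβ1 : 1 ≤ β 2)
    (hnet : ∀ n : ℕ, ∃ F V, HasNet P f (β (n + 1)) (1 / ((n : ℝ) + 1) ^ 2) F V) :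
    (∀ n, Integrable (regret f x n) P) ∧
      ∀ T : ℕ, 2 ≤ T → BCR P f x T ≤
        regretConst σ (⨅ z, k z z) * √(β T * maxInfoGain P f ε T * T * Real.log T) := by
  choose F V hF using hnet
  have hx := hrun.hasRule
  refine ⟨fun n => integrable_regret hM hc hx (hF n) n, fun T hT => ?_⟩
  have hκ := iInf_kernel_pos hM hk hc
  have hκ' : ∀ z, (⨅ z, k z z) ≤ k z z := fun z =>
    ciInf_le ⟨0, by rintro _ ⟨z, rfl⟩; exact (hk z).1.le⟩ z
  have hκ1 : (⨅ z, k z z) ≤ 1 := by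
    obtain ⟨z⟩ := ‹Nonempty X›
    exact (hκ' z).trans (hk z).2
  have hT' : (2 : ℝ) ≤ T := by exact_mod_cast hT
  have hβT : ∀ n < T, β (n + 1) ≤ β T := by
    intro n hn
    obtain ⟨m, rfl⟩ : ∃ m, T = m + 1 := ⟨T - 1, by omega⟩
    exact hβmono n m (by omega)
  have hβpos : ∀ n, 0 < β (n + 1) := fun n => hβ0.trans_le (hβmono 0 n (Nat.zero_le n))
  refine le_trans ?_ (add_le_regretConst_mul hσ hκ hκ1 (hβ1.trans (hβT 1 (by omega))) hT'
    (le_maxInfoGain hM hσ (fun z => (hk z).2) hκ hκ' (by omega)))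
  set κ := ⨅ z, k z z
  set B := √(β T) * (1 / gaussianTail + √(Real.log ((T + σ ^ 2) / (κ * σ ^ 2)))) with hB
  have hq := gaussianTail_pos
  have hB0 : 0 ≤ B := by positivity
  have hround : ∀ n ∈ Finset.range T, ∫ ω, regret f x n ω ∂P ≤ 2 * (1 / ((n : ℝ) + 1) ^ 2) +
      B * ∫ ω, postStd k σ (runPts x n ω) (x n ω) ∂P := by
    intro n hn
    have hn' := Finset.mem_range.1 hn
    have hnT : (n : ℝ) ≤ T := by exact_mod_cast hn'.le
    refine (integral_regret_le hM hσ hk hc hrun (hβpos n) (hF n)).trans ?_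
    have h0 : 0 ≤ ∫ ω, postStd k σ (runPts x n ω) (x n ω) ∂P :=
      integral_nonneg fun ω => Real.sqrt_nonneg _
    refine add_le_add_right (mul_le_mul_of_nonneg_right ?_ h0) _
    rw [hB]
    have h1 : √(β (n + 1)) ≤ √(β T) := Real.sqrt_le_sqrt (hβT n hn')
    have h2 : √(Real.log ((n + σ ^ 2) / (κ * σ ^ 2))) ≤
        √(Real.log ((T + σ ^ 2) / (κ * σ ^ 2))) := by
      refine Real.sqrt_le_sqrt (Real.log_le_log (by positivity) ?_)
      gcongr
    gcongr
  have hs : ∀ n, Integrable (fun ω => postStd k σ (runPts x n ω) (x n ω)) P :=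
    hM.integrable_postStd_run hσ (fun z => (hk z).2) hc hx
  calc BCR P f x T ≤ ∑ n ∈ Finset.range T, (2 * (1 / ((n : ℝ) + 1) ^ 2) +
        B * ∫ ω, postStd k σ (runPts x n ω) (x n ω) ∂P) := Finset.sum_le_sum hround
    _ = 2 * ∑ n ∈ Finset.range T, 1 / ((n : ℝ) + 1) ^ 2 +
        B * ∫ ω, ∑ n ∈ Finset.range T, postStd k σ (runPts x n ω) (x n ω) ∂P := by
        rw [Finset.sum_add_distrib, ← Finset.mul_sum, ← Finset.mul_sum,
          integral_finsetSum _ fun n _ => hs n]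
    _ ≤ 4 + B * √(T * (2 * (1 + σ ^ 2) * maxInfoGain P f ε T)) := by
        have h1 := sum_inv_sq_le T
        have h2 : ∫ ω, ∑ n ∈ Finset.range T, postStd k σ (runPts x n ω) (x n ω) ∂P ≤
            √(T * (2 * (1 + σ ^ 2) * maxInfoGain P f ε T)) := by
          have h3 : ∀ ω, ∑ n ∈ Finset.range T, postStd k σ (runPts x n ω) (x n ω) ≤
              √(T * (2 * (1 + σ ^ 2) * maxInfoGain P f ε T)) := by
            intro ω
            -- the Cauchy–Schwarz inequality
            refine Real.le_sqrt_of_sq_le ?_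
            refine (sq_sum_le_card_mul_sum_sq).trans ?_
            rw [Finset.card_range]
            gcongr
            refine le_trans (le_of_eq ?_)
              (sum_postVar_le hM hσ (fun z => (hk z).2) (fun j => x j ω) T)
            exact Finset.sum_congr rfl fun n _ => Real.sq_sqrt (hM.postVar_nonneg hσ _ _)
          refine (integral_mono (integrable_finsetSum _ fun n _ => hs n) (integrable_const _)
            h3).trans ?_
          simp
        have h4 := mul_le_mul_of_nonneg_left h2 hB0
        linarith

end Cumulative

/-! ### Suprema with Gaussian tails -/

section Majorant

variable {Ω : Type*} [MeasurableSpace Ω] {P : Measure Ω}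

/-- A function is majorized by a measurable function that satisfies the same continuous tail
bound. The function itself need not be measurable; its tails are bounded in outer measure. -/
lemma exists_measurable_ge_of_tail {L : Ω → ℝ≥0∞} {φ : ℝ → ℝ≥0∞} (hφ : Continuous φ)
    (hL : ∀ c : ℝ, 0 < c → P {ω | ENNReal.ofReal c < L ω} ≤ φ c) :
    ∃ Z : Ω → ℝ≥0∞, Measurable Z ∧ L ≤ Z ∧
      ∀ c : ℝ, 0 < c → P {ω | ENNReal.ofReal c < Z ω} ≤ φ c := by
  classical
  let A : {q : ℚ // 0 < q} → Set Ω := fun q => toMeasurable P {ω | ENNReal.ofReal (q : ℚ) < L ω}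
  refine ⟨fun ω => ⨅ q : {q : ℚ // 0 < q}, if ω ∈ A q then ⊤ else ENNReal.ofReal (q : ℚ),
    Measurable.iInf fun q => Measurable.ite (measurableSet_toMeasurable _ _) measurable_const
      measurable_const, fun ω => le_iInf fun q => ?_, fun c hc => ?_⟩
  · split_ifs with h
    · exact le_top
    · exact not_lt.1 fun h' => h (subset_toMeasurable P _ h')
  · have hq : ∀ q : ℚ, 0 < q → (q : ℝ) < c → P {ω | ENNReal.ofReal c <
        ⨅ q : {q : ℚ // 0 < q}, if ω ∈ A q then ⊤ else ENNReal.ofReal (q : ℚ)} ≤ φ q := by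
      intro q hq hqc
      refine le_trans (measure_mono fun ω hω => ?_)
        ((measure_toMeasurable _).trans_le (hL q (by exact_mod_cast hq)))
      by_contra h
      have h0 : ENNReal.ofReal c < ⨅ q : {q : ℚ // 0 < q},
        if ω ∈ A q then ⊤ else ENNReal.ofReal (q : ℚ) := hω
      have h1 := h0.trans_le (iInf_le _ (⟨q, hq⟩ : {q : ℚ // 0 < q}))
      simp only [A, if_neg h] at h1
      exact absurd h1 (not_lt.2 (ENNReal.ofReal_le_ofReal hqc.le))
    by_contra! hlt
    have hev := (hφ.tendsto c).eventually (gt_mem_nhds hlt)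
    obtain ⟨δ, hδ, hball⟩ := Metric.eventually_nhds_iff.1 hev
    obtain ⟨q, hq1, hq2⟩ := exists_rat_btwn (max_lt (sub_lt_self c hδ) hc)
    have h0 : (0 : ℝ) < q := (le_max_right _ _).trans_lt hq1
    have h1 : c - δ < q := (le_max_left _ _).trans_lt hq1
    refine absurd (hq q (by exact_mod_cast h0) hq2) (not_le.2 (hball ?_))
    rw [Real.dist_eq, abs_sub_lt_iff]
    constructor <;> linarith

lemma lintegral_Ioi_gaussian {b : ℝ} (hb : 0 < b) (t₀ : ℝ) :
    ∫⁻ t in Set.Ioi t₀, ENNReal.ofReal (Real.exp (-((t - t₀) / b) ^ 2)) =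
      ENNReal.ofReal (b * (√Real.pi / 2)) := by
  have h1 : ∫⁻ s in Set.Ioi (0 : ℝ), ENNReal.ofReal (Real.exp (-(s / b) ^ 2)) =
      ENNReal.ofReal (b * (√Real.pi / 2)) := by
    have he : (fun s : ℝ => Real.exp (-(s / b) ^ 2)) =
        fun s => Real.exp (-(b ^ 2)⁻¹ * s ^ 2) := by
      ext s; congr 1; field_simp
    rw [← ofReal_integral_eq_lintegral_ofReal _ (ae_of_all _ fun s => (Real.exp_pos _).le)]
    · rw [he, integral_gaussian_Ioi, div_inv_eq_mul, Real.sqrt_mul Real.pi_pos.le,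
        Real.sqrt_sq hb.le]
      congr 1; ring
    · rw [he]
      exact (integrable_exp_neg_mul_sq (by positivity)).integrableOn
  rw [← h1, ← lintegral_indicator measurableSet_Ioi, ← lintegral_indicator measurableSet_Ioi,
    ← lintegral_sub_right_eq_self ((Set.Ioi (0 : ℝ)).indicator _) t₀]
  refine lintegral_congr fun t => ?_
  simp [Set.indicator]

variable [IsProbabilityMeasure P]

/-- A function with Gaussian tails has an integrable majorant; its expectation is computed from
the trivial tail bound `1` below `b √(log a)`, and from the Gaussian one above. -/
lemma exists_integrable_ge_of_gaussian_tail {L : Ω → ℝ≥0∞} {a b : ℝ} (ha : 1 ≤ a) (hb : 0 < b)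
    (hL : ∀ c : ℝ, 0 < c → P {ω | ENNReal.ofReal c < L ω} ≤
      ENNReal.ofReal (a * Real.exp (-(c / b) ^ 2))) :
    ∃ Z : Ω → ℝ, Integrable Z P ∧ (∀ ω, 0 ≤ Z ω) ∧
      ∫ ω, Z ω ∂P ≤ b * (√(Real.log a) + √Real.pi / 2) ∧ ∀ᵐ ω ∂P, L ω ≤ ENNReal.ofReal (Z ω) := by
  have hcont : Continuous fun c : ℝ => ENNReal.ofReal (a * Real.exp (-(c / b) ^ 2)) :=
    ENNReal.continuous_ofReal.comp (by fun_prop)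
  obtain ⟨Z, hZm, hLZ, hZ⟩ := exists_measurable_ge_of_tail hcont hL
  set t₀ := b * √(Real.log a) with ht₀
  have hloga : 0 ≤ Real.log a := Real.log_nonneg ha
  have ht₀0 : 0 ≤ t₀ := by positivity
  have htop : ∀ᵐ ω ∂P, Z ω ≠ ⊤ := by
    rw [ae_iff]
    simp only [not_not]
    have hlim : Filter.Tendsto (fun c : ℝ => ENNReal.ofReal (a * Real.exp (-(c / b) ^ 2)))
        Filter.atTop (nhds 0) := by
      have h1 : Filter.Tendsto (fun c : ℝ => (c / b) ^ 2) Filter.atTop Filter.atTop :=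
        (Filter.tendsto_pow_atTop two_ne_zero).comp (Filter.tendsto_id.atTop_div_const hb)
      have h2 := (Real.tendsto_exp_neg_atTop_nhds_zero.comp h1).const_mul a
      rw [mul_zero] at h2
      have h3 := ENNReal.tendsto_ofReal h2
      rwa [ENNReal.ofReal_zero] at h3
    refine le_antisymm (ge_of_tendsto hlim ?_) zero_le
    filter_upwards [Filter.eventually_gt_atTop 0] with c hc
    refine (measure_mono fun ω hω => ?_).trans (hZ c hc)
    have hω' : Z ω = ⊤ := hω
    simp [hω']
  have htail : ∀ t ∈ Set.Ioi (0 : ℝ), P {ω | t < (Z ω).toReal} ≤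
      (Set.Ioc 0 t₀).indicator (fun _ => 1) t +
      (Set.Ioi t₀).indicator
        (fun t => ENNReal.ofReal (Real.exp (-((t - t₀) / b) ^ 2))) t := by
    intro t ht
    have ht' : 0 < t := ht
    by_cases h : t ≤ t₀
    · rw [Set.indicator_of_mem (show t ∈ Set.Ioc 0 t₀ from ⟨ht', h⟩)]
      exact prob_le_one.trans le_self_add
    · have h' : t₀ < t := not_le.1 h
      rw [Set.indicator_of_mem (show t ∈ Set.Ioi t₀ from h')]
      refine le_trans ?_ le_add_self
      refine (measure_mono fun ω hω => ?_).trans ((hZ t ht').trans (ENNReal.ofReal_le_ofReal ?_))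
      · have hω' : t < (Z ω).toReal := hω
        have hne : Z ω ≠ ⊤ := by
          intro h0
          rw [h0, ENNReal.toReal_top] at hω'
          exact absurd hω' (not_lt.2 ht'.le)
        exact (ENNReal.ofReal_lt_iff_lt_toReal ht'.le hne).2 hω'
      · calc a * Real.exp (-(t / b) ^ 2) = Real.exp (Real.log a + -(t / b) ^ 2) := by
              rw [Real.exp_add, Real.exp_log (by linarith)]
          _ ≤ _ := by
            refine Real.exp_le_exp.2 ?_
            have e1 : t / b = (t - t₀) / b + √(Real.log a) := by
              rw [ht₀]; field_simp; ring
            have e2 : 0 ≤ (t - t₀) / b := div_nonneg (by linarith) hb.le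
            have e3 := Real.sq_sqrt hloga
            have e4 := mul_nonneg e2 (Real.sqrt_nonneg (Real.log a))
            rw [e1]
            nlinarith
  have hbound : ∫⁻ ω, ENNReal.ofReal (Z ω).toReal ∂P ≤
      ENNReal.ofReal (b * (√(Real.log a) + √Real.pi / 2)) := by
    rw [lintegral_eq_lintegral_meas_lt P (ae_of_all _ fun ω => ENNReal.toReal_nonneg)
      hZm.ennreal_toReal.aemeasurable]
    refine (setLIntegral_mono' measurableSet_Ioi htail).trans ?_
    refine (setLIntegral_le_lintegral _ _).trans ?_
    rw [lintegral_add_left (measurable_const.indicator measurableSet_Ioc),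
      lintegral_indicator measurableSet_Ioc, lintegral_indicator measurableSet_Ioi,
      lintegral_Ioi_gaussian hb, setLIntegral_const, one_mul, Real.volume_Ioc, sub_zero,
      ← ENNReal.ofReal_add ht₀0 (by positivity), ht₀, ← mul_add]
  have hnn : 0 ≤ b * (√(Real.log a) + √Real.pi / 2) := by positivity
  have hint : Integrable (fun ω => (Z ω).toReal) P := by
    refine ⟨hZm.ennreal_toReal.aestronglyMeasurable, ?_⟩
    rw [hasFiniteIntegral_iff_ofReal (ae_of_all _ fun ω => ENNReal.toReal_nonneg)]
    exact hbound.trans_lt ENNReal.ofReal_lt_top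
  refine ⟨fun ω => (Z ω).toReal, hint, fun ω => ENNReal.toReal_nonneg, ?_, ?_⟩
  · rw [integral_eq_lintegral_of_nonneg_ae (ae_of_all _ fun ω => ENNReal.toReal_nonneg)
      hint.aestronglyMeasurable]
    exact ENNReal.toReal_le_of_le_ofReal hnn hbound
  · filter_upwards [htop] with ω hω
    rw [ENNReal.ofReal_toReal hω]
    exact hLZ ω

end Majorant

/-! ### Finite nets of a cube -/

/-- A subset of the cube `[0, r]^d` has an `r / M`-net of at most `M ^ d` of its own points, for
the supremum norm: one point for each cell that meets the set. -/
lemma exists_net_of_subset_cube {d : ℕ} {S : Set (Fin d → ℝ)} {r : ℝ} (hr : 0 < r)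
    (hS : S ⊆ Set.Icc 0 (fun _ => r)) {M : ℕ} (hM : Fin d → 0 < M) :
    ∃ F : Finset S, F.card ≤ M ^ d ∧ ∀ z : S, ∃ w ∈ F, ‖(z : Fin d → ℝ) - w‖ ≤ r / M := by
  classical
  let cell : S → Fin d → Fin M := fun z j =>
    ⟨min ⌊(z : Fin d → ℝ) j * M / r⌋₊ (M - 1), by have := hM j; omega⟩
  have hcell : ∀ (z : S) (j : Fin d), ((cell z j : ℕ) : ℝ) ≤ (z : Fin d → ℝ) j * M / r ∧
      (z : Fin d → ℝ) j * M / r ≤ (cell z j : ℕ) + 1 := by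
    intro z j
    have h0 : 0 ≤ (z : Fin d → ℝ) j := (hS z.2).1 j
    have h1 : (z : Fin d → ℝ) j ≤ r := (hS z.2).2 j
    have hM0 : (0 : ℝ) < M := by exact_mod_cast hM j
    have h2 : (z : Fin d → ℝ) j * M / r ≤ M := by
      rw [div_le_iff₀ hr, mul_comm]
      gcongr
    have h3 : 0 ≤ (z : Fin d → ℝ) j * M / r := by positivity
    refine ⟨le_trans (by exact_mod_cast min_le_left _ _) (Nat.floor_le h3), ?_⟩
    change _ ≤ ((min ⌊(z : Fin d → ℝ) j * M / r⌋₊ (M - 1) : ℕ) : ℝ) + 1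
    rcases min_choice ⌊(z : Fin d → ℝ) j * M / r⌋₊ (M - 1) with h | h
    · rw [h]
      exact (Nat.lt_floor_add_one _).le
    · rw [h, Nat.cast_sub (hM j), Nat.cast_one, sub_add_cancel]
      exact h2
  refine ⟨(Finset.univ : Finset (Set.range cell)).image fun c => c.2.choose, ?_, fun z => ?_⟩
  · refine Finset.card_image_le.trans ?_
    rw [Finset.card_univ]
    refine (Fintype.card_le_of_injective _ (Subtype.val_injective)).trans ?_
    simp
  · refine ⟨_, Finset.mem_image_of_mem _ (Finset.mem_univ (⟨cell z, z, rfl⟩ : Set.range cell)), ?_⟩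
    set w : S := (⟨cell z, z, rfl⟩ : Set.range cell).2.choose with hw
    have hwz : cell w = cell z := (⟨cell z, z, rfl⟩ : Set.range cell).2.choose_spec
    refine (pi_norm_le_iff_of_nonneg (by positivity)).2 fun j => ?_
    have hM0 : (0 : ℝ) < M := by exact_mod_cast hM j
    have h1 := hcell z j
    have h2 := hcell w j
    rw [hwz] at h2
    rw [le_div_iff₀ hr, div_le_iff₀ hr] at h1 h2
    rw [Pi.sub_apply, Real.norm_eq_abs, abs_le, ← neg_div, div_le_iff₀ hM0, le_div_iff₀ hM0]
    constructor <;> linarith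

/-! ### Nets for the two kinds of domain -/

lemma sqrt_two_pi_le : √(2 * Real.pi) ≤ 4 :=
  Real.sqrt_le_iff.2 ⟨by norm_num, by nlinarith [Real.pi_le_four]⟩

/-- The confidence parameters are chosen to make the union bound over `N` points summable. -/
lemma mul_exp_neg_log_le {N t : ℝ} (hN : 0 ≤ N) (ht : 0 < t) :
    N * ((√(2 * Real.pi))⁻¹ * Real.exp (-Real.log (N * t ^ 2 / √(2 * Real.pi) + 1))) ≤
      1 / t ^ 2 := by
  have hp : 0 < √(2 * Real.pi) := by positivity
  rw [Real.exp_neg, Real.exp_log (by positivity), le_div_iff₀ (by positivity)]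
  have h : N * ((√(2 * Real.pi))⁻¹ * (N * t ^ 2 / √(2 * Real.pi) + 1)⁻¹) * t ^ 2 =
      (N * t ^ 2 / √(2 * Real.pi)) / (N * t ^ 2 / √(2 * Real.pi) + 1) := by
    field_simp
  rw [h]
  exact div_le_one_of_le₀ (by linarith) (by positivity)

lemma one_le_two_mul_log {t : ℝ} (ht : 2 ≤ t) {N : ℝ} (hN : 1 ≤ N) :
    1 ≤ 2 * Real.log (N * t ^ 2 / √(2 * Real.pi) + 1) := by
  have h1 : (1 : ℝ) ≤ N * t ^ 2 / √(2 * Real.pi) := by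
    rw [one_le_div (by positivity)]
    nlinarith [sqrt_two_pi_le]
  have h2 := Real.log_two_gt_d9
  have h3 := Real.log_le_log two_pos (by linarith : 2 ≤ N * t ^ 2 / √(2 * Real.pi) + 1)
  linarith

lemma betaFinite_mono (N : ℕ) : Monotone (betaFinite N) := by
  intro s t hst
  simp only [betaFinite]
  gcongr

lemma betaFinite_pos {N t : ℕ} (hN : 0 < N) (ht : 0 < t) : 0 < betaFinite N t := by
  have : (0 : ℝ) < N * t ^ 2 / √(2 * Real.pi) := by positivity
  have := Real.log_pos (by linarith : 1 < (N : ℝ) * t ^ 2 / √(2 * Real.pi) + 1)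
  simp only [betaFinite]
  positivity

lemma one_le_betaFinite {N : ℕ} (hN : 0 < N) : 1 ≤ betaFinite N 2 :=
  one_le_two_mul_log (by norm_num) (by exact_mod_cast hN)

section Finite

variable {Ω : Type*} [MeasurableSpace Ω] {P : Measure Ω} {X : Type*} {f : X → Ω → ℝ}

lemma hasNet_univ [Fintype X] {t : ℕ} (ht : 0 < t) :
    HasNet P f (betaFinite (Fintype.card X) t) (1 / (t : ℝ) ^ 2) Finset.univ (fun _ => 0) where
  integrable := integrable_zero _ _ _
  integral_le := by simp
  exists_near := ae_of_all _ fun ω z => ⟨z, Finset.mem_univ z, by simp⟩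
  card_le := by
    have h := mul_exp_neg_log_le (N := Fintype.card X) (t := t) (by positivity) (by positivity)
    rw [Finset.card_univ, betaFinite]
    convert h using 4
    ring

end Finite

section Smooth

variable {Ω : Type*} [MeasurableSpace Ω] {P : Measure Ω} {d : ℕ} {S : Set (Fin d → ℝ)}
  {f : S → Ω → ℝ} {r a b : ℝ}

lemma SmoothPaths.ae_continuous (h : SmoothPaths P f a b) :
    ∀ᵐ ω ∂P, Continuous fun z => f z ω := by
  obtain ⟨D, hD, -⟩ := h
  filter_upwards [hD] with ω hω
  have hcon : ContinuousOn (Function.extend Subtype.val (fun w : S => f w ω) 0) S :=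
    fun z hz => (hω ⟨z, hz⟩).continuousWithinAt
  have hres := continuousOn_iff_continuous_domRestrict.1 hcon
  convert hres using 1
  ext z
  rw [Set.domRestrict_apply, Subtype.val_injective.extend_apply]

lemma opNorm_le_sum_abs (A : (Fin d → ℝ) →L[ℝ] ℝ) : ‖A‖ ≤ ∑ j, |A (Pi.single j 1)| := by
  refine A.opNorm_le_bound (Finset.sum_nonneg fun _ _ => abs_nonneg _) fun v => ?_
  have h := LinearMap.pi_apply_eq_sum_univ (A : (Fin d → ℝ) →ₗ[ℝ] ℝ) v
  have h' : A v = ∑ j, v j * A (Pi.single j 1) := by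
    refine h.trans (Finset.sum_congr rfl fun j _ => ?_)
    have e : (fun i => if j = i then (1 : ℝ) else 0) = Pi.single j 1 := by
      funext i
      simp [Pi.single_apply, eq_comm]
    rw [smul_eq_mul, e]
    rfl
  rw [h', Finset.sum_mul]
  refine (norm_sum_le _ _).trans (Finset.sum_le_sum fun j _ => ?_)
  rw [norm_mul, mul_comm, Real.norm_eq_abs (A _)]
  gcongr
  exact norm_le_pi_norm v j

variable [IsProbabilityMeasure P]

/-- The sample paths are almost surely Lipschitz continuous for the supremum norm, with an
integrable Lipschitz constant. -/
lemma SmoothPaths.exists_lipschitz (h : SmoothPaths P f a b) (hS : Convex ℝ S) (ha : 1 ≤ a)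
    (hb : 0 < b) :
    ∃ Λ : Ω → ℝ, Integrable Λ P ∧ ∫ ω, Λ ω ∂P ≤ d * (b * (√(Real.log a) + √Real.pi / 2)) ∧
      (∀ ω, 0 ≤ Λ ω) ∧
      ∀ᵐ ω ∂P, ∀ z w : S, |f z ω - f w ω| ≤ Λ ω * ‖(z : Fin d → ℝ) - w‖ := by
  obtain ⟨D, hD, htail⟩ := h
  choose Z hZint hZ0 hZle hZ using fun j =>
    exists_integrable_ge_of_gaussian_tail ha hb (htail j)
  refine ⟨fun ω => ∑ j, Z j ω, integrable_finsetSum _ fun j _ => hZint j, ?_,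
    fun ω => Finset.sum_nonneg fun j _ => hZ0 j ω, ?_⟩
  · rw [integral_finsetSum _ fun j _ => hZint j]
    refine (Finset.sum_le_sum fun j _ => hZle j).trans ?_
    simp
  · filter_upwards [hD, ae_all_iff.2 hZ] with ω hω hZω z w
    classical
    let g : (Fin d → ℝ) → ((Fin d → ℝ) →L[ℝ] ℝ) := fun y => if hy : y ∈ S then D ⟨y, hy⟩ ω else 0
    have hg : ∀ y ∈ S, HasFDerivWithinAt (Function.extend Subtype.val (fun w : S => f w ω) 0)
        (g y) S y := by
      intro y hy
      simp only [g, dif_pos hy]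
      exact hω ⟨y, hy⟩
    have hgle : ∀ y ∈ S, ‖g y‖ ≤ ∑ j, Z j ω := by
      intro y hy
      simp only [g, dif_pos hy]
      refine (opNorm_le_sum_abs _).trans (Finset.sum_le_sum fun j _ => ?_)
      have h1 := (le_iSup (fun z : S => ENNReal.ofReal |D z ω (Pi.single j 1)|) ⟨y, hy⟩).trans
        (hZω j)
      exact (ENNReal.ofReal_le_ofReal_iff (hZ0 j ω)).1 h1
    have h1 := hS.norm_image_sub_le_of_norm_hasFDerivWithin_le hg hgle w.2 z.2
    rwa [Subtype.val_injective.extend_apply, Subtype.val_injective.extend_apply,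
      Real.norm_eq_abs] at h1

/-- The number of cells per coordinate in the discretization used in round `t`. It is zero for
`d = 0`, where a single cell remains, in agreement with `0 ^ 0 = 1`. -/
def gridSize (d : ℕ) (r a b : ℝ) (t : ℕ) : ℕ :=
  ⌈b * d * r * t ^ 2 * (√(Real.log (a * d)) + √Real.pi / 2)⌉₊

lemma betaConvex_eq (hr : 0 < r) (hb : 0 < b) (t : ℕ) :
    betaConvex d r a b t = 2 * d * Real.log (gridSize d r a b t) +
      2 * Real.log (t ^ 2 / √(2 * Real.pi) + 1) := by
  have h : 0 ≤ b * d * r * t ^ 2 * (√(Real.log (a * d)) + √Real.pi / 2) := by positivity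
  have h2 : ((⌈b * d * r * t ^ 2 * (√(Real.log (a * d)) + √Real.pi / 2)⌉ : ℤ) : ℝ) =
      (gridSize d r a b t : ℝ) := by
    rw [gridSize, ← natCast_ceil_eq_intCast_ceil h]
  rw [betaConvex, h2]

lemma gridSize_pos (hr : 0 < r) (hb : 0 < b) (hd : 0 < d) {t : ℕ} (ht : 0 < t) :
    0 < gridSize d r a b t := by
  rw [gridSize, Nat.ceil_pos]
  positivity

lemma betaConvex_mono (hr : 0 < r) (hb : 0 < b) {s t : ℕ} (hs : 0 < s) (hst : s ≤ t) :
    betaConvex d r a b s ≤ betaConvex d r a b t := by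
  rw [betaConvex_eq hr hb, betaConvex_eq hr hb]
  have h1 : 2 * (d : ℝ) * Real.log (gridSize d r a b s) ≤
      2 * d * Real.log (gridSize d r a b t) := by
    rcases Nat.eq_zero_or_pos d with rfl | hd
    · simp
    have h2 : (0 : ℝ) < gridSize d r a b s := by exact_mod_cast gridSize_pos hr hb hd hs
    have h3 : gridSize d r a b s ≤ gridSize d r a b t := by
      refine Nat.ceil_mono ?_
      gcongr
    gcongr
  gcongr

lemma two_mul_log_le_betaConvex (hr : 0 < r) (hb : 0 < b) (t : ℕ) :
    2 * Real.log (t ^ 2 / √(2 * Real.pi) + 1) ≤ betaConvex d r a b t := by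
  rw [betaConvex_eq hr hb]
  have := Real.log_natCast_nonneg (gridSize d r a b t)
  have h : 0 ≤ 2 * (d : ℝ) * Real.log (gridSize d r a b t) := by positivity
  linarith

lemma betaConvex_pos (hr : 0 < r) (hb : 0 < b) {t : ℕ} (ht : 0 < t) :
    0 < betaConvex d r a b t := by
  refine lt_of_lt_of_le ?_ (two_mul_log_le_betaConvex hr hb t)
  have : (0 : ℝ) < t ^ 2 / √(2 * Real.pi) := by positivity
  have := Real.log_pos (by linarith : 1 < (t : ℝ) ^ 2 / √(2 * Real.pi) + 1)
  positivity

lemma one_le_betaConvex (hr : 0 < r) (hb : 0 < b) : 1 ≤ betaConvex d r a b 2 := by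
  refine le_trans ?_ (two_mul_log_le_betaConvex hr hb 2)
  have := one_le_two_mul_log (t := (2 : ℕ)) (by norm_num) (N := 1) le_rfl
  simpa using this

/-- The grid is fine enough for the Lipschitz constant to make the error of the net at most
`1 / t ^ 2` in expectation, and `β` is the confidence parameter that its number of cells needs. -/
lemma SmoothPaths.exists_hasNet (h : SmoothPaths P f a b) (hr : 0 < r) (ha : 1 ≤ a) (hb : 0 < b)
    (hconv : Convex ℝ S) (hS : S ⊆ Set.Icc 0 (fun _ => r)) {t : ℕ} (ht : 0 < t) :
    ∃ F V, HasNet P f (betaConvex d r a b t) (1 / (t : ℝ) ^ 2) F V := by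
  obtain ⟨Λ, hΛint, hΛle, hΛ0, hΛ⟩ := h.exists_lipschitz hconv ha hb
  obtain ⟨F, hFcard, hF⟩ := exists_net_of_subset_cube hr hS
    (M := gridSize d r a b t) (fun j => gridSize_pos hr hb j.pos ht)
  set M := gridSize d r a b t with hM
  have ht' : (0 : ℝ) < t := by exact_mod_cast ht
  refine ⟨F, fun ω => Λ ω * (r / M), hΛint.mul_const _, ?_, ?_, ?_⟩
  · rw [integral_mul_const]
    rcases Nat.eq_zero_or_pos d with hd | hd
    · have : ∫ ω, Λ ω ∂P = 0 := by
        refine le_antisymm (hΛle.trans ?_) (integral_nonneg hΛ0)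
        simp [hd]
      rw [this, zero_mul]
      positivity
    have hM0 : (0 : ℝ) < M := by exact_mod_cast gridSize_pos hr hb hd ht
    have hle : b * d * r * t ^ 2 * (√(Real.log (a * d)) + √Real.pi / 2) ≤ M := Nat.le_ceil _
    have hlog : √(Real.log a) ≤ √(Real.log (a * d)) := by
      refine Real.sqrt_le_sqrt (Real.log_le_log (by linarith) ?_)
      have : (1 : ℝ) ≤ d := by exact_mod_cast hd
      nlinarith
    rw [← mul_div_assoc, div_le_div_iff₀ hM0 (by positivity), one_mul]
    refine le_trans ?_ hle
    calc (∫ ω, Λ ω ∂P) * r * t ^ 2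
        ≤ d * (b * (√(Real.log (a * d)) + √Real.pi / 2)) * r * t ^ 2 := by
          gcongr
          refine hΛle.trans ?_
          gcongr
      _ = _ := by ring
  · filter_upwards [hΛ] with ω hω z
    obtain ⟨w, hw, hzw⟩ := hF z
    exact ⟨w, hw, (hω z w).trans (mul_le_mul_of_nonneg_left hzw (hΛ0 ω))⟩
  · have hexp : Real.exp (-betaConvex d r a b t / 2) * (M : ℝ) ^ d =
        Real.exp (-Real.log (t ^ 2 / √(2 * Real.pi) + 1)) := by
      have e1 : Real.exp (-(d * Real.log M)) * (M : ℝ) ^ d = 1 := by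
        rcases Nat.eq_zero_or_pos d with hd | hd
        · simp [hd]
        have hM0 : (0 : ℝ) < M := by exact_mod_cast gridSize_pos hr hb hd ht
        have e2 : Real.exp (d * Real.log M) = (M : ℝ) ^ d := by
          rw [Real.exp_nat_mul, Real.exp_log hM0]
        rw [Real.exp_neg, e2, inv_mul_cancel₀ (by positivity)]
      have e3 : -betaConvex d r a b t / 2 = -(d * Real.log M) +
          -Real.log (t ^ 2 / √(2 * Real.pi) + 1) := by
        rw [betaConvex_eq hr hb]; ring
      rw [e3, Real.exp_add, mul_right_comm, e1, one_mul]
    have h1 := mul_exp_neg_log_le (N := 1) (t := t) zero_le_one ht'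
    simp only [one_mul] at h1
    refine le_trans ?_ h1
    rw [← hexp]
    have hcard : (F.card : ℝ) ≤ (M : ℝ) ^ d := by exact_mod_cast hFcard
    calc (F.card : ℝ) * ((√(2 * Real.pi))⁻¹ * Real.exp (-betaConvex d r a b t / 2))
        ≤ (M : ℝ) ^ d * ((√(2 * Real.pi))⁻¹ * Real.exp (-betaConvex d r a b t / 2)) := by gcongr
      _ = _ := by ring

end Smooth
end BO

theorem mainTheorem8 (σ : ℝ) (hσ : 0 < σ) :
    ∃ C : ℝ → ℝ,
      ∀ (Ω : Type u) [MeasurableSpace Ω] (P : Measure Ω) [IsProbabilityMeasure P]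
        (Θ : Type v) [MeasurableSpace Θ] (U : Ω → Θ)
        (d : ℕ) (S : Set (Fin d → ℝ)) (k : S → S → ℝ)
        (f : S → Ω → ℝ) (ε : ℕ → Ω → ℝ) (x : ℕ → Ω → S),
        (∀ z, 0 < k z z ∧ k z z ≤ 1) →
        BO.IsModel P k σ f ε U →
        -- finite domain
        (S.Finite →
          BO.IsRescaledEIRun k σ (BO.betaFinite S.ncard) f ε U x →
          (∀ n, Integrable (BO.regret f x n) P) ∧
          ∀ T : ℕ, 2 ≤ T → BO.BCR P f x T ≤
            C (⨅ z, k z z) *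
              √(BO.betaFinite S.ncard T * BO.maxInfoGain P f ε T * T * Real.log T)) ∧
        -- compact convex domain
        (∀ r a b : ℝ, 0 < r → 1 ≤ a → 0 < b →
          IsCompact S → Convex ℝ S → S ⊆ Set.Icc 0 (fun _ => r) →
          BO.SmoothPaths P f a b →
          BO.IsRescaledEIRun k σ (BO.betaConvex d r a b) f ε U x →
          (∀ n, Integrable (BO.regret f x n) P) ∧
          ∀ T : ℕ, 2 ≤ T → BO.BCR P f x T ≤
            C (⨅ z, k z z) *
              √(BO.betaConvex d r a b T * BO.maxInfoGain P f ε T * T * Real.log T)) := by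
  refine ⟨BO.regretConst σ, fun Ω _ P _ Θ _ U d S k f ε x hk hM => ?_⟩
  obtain ⟨ω₀⟩ := nonempty_of_isProbabilityMeasure P
  have hne : Nonempty S := ⟨x 0 ω₀⟩
  refine ⟨fun hfin hrun => ?_, fun r a b hr ha hb hcomp hconv hS hsm hrun => ?_⟩
  · have : Finite S := hfin
    have : Fintype S := Fintype.ofFinite S
    have hcard : S.ncard = Fintype.card S := by
      rw [← Nat.card_coe_set_eq, Nat.card_eq_fintype_card]
    rw [hcard] at hrun ⊢
    have hN : 0 < Fintype.card S := Fintype.card_pos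
    refine BO.regret_bound hM hσ hk (ae_of_all _ fun ω => continuous_of_discreteTopology) hrun
      (fun n m hnm => BO.betaFinite_mono _ (by omega)) (BO.betaFinite_pos hN one_pos)
      (BO.one_le_betaFinite hN) fun n => ?_
    have h := BO.hasNet_univ (P := P) (f := f) (Nat.succ_pos n)
    rw [Nat.cast_succ] at h
    exact ⟨_, _, h⟩
  · have : CompactSpace S := isCompact_iff_compactSpace.1 hcomp
    refine BO.regret_bound hM hσ hk hsm.ae_continuous hrun
      (fun n m hnm => BO.betaConvex_mono hr hb n.succ_pos (by omega))
      (BO.betaConvex_pos hr hb one_pos) (BO.one_le_betaConvex hr hb) fun n => ?_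
    have h := hsm.exists_hasNet hr ha hb hconv hS (Nat.succ_pos n)
    rwa [Nat.cast_succ] at h
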